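/- Let $\gamma>1$, $\rho(s)=\bigl(1-\frac{\gamma-1}{2}s\bigr)^{1/(\gamma-1)}$, $q_{\max}=\sqrt{2/(\gamma-1)}$ and $c_*=\sqrt{2/(\gamma+1)}$. **Sonic curves.** Let $D$ be a plane nozzle with a lower and an upper wall, and let $q$ be the speed of a flow in $\overline D$. The flow is transonic of Meyer type with (positively oriented) sonic curve $S$ if $S:[0,1]\to\overline D$ is an injective regular $C^2$ curve whose image is the set $\{q=c_*\}$ of all sonic points of $\overline D$, $S(s)\in D$ for $0<s<1$, one endpoint of $S$ lies on the lower wall and the other on the upper wall (not at an end of the wall), $S$ is contained in the boundary of the subsonic region $\{q<c_*\}$ and in the boundary of the supersonic region $\{q>c_*\}$, and $S$ is run through in its positive direction, i.e. with the subsonic region on its left. A point of $S$ is exceptional if the derivative of the flow angle $\theta$ along $S$ vanishes there. **(1) Potential plane.** Let $G=\{(\varphi,\psi): g_1(\psi)<\varphi<g_2(\psi),\ \psi_1<\psi<\psi_2\}$ with $\psi_1<\psi_2$ and continuous $g_1<g_2$ on $[\psi_1,\psi_2]$; the walls are $\psi=\psi_1$ (lower) and $\psi=\psi_2$ (upper).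 Let $q,\theta\in C^2(\overline G)$ with $0<q<q_{\max}$ satisfy the Chaplygin equations $$\frac{\partial\theta}{\partial\psi}+\frac{\rho(q^2)+2q^2\rho'(q^2)}{q\rho^2(q^2)}\frac{\partial q}{\partial\varphi}=0,\qquad \frac1q\frac{\partial q}{\partial\psi}-\frac1{\rho(q^2)}\frac{\partial\theta}{\partial\varphi}=0\qquad\text{in }G,$$ and suppose that this flow is transonic of Meyer type with sonic curve $S$. Then $S$ is the disjoint union of three connected (possibly empty) parts $S_e,S_+,S_-$, where $S_e$ is the set of exceptional points, $S_+$, if not empty, contains the endpoint of $S$ on the upper wall, and $S_-$, if not empty, contains the endpoint of $S$ on the lower wall. Moreover: (i) $S_e$ is a closed segment parallel to the $\psi$-axis (possibly empty or a single point); (ii) $S_+$ and $S_-$ are graphs of functions of $\varphi$; along the positive direction of $S$, $\varphi$ is strictly decreasing on $S_+$ and strictly increasing on $S_-$; (iii) if $S_e=\emptyset$, then $S=S_+$ or $S=S_-$. **(2) Physical plane.** Let $\mathcal G=\{(x,y): f_1(x)<y<f_2(x),\ l_1<x<l_2\}$ with $l_1<l_2$ and $C^1$ functions $f_1<f_2$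 on $[l_1,l_2]$; the walls are $y=f_1(x)$ (lower) and $y=f_2(x)$ (upper). Let $u,v\in C^2(\overline{\mathcal G})$ with $0<q=\sqrt{u^2+v^2}<q_{\max}$ satisfy $$\partial_x(\rho(q^2)u)+\partial_y(\rho(q^2)v)=0,\qquad \partial_yu=\partial_xv\qquad\text{in }\mathcal G,$$ and let $\theta$ be its continuous flow angle, $(u,v)=q(\cos\theta,\sin\theta)$, $\varphi$ a velocity potential, $\nabla\varphi=(u,v)$, and $\psi$ a stream function, $\nabla\psi=\rho(q^2)(-v,u)$. Assume that the change of coordinates $(x,y)\mapsto(\varphi,\psi)$ maps $\overline{\mathcal G}$ bijectively onto $\overline G$ for some nozzle $G$ as in (1), with $\psi=\psi_1$ on the lower and $\psi=\psi_2$ on the upper wall. Suppose that the flow is transonic of Meyer type with sonic curve $\mathcal S$. Then $\mathcal S$ is the disjoint union of three connected (possibly empty) parts $\mathcal S_e,\mathcal S_+,\mathcal S_-$, where $\mathcal S_e$ is the set of exceptional points and is a closed line segment (possibly empty or a single point), $\mathcal S_+$, if not empty, contains the endpoint of $\mathcal S$ on the upper wall, $\mathcal S_-$, if not empty, contains the endpoint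 of $\mathcal S$ on the lower wall, and $\mathcal S=\mathcal S_+$ or $\mathcal S=\mathcal S_-$ if $\mathcal S_e=\emptyset$. Moreover, the images of $\mathcal S_e,\mathcal S_+,\mathcal S_-$ in the $(\varphi,\psi)$-plane have the properties (i) and (ii). -/

import Mathlib

open Set Filter Topology

noncomputable section

namespace TransonicFlow

/-! ### The gas -/

/-- Bernoulli law for a polytropic gas: the density as a function of the square `s = q²` of the
speed. -/
def density (γ s : ℝ) : ℝ := (1 - (γ - 1) / 2 * s) ^ (1 / (γ - 1))

/-- The critical (sonic) speed. -/
def critSpeed (γ : ℝ) : ℝ := Real.sqrt (2 / (γ + 1))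

/-- The limiting speed, at which the density vanishes. -/
def maxSpeed (γ : ℝ) : ℝ := Real.sqrt (2 / (γ - 1))

/-! ### Plane notation -/

/-- Partial derivative in the first coordinate. -/
def pd₁ (f : ℝ × ℝ → ℝ) (p : ℝ × ℝ) : ℝ := fderiv ℝ f p (1, 0)

/-- Partial derivative in the second coordinate. -/
def pd₂ (f : ℝ × ℝ → ℝ) (p : ℝ × ℝ) : ℝ := fderiv ℝ f p (0, 1)

/-- Rotation by a right angle to the left. -/
def rotLeft (w : ℝ × ℝ) : ℝ × ℝ := (-w.2, w.1)

/-! ### Sonic curves of Meyer type -/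

/-- `S : [0,1] → closure D` is the positively oriented sonic curve of a transonic flow of Meyer type
in the nozzle `D`, where `c` is the sonic speed, `q` the speed, and `Wl`, `Wu` are the lower and the
upper wall without their endpoints. -/
structure IsMeyerSonicCurve (c : ℝ) (D Wl Wu : Set (ℝ × ℝ)) (q : ℝ × ℝ → ℝ)
    (S : ℝ → ℝ × ℝ) : Prop where
  contDiffOn : ContDiffOn ℝ 2 S (Icc 0 1)
  regular : ∀ s ∈ Icc (0 : ℝ) 1, derivWithin S (Icc 0 1) s ≠ 0
  injOn : InjOn S (Icc 0 1)
  /-- the curve consists of all sonic points -/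
  image_eq : S '' Icc 0 1 = {p ∈ closure D | q p = c}
  /-- it runs inside the nozzle -/
  mem_nozzle : ∀ s ∈ Ioo (0 : ℝ) 1, S s ∈ D
  /-- from one wall to the other -/
  ends : (S 0 ∈ Wl ∧ S 1 ∈ Wu) ∨ (S 0 ∈ Wu ∧ S 1 ∈ Wl)
  /-- it belongs to the boundary of the subsonic region -/
  subsonic_frontier : S '' Icc 0 1 ⊆ frontier {p ∈ D | q p < c}
  /-- and to the boundary of the supersonic region -/
  supersonic_frontier : S '' Icc 0 1 ⊆ frontier {p ∈ D | c < q p}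
  /-- positive direction: the subsonic region is located on the left -/
  left_subsonic : ∀ s ∈ Ioo (0 : ℝ) 1,
    ∀ᶠ t in 𝓝[>] (0 : ℝ), q (S s + t • rotLeft (derivWithin S (Icc 0 1) s)) < c

/-- The exceptional points of the sonic curve `S`: the points where the derivative of the flow angle
`θ` along the curve vanishes. (The parametrization is regular, so this does not depend on whether the
derivative is taken with respect to the parameter or to arc length.) -/
def exceptionalSet (θ : ℝ × ℝ → ℝ) (S : ℝ → ℝ × ℝ) : Set (ℝ × ℝ) :=
  S '' {s ∈ Icc (0 : ℝ) 1 | derivWithin (fun r => θ (S r)) (Icc 0 1) s = 0}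

/-- The curve `T` is the disjoint union of three connected, possibly empty parts `Te`, `Tp`, `Tm`,
where `Tp` reaches the upper and `Tm` the lower wall (if not empty), and `T = Tp` or `T = Tm` if
`Te` is empty. -/
structure IsDecomposition (Wl Wu T Te Tp Tm : Set (ℝ × ℝ)) : Prop where
  union_eq : T = Te ∪ Tp ∪ Tm
  disjoint_ep : Disjoint Te Tp
  disjoint_em : Disjoint Te Tm
  disjoint_pm : Disjoint Tp Tm
  preconnected_e : IsPreconnected Te
  preconnected_p : IsPreconnected Tp
  preconnected_m : IsPreconnected Tm
  upper : Tp.Nonempty → (Tp ∩ Wu).Nonempty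
  lower : Tm.Nonempty → (Tm ∩ Wl).Nonempty
  eq_of_empty : Te = ∅ → T = Tp ∨ T = Tm

/-- Shape of the three parts in the potential plane, with coordinates `(φ, ψ)`: `Te` is a closed
segment parallel to the `ψ`-axis (possibly empty or one point), `Tp` and `Tm` are graphs over `φ`,
and along the direction in which `S` is run through, `φ` is strictly decreasing on `Tp` and strictly
increasing on `Tm`. -/
structure HasPotentialShape (S : ℝ → ℝ × ℝ) (Te Tp Tm : Set (ℝ × ℝ)) : Prop where
  segment : Te = ∅ ∨ ∃ φ₀ a b : ℝ, a ≤ b ∧ Te = {φ₀} ×ˢ Icc a b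
  graph_p : ∃ h : ℝ → ℝ, ∀ p ∈ Tp, p.2 = h p.1
  graph_m : ∃ h : ℝ → ℝ, ∀ p ∈ Tm, p.2 = h p.1
  decreasing : ∀ s ∈ Icc (0 : ℝ) 1, ∀ t ∈ Icc (0 : ℝ) 1,
    S s ∈ Tp → S t ∈ Tp → s < t → (S t).1 < (S s).1
  increasing : ∀ s ∈ Icc (0 : ℝ) 1, ∀ t ∈ Icc (0 : ℝ) 1,
    S s ∈ Tm → S t ∈ Tm → s < t → (S s).1 < (S t).1

/-! ### Flows in the potential plane -/

/-- The data `g₁, g₂, ψ₁, ψ₂` describe a nozzle in the potential plane. -/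
structure IsPotNozzle (g₁ g₂ : ℝ → ℝ) (ψ₁ ψ₂ : ℝ) : Prop where
  lt : ψ₁ < ψ₂
  cont₁ : ContinuousOn g₁ (Icc ψ₁ ψ₂)
  cont₂ : ContinuousOn g₂ (Icc ψ₁ ψ₂)
  g_lt : ∀ ψ ∈ Icc ψ₁ ψ₂, g₁ ψ < g₂ ψ

/-- The nozzle `G = {(φ, ψ) : g₁(ψ) < φ < g₂(ψ), ψ₁ < ψ < ψ₂}`. -/
def potNozzle (g₁ g₂ : ℝ → ℝ) (ψ₁ ψ₂ : ℝ) : Set (ℝ × ℝ) :=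
  {p | p.2 ∈ Ioo ψ₁ ψ₂ ∧ p.1 ∈ Ioo (g₁ p.2) (g₂ p.2)}

/-- The wall `ψ = ψ₀` of the nozzle in the potential plane, without its endpoints. -/
def potWall (g₁ g₂ : ℝ → ℝ) (ψ₀ : ℝ) : Set (ℝ × ℝ) :=
  {p | p.2 = ψ₀ ∧ p.1 ∈ Ioo (g₁ ψ₀) (g₂ ψ₀)}

/-- `(q, θ)` (speed and flow angle) is a flow of class `C²(closure G)` in the potential plane: it
solves the Chaplygin equations in `G`. -/
structure IsPotFlow (γ : ℝ) (G : Set (ℝ × ℝ)) (q θ : ℝ × ℝ → ℝ) : Prop where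
  contDiffOn_q : ContDiffOn ℝ 2 q (closure G)
  contDiffOn_θ : ContDiffOn ℝ 2 θ (closure G)
  pos : ∀ p ∈ closure G, 0 < q p
  lt_max : ∀ p ∈ closure G, q p < maxSpeed γ
  chaplygin₁ : ∀ p ∈ G,
    pd₂ θ p + (density γ (q p ^ 2) + 2 * q p ^ 2 * deriv (density γ) (q p ^ 2)) /
      (q p * density γ (q p ^ 2) ^ 2) * pd₁ q p = 0
  chaplygin₂ : ∀ p ∈ G, 1 / q p * pd₂ q p - 1 / density γ (q p ^ 2) * pd₁ θ p = 0

/-! ### Flows in the physical plane -/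

/-- The data `f₁, f₂, l₁, l₂` describe a nozzle in the physical plane. -/
structure IsPhysNozzle (f₁ f₂ : ℝ → ℝ) (l₁ l₂ : ℝ) : Prop where
  lt : l₁ < l₂
  contDiffOn₁ : ContDiffOn ℝ 1 f₁ (Icc l₁ l₂)
  contDiffOn₂ : ContDiffOn ℝ 1 f₂ (Icc l₁ l₂)
  f_lt : ∀ x ∈ Icc l₁ l₂, f₁ x < f₂ x

/-- The nozzle `{(x, y) : f₁(x) < y < f₂(x), l₁ < x < l₂}`. -/
def physNozzle (f₁ f₂ : ℝ → ℝ) (l₁ l₂ : ℝ) : Set (ℝ × ℝ) :=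
  {p | p.1 ∈ Ioo l₁ l₂ ∧ p.2 ∈ Ioo (f₁ p.1) (f₂ p.1)}

/-- The wall `y = f(x)` of the nozzle in the physical plane, without its endpoints. -/
def physWall (f : ℝ → ℝ) (l₁ l₂ : ℝ) : Set (ℝ × ℝ) :=
  {p | p.1 ∈ Ioo l₁ l₂ ∧ p.2 = f p.1}

/-- The speed of the velocity field `(u, v)`. -/
def speed (u v : ℝ × ℝ → ℝ) (p : ℝ × ℝ) : ℝ := Real.sqrt (u p ^ 2 + v p ^ 2)

/-- The density of the flow with velocity field `(u, v)`. -/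
def flowDensity (γ : ℝ) (u v : ℝ × ℝ → ℝ) (p : ℝ × ℝ) : ℝ := density γ (speed u v p ^ 2)

/-- `(u, v)` is the velocity field of a steady isentropic irrotational flow of class
`C²(closure D)` in the region `D` of the physical plane, without stagnation points. -/
structure IsPhysFlow (γ : ℝ) (D : Set (ℝ × ℝ)) (u v : ℝ × ℝ → ℝ) : Prop where
  contDiffOn_u : ContDiffOn ℝ 2 u (closure D)
  contDiffOn_v : ContDiffOn ℝ 2 v (closure D)
  pos : ∀ p ∈ closure D, 0 < speed u v p
  lt_max : ∀ p ∈ closure D, speed u v p < maxSpeed γ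
  mass : ∀ p ∈ D,
    pd₁ (fun z => flowDensity γ u v z * u z) p + pd₂ (fun z => flowDensity γ u v z * v z) p = 0
  irrotational : ∀ p ∈ D, pd₂ u p = pd₁ v p

/-- `θ` is the (continuous) flow angle of the velocity field `(u, v)`. -/
structure IsFlowAngle (D : Set (ℝ × ℝ)) (u v θ : ℝ × ℝ → ℝ) : Prop where
  cont : ContinuousOn θ (closure D)
  u_eq : ∀ p ∈ closure D, u p = speed u v p * Real.cos (θ p)
  v_eq : ∀ p ∈ closure D, v p = speed u v p * Real.sin (θ p)

/-- `φ` is a velocity potential of `(u, v)`. -/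
structure IsVelocityPotential (D : Set (ℝ × ℝ)) (u v φ : ℝ × ℝ → ℝ) : Prop where
  cont : ContinuousOn φ (closure D)
  diff : DifferentiableOn ℝ φ D
  dx : ∀ p ∈ D, pd₁ φ p = u p
  dy : ∀ p ∈ D, pd₂ φ p = v p

/-- `ψ` is a stream function of `(u, v)`. -/
structure IsStreamFunction (γ : ℝ) (D : Set (ℝ × ℝ)) (u v ψ : ℝ × ℝ → ℝ) : Prop where
  cont : ContinuousOn ψ (closure D)
  diff : DifferentiableOn ℝ ψ D
  dx : ∀ p ∈ D, pd₁ ψ p = -(flowDensity γ u v p * v p)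
  dy : ∀ p ∈ D, pd₂ ψ p = flowDensity γ u v p * u p

/-- The coordinate transformation from the physical to the potential plane. -/
def toPot (φ ψ : ℝ × ℝ → ℝ) (p : ℝ × ℝ) : ℝ × ℝ := (φ p, ψ p)

/-- The potential-stream coordinates represent the physical nozzle as the nozzle
`{g₁(ψ) < φ < g₂(ψ), ψ₁ < ψ < ψ₂}` of the potential plane, where the lower and the upper wall are the
streamlines `ψ = ψ₁` and `ψ = ψ₂` (slip condition). -/
structure IsPotRepresentation (f₁ f₂ : ℝ → ℝ) (l₁ l₂ : ℝ) (g₁ g₂ : ℝ → ℝ) (ψ₁ ψ₂ : ℝ)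
    (φ ψ : ℝ × ℝ → ℝ) : Prop where
  bijOn : BijOn (toPot φ ψ) (closure (physNozzle f₁ f₂ l₁ l₂)) (closure (potNozzle g₁ g₂ ψ₁ ψ₂))
  lower : ∀ x ∈ Icc l₁ l₂, ψ (x, f₁ x) = ψ₁
  upper : ∀ x ∈ Icc l₁ l₂, ψ (x, f₂ x) = ψ₂

end TransonicFlow

end

/-!
Everything takes place in the potential plane. Elimination of `θ` from the Chaplygin system
`θ_ψ = -K(q) q_φ`, `θ_φ = B(q) q_ψ` gives `B q_ψψ = -(K q_φφ + K' q_φ² + B' q_ψ²)`, and at the sonic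
speed `c` one has `K = 0`, `K' < 0`, `B > 0`, `B' < 0`. So `|q_ψψ|` is bounded by a multiple of
`|q - c| + q_φ² + q_ψ²`, and `(c - q)_ψψ ≤ C (c - q)` in the subsonic region
(`growth_of_chaplygin`). Since `K(c) = 0`, the derivative of the flow angle along the sonic curve
`S` is `B(c) q_ψ φ'`. A positive function with `u'' ≤ C u` cannot satisfy `u = u' = 0` at an
endpoint (`false_of_pos_of_second_deriv_le`). This is applied twice, on vertical rays issuing from
`S`.

* Where `φ' ≠ 0`, also `q_ψ ≠ 0` (`IsSonicArc.pd₂_ne_zero`). Otherwise the gradient of `q` would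
  vanish; in a sector around a vertical ray `q - c` has a sign, so that its modulus controls the
  squares of its first derivatives, and `u = |q - c|` on the ray is a forbidden solution. Hence the
  exceptional points are the points with a vertical tangent, `φ' = 0`.
* From a point with a vertical tangent, `S` cannot turn to the supersonic side of the vertical ray
  on which it starts (`IsSonicArc.no_turn`). Otherwise the ray would be subsonic and `u = c - q` on it
  a forbidden solution. Consequently the tangent angle passes vertical directions only upwards
  (`IsSonicArc.angle_crossing`).

The second fact is local. To exclude that the tangent angle leaves the range in which it determines
the sign of `φ'`, it has to be known at both ends: `S` runs from one wall `ψ = const` to the other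
between these walls, and Hopf's homotopy of the tangents to the secants (`exists_secant_angle`)
shows that, up to orientation, one continuous branch of the tangent angle belongs to `[0, π]` at both
ends. It follows that `φ` is monotone before and after the exceptional points, in opposite senses
(`IsSonicArc.monotone_before_antitone_after`), and the decomposition according to the sign of `φ'`
has all required properties.

A flow in the physical plane is transported to the potential plane by the coordinates `(φ, ψ)`; the
inverse of the transformation is continuous up to the boundary by compactness and `C²` in the
interior by the inverse function theorem. The data on the boundary of the image enter only as limits,
whose existence follows from the regularity of `u` and `v` up to the boundary
(`IsRepresentedFlow.exists_isSonicFlow`). Along the exceptional part the velocity is constant and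
orthogonal to the curve, which is therefore straight.
-/

noncomputable section

namespace TransonicFlow

/-! ### Lemmas on functions of one variable -/

/-- A function with a bounded derivative on `(0, r)` that vanishes at `0` is bounded linearly. -/
theorem abs_le_mul_of_tendsto_zero {f f' : ℝ → ℝ} {r C : ℝ}
    (hf : ∀ y ∈ Ioo 0 r, HasDerivAt f (f' y) y) (hC : ∀ y ∈ Ioo 0 r, |f' y| ≤ C)
    (h0 : Tendsto f (𝓝[>] 0) (𝓝 0)) : ∀ y ∈ Ioo 0 r, |f y| ≤ C * y := by
  intro y hy
  have hlim : Tendsto (fun t => |f y - f t|) (𝓝[>] 0) (𝓝 |f y - 0|) :=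
    (tendsto_const_nhds.sub h0).abs
  have hlim' : Tendsto (fun t : ℝ => C * (y - t)) (𝓝[>] 0) (𝓝 (C * (y - 0))) :=
    (Continuous.tendsto (by fun_prop) 0).mono_left nhdsWithin_le_nhds
  have key : |f y - 0| ≤ C * (y - 0) := by
    refine le_of_tendsto_of_tendsto hlim hlim' ?_
    filter_upwards [Ioo_mem_nhdsGT hy.1] with t ht
    have := (convex_Icc t y).norm_image_sub_le_of_norm_hasDerivWithin_le
      (f := f) (f' := f') (C := C)
      (fun x hx => (hf x ⟨ht.1.trans_le hx.1, hx.2.trans_lt hy.2⟩).hasDerivWithinAt)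
      (fun x hx => hC x ⟨ht.1.trans_le hx.1, hx.2.trans_lt hy.2⟩)
      (left_mem_Icc.2 ht.2.le) (right_mem_Icc.2 ht.2.le)
    rwa [Real.norm_eq_abs, Real.norm_eq_abs, abs_of_pos (sub_pos.2 ht.2)] at this
  simpa using key

/-- A positive function with `u'' ≤ C u` cannot vanish together with its derivative at an
endpoint. -/
theorem false_of_pos_of_second_deriv_le {u u' u'' : ℝ → ℝ} {r C : ℝ} (hr : 0 < r) (hC : 0 ≤ C)
    (hu : ∀ y ∈ Ioo 0 r, HasDerivAt u (u' y) y) (hu' : ∀ y ∈ Ioo 0 r, HasDerivAt u' (u'' y) y)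
    (hpos : ∀ y ∈ Ioo 0 r, 0 < u y) (hle : ∀ y ∈ Ioo 0 r, u'' y ≤ C * u y)
    (h0 : Tendsto u (𝓝[>] 0) (𝓝 0)) (h0' : Tendsto u' (𝓝[>] 0) (𝓝 0)) : False := by
  obtain ⟨h, hh0, hhr, hhC⟩ : ∃ h, 0 < h ∧ h < r ∧ C * h ^ 2 < 1 := by
    have : Tendsto (fun h : ℝ => C * h ^ 2) (𝓝[>] 0) (𝓝 (C * 0 ^ 2)) :=
      (Continuous.tendsto (by fun_prop) 0).mono_left nhdsWithin_le_nhds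
    have h1 := this.eventually (gt_mem_nhds (show C * (0 : ℝ) ^ 2 < 1 by norm_num))
    obtain ⟨h, h2, h3⟩ := (h1.and (Ioo_mem_nhdsGT hr)).exists
    exact ⟨h, h3.1, h3.2, h2⟩
  -- `v` extends `u` continuously to `[0, h]`, so that it attains its maximum `M`
  let v := Function.update u 0 0
  have hv : ∀ y, 0 < y → v y = u y := fun y hy => Function.update_of_ne hy.ne' _ _
  have hv0 : v 0 = 0 := Function.update_self _ _ _
  have hvc : ContinuousOn v (Icc 0 h) := by
    intro y hy
    rcases hy.1.eq_or_lt with rfl | hy0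
    · have : ContinuousWithinAt v (Ioi 0) 0 := by
        rw [continuousWithinAt_update_same]
        exact h0.mono_left (nhdsWithin_mono _ sdiff_subset)
      exact (continuousWithinAt_Ioi_iff_Ici.1 this).mono Icc_subset_Ici_self
    · have h1 : ContinuousAt u y := (hu y ⟨hy0, hy.2.trans_lt hhr⟩).continuousAt
      refine (h1.congr ?_).continuousWithinAt
      filter_upwards [lt_mem_nhds hy0] with z hz using (hv z hz).symm
  obtain ⟨m, hm, hmax⟩ := isCompact_Icc.exists_isMaxOn ⟨h, hh0.le, le_rfl⟩ hvc
  have hMh := hmax (show h ∈ Icc 0 h from ⟨hh0.le, le_rfl⟩)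
  simp only [mem_ofPred_eq] at hMh
  rw [hv h hh0] at hMh
  have hM : 0 < v m := (hpos h ⟨hh0, hhr⟩).trans_le hMh
  have hm0 : 0 < m := by
    rcases hm.1.eq_or_lt with h1 | h1
    · rw [← h1, hv0] at hM; exact absurd hM (lt_irrefl _)
    · exact h1
  have hmr : m < r := hm.2.trans_lt hhr
  have hub : ∀ y ∈ Ioo 0 h, u y ≤ v m := fun y hy => by
    have := hmax (show y ∈ Icc 0 h from ⟨hy.1.le, hy.2.le⟩)
    simp only [mem_ofPred_eq] at this
    rwa [hv y hy.1] at this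
  -- integrating `u'' ≤ C M` twice
  have hg' : ∀ y ∈ Ioo 0 h, u' y ≤ C * v m * y := by
    intro y hy
    have hlim : Tendsto (fun t => u' t + C * v m * (y - t)) (𝓝[>] 0) (𝓝 (0 + C * v m * (y - 0))) :=
      h0'.add ((Continuous.tendsto (by fun_prop) 0).mono_left nhdsWithin_le_nhds)
    have : u' y ≤ 0 + C * v m * (y - 0) := by
      refine ge_of_tendsto hlim ?_
      filter_upwards [Ioo_mem_nhdsGT hy.1] with t ht
      have := (convex_Icc t y).image_sub_le_mul_sub_of_deriv_le (f := u') (C := C * v m)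
        (fun x hx => (hu' x ⟨ht.1.trans_le hx.1,
          hx.2.trans_lt (hy.2.trans hhr)⟩).continuousAt.continuousWithinAt)
        (fun x hx => by
          rw [interior_Icc] at hx
          exact (hu' x ⟨ht.1.trans hx.1, hx.2.trans
            (hy.2.trans hhr)⟩).differentiableAt.differentiableWithinAt)
        (fun x hx => by
          rw [interior_Icc] at hx
          have hxr : x ∈ Ioo 0 r := ⟨ht.1.trans hx.1, hx.2.trans (hy.2.trans hhr)⟩
          rw [(hu' x hxr).deriv]
          exact (hle x hxr).trans (mul_le_mul_of_nonneg_left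
            (hub x ⟨hxr.1, hx.2.trans hy.2⟩) hC))
        t (left_mem_Icc.2 ht.2.le) y (right_mem_Icc.2 ht.2.le) ht.2.le
      linarith
    simpa using this
  have hg : u m ≤ C * v m * h * m := by
    have hlim : Tendsto (fun t => u t + C * v m * h * (m - t)) (𝓝[>] 0)
        (𝓝 (0 + C * v m * h * (m - 0))) :=
      h0.add ((Continuous.tendsto (by fun_prop) 0).mono_left nhdsWithin_le_nhds)
    have : u m ≤ 0 + C * v m * h * (m - 0) := by
      refine ge_of_tendsto hlim ?_
      filter_upwards [Ioo_mem_nhdsGT hm0] with t ht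
      have := (convex_Icc t m).image_sub_le_mul_sub_of_deriv_le (f := u) (C := C * v m * h)
        (fun x hx => (hu x ⟨ht.1.trans_le hx.1,
          hx.2.trans_lt hmr⟩).continuousAt.continuousWithinAt)
        (fun x hx => by
          rw [interior_Icc] at hx
          exact (hu x ⟨ht.1.trans hx.1, hx.2.trans
            hmr⟩).differentiableAt.differentiableWithinAt)
        (fun x hx => by
          rw [interior_Icc] at hx
          have hxr : x ∈ Ioo 0 h := ⟨ht.1.trans hx.1, hx.2.trans_le hm.2⟩
          rw [(hu x ⟨hxr.1, hxr.2.trans hhr⟩).deriv]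
          exact (hg' x hxr).trans (mul_le_mul_of_nonneg_left hxr.2.le (by positivity)))
        t (left_mem_Icc.2 ht.2.le) m (right_mem_Icc.2 ht.2.le) ht.2.le
      linarith
    simpa using this
  rw [← hv m hm0] at hg
  have : C * v m * h * m ≤ C * h ^ 2 * v m := by
    have : C * v m * h * m ≤ C * v m * h * h :=
      mul_le_mul_of_nonneg_left hm.2 (by positivity)
    linarith
  nlinarith

/-- The gradient of a nonnegative function with `f'' ≤ M` is controlled by the square root of the
function, if there is enough room. -/
theorem sq_deriv_le_of_nonneg {f f' f'' : ℝ → ℝ} {x h M : ℝ} (hM : 0 < M)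
    (hf : ∀ t ∈ Icc (x - h) (x + h), HasDerivAt f (f' t) t)
    (hf' : ∀ t ∈ Icc (x - h) (x + h), HasDerivAt f' (f'' t) t)
    (hnn : ∀ t ∈ Icc (x - h) (x + h), 0 ≤ f t) (hle : ∀ t ∈ Icc (x - h) (x + h), f'' t ≤ M)
    (hh : |f' x| ≤ M * h) : f' x ^ 2 ≤ 2 * M * f x := by
  have hh0 : 0 ≤ h := by
    have := (abs_nonneg _).trans hh
    exact nonneg_of_mul_nonneg_right this hM
  -- `f` lies below the parabola with second derivative `M` that is tangent to it at `x`; this is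
  -- used at the minimum of the parabola
  have key : ∀ t ∈ Icc (x - h) (x + h), f t ≤ f x + f' x * (t - x) + M / 2 * (t - x) ^ 2 := by
    let g : ℝ → ℝ := fun t => f t - f x - f' x * (t - x) - M / 2 * (t - x) ^ 2
    let g' : ℝ → ℝ := fun t => f' t - f' x - M * (t - x)
    have hg : ∀ t ∈ Icc (x - h) (x + h), HasDerivAt g (g' t) t := fun t ht => by
      have := (((hf t ht).sub_const (f x)).sub
        (((hasDerivAt_id t).sub_const x).const_mul (f' x))).sub
        ((((hasDerivAt_id t).sub_const x).pow 2).const_mul (M / 2))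
      refine this.congr_deriv ?_
      simp [g']
      ring
    have hg' : ∀ t ∈ Icc (x - h) (x + h), HasDerivAt g' (f'' t - M) t := fun t ht => by
      have := ((hf' t ht).sub_const (f' x)).sub (((hasDerivAt_id t).sub_const x).const_mul M)
      refine this.congr_deriv ?_
      simp
    have hanti : AntitoneOn g' (Icc (x - h) (x + h)) := by
      refine antitoneOn_of_deriv_nonpos (convex_Icc _ _)
        (fun t ht => (hg' t ht).continuousAt.continuousWithinAt)
        (fun t ht => (hg' t (interior_subset ht)).differentiableAt.differentiableWithinAt)
        (fun t ht => ?_)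
      rw [(hg' t (interior_subset ht)).deriv]
      linarith [hle t (interior_subset ht)]
    have hx : x ∈ Icc (x - h) (x + h) := ⟨by linarith, by linarith⟩
    have hg'x : g' x = 0 := by simp [g']
    have hgx : g x = 0 := by simp [g]
    intro t ht
    have hgt : g t ≤ 0 := by
      rcases le_total x t with hxt | hxt
      · have hsub : Icc x t ⊆ Icc (x - h) (x + h) := Icc_subset_Icc hx.1 ht.2
        have : AntitoneOn g (Icc x t) := by
          refine antitoneOn_of_deriv_nonpos (convex_Icc _ _)
            (fun s hs => (hg s (hsub hs)).continuousAt.continuousWithinAt)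
            (fun s hs => (hg s (hsub (interior_subset hs))).differentiableAt.differentiableWithinAt)
            (fun s hs => ?_)
          have hs' := interior_subset hs
          rw [(hg s (hsub hs')).deriv, ← hg'x]
          exact hanti hx (hsub hs') hs'.1
        rw [← hgx]
        exact this (left_mem_Icc.2 hxt) (right_mem_Icc.2 hxt) hxt
      · have hsub : Icc t x ⊆ Icc (x - h) (x + h) := Icc_subset_Icc ht.1 hx.2
        have : MonotoneOn g (Icc t x) := by
          refine monotoneOn_of_deriv_nonneg (convex_Icc _ _)
            (fun s hs => (hg s (hsub hs)).continuousAt.continuousWithinAt)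
            (fun s hs => (hg s (hsub (interior_subset hs))).differentiableAt.differentiableWithinAt)
            (fun s hs => ?_)
          have hs' := interior_subset hs
          rw [(hg s (hsub hs')).deriv, ← hg'x]
          exact hanti (hsub hs') hx hs'.2
        rw [← hgx]
        exact this (left_mem_Icc.2 hxt) (right_mem_Icc.2 hxt) hxt
    simp only [g] at hgt
    linarith
  have hb := abs_le.1 hh
  have ht : x - f' x / M ∈ Icc (x - h) (x + h) := by
    constructor
    · have : f' x / M ≤ h := by rw [div_le_iff₀ hM]; linarith
      linarith
    · have : -h ≤ f' x / M := by rw [le_div_iff₀ hM]; linarith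
      linarith
  have h1 := (hnn _ ht).trans (key _ ht)
  have h2 : f x + f' x * (x - f' x / M - x) + M / 2 * (x - f' x / M - x) ^ 2
      = f x - f' x ^ 2 / (2 * M) := by
    field_simp
    ring
  rw [h2, sub_nonneg, div_le_iff₀ (by positivity)] at h1
  linarith

/-- If a curve is continuous on `[0,1]` and has a derivative in the interior which extends
continuously to the endpoints, then it has this derivative at the endpoints, too; and it is the
restriction of a curve which is an antiderivative on the whole line. -/
theorem exists_antideriv_eqOn {E : Type*} [NormedAddCommGroup E] [NormedSpace ℝ E]
    [CompleteSpace E] {S T : ℝ → E} (hS : ContinuousOn S (Icc 0 1))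
    (hST : ∀ s ∈ Ioo (0 : ℝ) 1, HasDerivAt S (T s) s) (hT : ContinuousOn T (Icc 0 1)) :
    ∃ F T' : ℝ → E, Continuous T' ∧ (∀ s, HasDerivAt F (T' s) s) ∧ EqOn F S (Icc 0 1) ∧
      EqOn T' T (Icc 0 1) := by
  let T' : ℝ → E := IccExtend zero_le_one ((Icc (0 : ℝ) 1).domRestrict T)
  have hT' : Continuous T' := (continuousOn_iff_continuous_domRestrict.1 hT).Icc_extend'
  have hTT : EqOn T' T (Icc 0 1) := fun s hs => IccExtend_of_mem _ _ hs
  refine ⟨fun s => S 0 + ∫ r in (0 : ℝ)..s, T' r, T', hT', fun s => ?_, fun s hs => ?_, hTT⟩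
  · exact (hT'.integral_hasStrictDerivAt 0 s).hasDerivAt.const_add _
  · have : ∫ r in (0 : ℝ)..s, T' r = S s - S 0 := by
      refine intervalIntegral.integral_eq_sub_of_hasDerivAt_of_le hs.1
        (hS.mono (Icc_subset_Icc_right hs.2)) (fun x hx => ?_) (hT'.intervalIntegrable _ _)
      have hx' : x ∈ Ioo (0 : ℝ) 1 := ⟨hx.1, hx.2.trans_le hs.2⟩
      rw [hTT (Ioo_subset_Icc_self hx')]
      exact hST x hx'
    simp [this]

theorem hasDerivWithinAt_Icc_of_Ioo {E : Type*} [NormedAddCommGroup E] [NormedSpace ℝ E]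
    [CompleteSpace E] {S T : ℝ → E} (hS : ContinuousOn S (Icc 0 1))
    (hST : ∀ s ∈ Ioo (0 : ℝ) 1, HasDerivAt S (T s) s) (hT : ContinuousOn T (Icc 0 1)) :
    ∀ s ∈ Icc (0 : ℝ) 1, HasDerivWithinAt S (T s) (Icc 0 1) s := by
  intro s hs
  obtain ⟨F, T', -, hF, hFS, hTT⟩ := exists_antideriv_eqOn hS hST hT
  rw [← hTT hs]
  exact (hF s).hasDerivWithinAt.congr (fun x hx => (hFS hx).symm) (hFS hs).symm

/-! ### Partial derivatives -/

theorem hasDerivAt_fst {f : ℝ × ℝ → ℝ} {x y : ℝ} (h : DifferentiableAt ℝ f (x, y)) :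
    HasDerivAt (fun t => f (t, y)) (pd₁ f (x, y)) x :=
  h.hasFDerivAt.comp_hasDerivAt x ((hasDerivAt_id x).prodMk (hasDerivAt_const x y))

theorem hasDerivAt_snd {f : ℝ × ℝ → ℝ} {x y : ℝ} (h : DifferentiableAt ℝ f (x, y)) :
    HasDerivAt (fun t => f (x, t)) (pd₂ f (x, y)) y :=
  h.hasFDerivAt.comp_hasDerivAt y ((hasDerivAt_const y x).prodMk (hasDerivAt_id y))

theorem hasDerivAt_ray {f : ℝ × ℝ → ℝ} {x y₀ κ y : ℝ} (h : DifferentiableAt ℝ f (x, y₀ + κ * y)) :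
    HasDerivAt (fun t => f (x, y₀ + κ * t)) (κ * pd₂ f (x, y₀ + κ * y)) y := by
  have h1 : HasDerivAt (fun t => y₀ + κ * t) κ y := by
    simpa using ((hasDerivAt_id y).const_mul κ).const_add y₀
  have := (hasDerivAt_snd h).comp y h1
  rwa [mul_comm] at this

theorem fderiv_eq_pd (f : ℝ × ℝ → ℝ) (p w : ℝ × ℝ) :
    fderiv ℝ f p w = pd₁ f p * w.1 + pd₂ f p * w.2 := by
  have : w = w.1 • ((1, 0) : ℝ × ℝ) + w.2 • ((0, 1) : ℝ × ℝ) := by ext <;> simp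
  conv_lhs => rw [this]
  rw [map_add, map_smul, map_smul, pd₁, pd₂, smul_eq_mul, smul_eq_mul]
  ring

theorem contDiffOn_pd₁ {f : ℝ × ℝ → ℝ} {D : Set (ℝ × ℝ)} (hD : IsOpen D) {n m : WithTop ℕ∞}
    (h : ContDiffOn ℝ n f D) (hm : m + 1 ≤ n) : ContDiffOn ℝ m (pd₁ f) D :=
  (h.fderiv_of_isOpen hD hm).clm_apply contDiffOn_const

theorem contDiffOn_pd₂ {f : ℝ × ℝ → ℝ} {D : Set (ℝ × ℝ)} (hD : IsOpen D) {n m : WithTop ℕ∞}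
    (h : ContDiffOn ℝ n f D) (hm : m + 1 ≤ n) : ContDiffOn ℝ m (pd₂ f) D :=
  (h.fderiv_of_isOpen hD hm).clm_apply contDiffOn_const

theorem exists_sign_of_isPreconnected {X : Type*} [TopologicalSpace X] {W : Set X} {f : X → ℝ}
    (hW : IsPreconnected W) (hf : ContinuousOn f W) (h0 : ∀ x ∈ W, f x ≠ 0) :
    ∃ ε : ℝ, (ε = 1 ∨ ε = -1) ∧ ∀ x ∈ W, 0 < ε * f x := by
  by_cases hp : ∀ x ∈ W, 0 < f x
  · exact ⟨1, Or.inl rfl, fun x hx => by simpa using hp x hx⟩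
  · push Not at hp
    obtain ⟨x, hx, hfx⟩ := hp
    refine ⟨-1, Or.inr rfl, fun y hy => ?_⟩
    by_contra hcon
    obtain ⟨z, hz, hz0⟩ := hW.intermediate_value hx hy hf ⟨hfx, by linarith⟩
    exact h0 z hz hz0

/-! ### Sonic arcs -/

/-- `D` contains a half-neighbourhood of `p`, above `p` if `κ = 1` and below `p` if `κ = -1`. -/
def HasHalfBox (κ : ℝ) (D : Set (ℝ × ℝ)) (p : ℝ × ℝ) : Prop :=
  ∃ r > 0, ∀ z : ℝ × ℝ, |z.1 - p.1| < r → 0 < κ * (z.2 - p.2) → κ * (z.2 - p.2) < r → z ∈ D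

/-- A sonic curve in a region `D` of the potential plane, reduced to what the geometric argument
needs. Here `S` is run through from the wall below to the wall above if `τ = 1`, and in the
opposite direction if `τ = -1`; `T` is the derivative of `S`, and `a`, `b` are the partial
derivatives of the speed `q` along `S`, taken as limits from `D`, because the endpoints of `S` do
not belong to `D`. The equation of motion enters through `growth` alone. -/
structure IsSonicArc (c τ : ℝ) (D : Set (ℝ × ℝ)) (q : ℝ × ℝ → ℝ) (S T : ℝ → ℝ × ℝ)
    (a b : ℝ → ℝ) : Prop where
  sign : τ = 1 ∨ τ = -1
  isOpen : IsOpen D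
  contDiffOn : ContDiffOn ℝ 2 q D
  continuousOn : ContinuousOn S (Icc 0 1)
  hasDerivAt : ∀ s ∈ Ioo (0 : ℝ) 1, HasDerivAt S (T s) s
  continuousOn_deriv : ContinuousOn T (Icc 0 1)
  regular : ∀ s ∈ Icc (0 : ℝ) 1, T s ≠ 0
  injOn : InjOn S (Icc 0 1)
  mem : ∀ s ∈ Ioo (0 : ℝ) 1, S s ∈ D
  start_box : HasHalfBox τ D (S 0)
  end_box : HasHalfBox (-τ) D (S 1)
  above : ∀ s ∈ Ioc (0 : ℝ) 1, 0 < τ * ((S s).2 - (S 0).2)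
  below : ∀ s ∈ Ico (0 : ℝ) 1, 0 < τ * ((S 1).2 - (S s).2)
  sonic : ∀ z ∈ D, q z = c → z ∈ S '' Icc 0 1
  tendsto_q : ∀ s ∈ Icc (0 : ℝ) 1, Tendsto q (𝓝[D] S s) (𝓝 c)
  tendsto₁ : ∀ s ∈ Icc (0 : ℝ) 1, Tendsto (pd₁ q) (𝓝[D] S s) (𝓝 (a s))
  tendsto₂ : ∀ s ∈ Icc (0 : ℝ) 1, Tendsto (pd₂ q) (𝓝[D] S s) (𝓝 (b s))
  bounded : ∀ s ∈ Icc (0 : ℝ) 1, ∃ C, ∀ᶠ z in 𝓝[D] S s,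
    |pd₁ (pd₁ q) z| ≤ C ∧ |pd₂ (pd₁ q) z| ≤ C
  growth : ∀ s ∈ Icc (0 : ℝ) 1, ∃ C ≥ 0, ∀ᶠ z in 𝓝[D] S s,
    |pd₂ (pd₂ q) z| ≤ C * (|q z - c| + pd₁ q z ^ 2 + pd₂ q z ^ 2) ∧
    (q z < c → -pd₂ (pd₂ q) z ≤ C * (c - q z))
  /-- the speed is constant along `S` -/
  tangent : ∀ s ∈ Icc (0 : ℝ) 1, a s * (T s).1 + b s * (T s).2 = 0
  /-- the speed does not increase to the left of `S` -/
  left : ∀ s ∈ Icc (0 : ℝ) 1, b s * (T s).1 ≤ 0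

namespace IsSonicArc

variable {c τ : ℝ} {D : Set (ℝ × ℝ)} {q : ℝ × ℝ → ℝ} {S T : ℝ → ℝ × ℝ} {a b : ℝ → ℝ}

theorem hasDerivWithinAt (h : IsSonicArc c τ D q S T a b) :
    ∀ s ∈ Icc (0 : ℝ) 1, HasDerivWithinAt S (T s) (Icc 0 1) s :=
  hasDerivWithinAt_Icc_of_Ioo h.continuousOn h.hasDerivAt h.continuousOn_deriv

theorem differentiableAt (h : IsSonicArc c τ D q S T a b) {z : ℝ × ℝ} (hz : z ∈ D) :
    DifferentiableAt ℝ q z :=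
  (h.contDiffOn.contDiffAt (h.isOpen.mem_nhds hz)).differentiableAt (by norm_num)

theorem differentiableAt₁ (h : IsSonicArc c τ D q S T a b) {z : ℝ × ℝ} (hz : z ∈ D) :
    DifferentiableAt ℝ (pd₁ q) z :=
  ((contDiffOn_pd₁ (m := 1) h.isOpen h.contDiffOn (by norm_num)).contDiffAt
    (h.isOpen.mem_nhds hz)).differentiableAt (by norm_num)

theorem differentiableAt₂ (h : IsSonicArc c τ D q S T a b) {z : ℝ × ℝ} (hz : z ∈ D) :
    DifferentiableAt ℝ (pd₂ q) z :=
  ((contDiffOn_pd₂ (m := 1) h.isOpen h.contDiffOn (by norm_num)).contDiffAt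
    (h.isOpen.mem_nhds hz)).differentiableAt (by norm_num)

/-- `S` stays away from the point `S s₀`, except for parameters near `s₀`. -/
theorem exists_isolating (h : IsSonicArc c τ D q S T a b) {s₀ δ : ℝ} (hs₀ : s₀ ∈ Icc (0 : ℝ) 1)
    (hδ : 0 < δ) : ∃ d > 0, ∀ s ∈ Icc (0 : ℝ) 1, |(S s).1 - (S s₀).1| < d →
      |(S s).2 - (S s₀).2| < d → |s - s₀| < δ := by
  have hK : IsCompact (Icc (0 : ℝ) 1 \ Metric.ball s₀ δ) := isCompact_Icc.diff Metric.isOpen_ball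
  have hc : IsCompact (S '' (Icc (0 : ℝ) 1 \ Metric.ball s₀ δ)) :=
    hK.image_of_continuousOn (h.continuousOn.mono sdiff_subset)
  have hn : S s₀ ∉ S '' (Icc (0 : ℝ) 1 \ Metric.ball s₀ δ) := by
    rintro ⟨s, ⟨hs, hsb⟩, he⟩
    rw [h.injOn hs hs₀ he] at hsb
    exact hsb (Metric.mem_ball_self hδ)
  obtain ⟨d, hd, hball⟩ := Metric.mem_nhds_iff.1 (hc.isClosed.isOpen_compl.mem_nhds hn)
  refine ⟨d, hd, fun s hs h1 h2 => ?_⟩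
  by_contra hcon
  refine hball (?_ : S s ∈ Metric.ball (S s₀) d) ⟨s, ⟨hs, fun hb => hcon ?_⟩, rfl⟩
  · rw [Metric.mem_ball, Prod.dist_eq, Real.dist_eq, Real.dist_eq]
    exact max_lt h1 h2
  · rwa [Metric.mem_ball, Real.dist_eq] at hb

/-- `D` contains a half-neighbourhood of each point of `S`, above the point if `κ = 1` and below it
if `κ = -1`; at the endpoints of `S`, only one of the two sides is admitted. -/
theorem exists_box (h : IsSonicArc c τ D q S T a b) {s₀ κ : ℝ} (hs₀ : s₀ ∈ Icc (0 : ℝ) 1)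
    (hκ : κ = 1 ∨ κ = -1) (h0 : s₀ = 0 → κ = τ) (h1 : s₀ = 1 → κ = -τ) :
    ∃ r > 0, ∀ x y : ℝ, |x| < r → 0 < y → y < r → ((S s₀).1 + x, (S s₀).2 + κ * y) ∈ D := by
  have hκκ : κ * κ = 1 := by rcases hκ with rfl | rfl <;> norm_num
  have hy : ∀ y : ℝ, κ * ((S s₀).2 + κ * y - (S s₀).2) = y := fun y => by
    linear_combination y * hκκ
  rcases hs₀.1.eq_or_lt with rfl | h00
  · obtain ⟨r, hr, hbox⟩ := h.start_box
    rw [← h0 rfl] at hbox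
    exact ⟨r, hr, fun x y hx h2 h3 => hbox _ (by simpa using hx) (by rwa [hy]) (by rwa [hy])⟩
  rcases hs₀.2.eq_or_lt with rfl | h11
  · obtain ⟨r, hr, hbox⟩ := h.end_box
    rw [← h1 rfl] at hbox
    exact ⟨r, hr, fun x y hx h2 h3 => hbox _ (by simpa using hx) (by rwa [hy]) (by rwa [hy])⟩
  · obtain ⟨r, hr, hball⟩ := Metric.isOpen_iff.1 h.isOpen _ (h.mem s₀ ⟨h00, h11⟩)
    refine ⟨r, hr, fun x y hx h2 h3 => hball ?_⟩
    rw [Metric.mem_ball, Prod.dist_eq, Real.dist_eq, Real.dist_eq]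
    refine max_lt (by simpa using hx) ?_
    rw [add_sub_cancel_left, abs_mul, abs_of_pos h2]
    rcases hκ with rfl | rfl <;> simpa using h3

theorem exists_direction (h : IsSonicArc c τ D q S T a b) (s₀ : ℝ) :
    ∃ κ : ℝ, (κ = 1 ∨ κ = -1) ∧ (s₀ = 0 → κ = τ) ∧ (s₀ = 1 → κ = -τ) := by
  by_cases h1 : s₀ = 1
  · refine ⟨-τ, ?_, fun h0 => ?_, fun _ => rfl⟩
    · rcases h.sign with h | h <;> simp [h]
    · rw [h0] at h1; norm_num at h1
  · exact ⟨τ, h.sign, fun _ => rfl, fun h2 => absurd h2 h1⟩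

end IsSonicArc

theorem exists_forall_of_eventually_nhdsWithin {D : Set (ℝ × ℝ)} {p : ℝ × ℝ} {P : ℝ × ℝ → Prop}
    (h : ∀ᶠ z in 𝓝[D] p, P z) :
    ∃ r > 0, ∀ z ∈ D, |z.1 - p.1| < r → |z.2 - p.2| < r → P z := by
  obtain ⟨r, hr, hP⟩ := Metric.mem_nhdsWithin_iff.1 h
  refine ⟨r, hr, fun z hz h1 h2 => hP ⟨?_, hz⟩⟩
  rw [Metric.mem_ball, Prod.dist_eq, Real.dist_eq, Real.dist_eq]
  exact max_lt h1 h2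

theorem tendsto_ray {D : Set (ℝ × ℝ)} {p : ℝ × ℝ} {f : ℝ × ℝ → ℝ} {L κ r : ℝ} (hr : 0 < r)
    (hf : Tendsto f (𝓝[D] p) (𝓝 L)) (hD : ∀ y, 0 < y → y < r → (p.1, p.2 + κ * y) ∈ D) :
    Tendsto (fun y => f (p.1, p.2 + κ * y)) (𝓝[>] 0) (𝓝 L) := by
  refine hf.comp (tendsto_nhdsWithin_iff.2 ⟨?_, ?_⟩)
  · have : Tendsto (fun y : ℝ => (p.1, p.2 + κ * y)) (𝓝 0) (𝓝 (p.1, p.2 + κ * 0)) :=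
      Continuous.tendsto (by fun_prop) 0
    simp only [mul_zero, add_zero] at this
    exact this.mono_left nhdsWithin_le_nhds
  · filter_upwards [Ioo_mem_nhdsGT hr] with y hy using hD y hy.1 hy.2

/-! ### The gradient of the speed along a sonic arc -/

namespace IsSonicArc

variable {c τ : ℝ} {D : Set (ℝ × ℝ)} {q : ℝ × ℝ → ℝ} {S T : ℝ → ℝ × ℝ} {a b : ℝ → ℝ}

/-- Near a point where the tangent of `S` is not vertical, `S` lies in a double cone. -/
theorem exists_cone (h : IsSonicArc c τ D q S T a b) {s₀ : ℝ} (hs₀ : s₀ ∈ Icc (0 : ℝ) 1)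
    (hT : (T s₀).1 ≠ 0) : ∃ δ > 0, ∃ L > 0, ∀ s ∈ Icc (0 : ℝ) 1, |s - s₀| < δ →
      |(S s).2 - (S s₀).2| ≤ L * |(S s).1 - (S s₀).1| := by
  have hTp : 0 < |(T s₀).1| := abs_pos.2 hT
  have hder := (h.hasDerivWithinAt s₀ hs₀).isLittleO.def (half_pos hTp)
  obtain ⟨δ, hδ, hball⟩ := Metric.mem_nhdsWithin_iff.1 hder
  refine ⟨δ, hδ, (2 * |(T s₀).2| + |(T s₀).1|) / |(T s₀).1|, by positivity, fun s hs hsδ => ?_⟩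
  have h1 := hball ⟨(by rwa [Metric.mem_ball, Real.dist_eq] : s ∈ Metric.ball s₀ δ), hs⟩
  simp only [mem_ofPred_eq, Prod.norm_def, Real.norm_eq_abs, sup_le_iff, Prod.fst_sub, Prod.snd_sub,
    Prod.smul_fst, Prod.smul_snd, smul_eq_mul] at h1
  obtain ⟨h1, h2⟩ := h1
  have h3 : |s - s₀| * |(T s₀).1| ≤ 2 * |(S s).1 - (S s₀).1| := by
    have := abs_sub_abs_le_abs_sub ((s - s₀) * (T s₀).1) ((S s).1 - (S s₀).1)
    rw [abs_sub_comm ((s - s₀) * _), abs_mul] at this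
    linarith
  have h4 : |(S s).2 - (S s₀).2| ≤ |s - s₀| * |(T s₀).2| + |(T s₀).1| / 2 * |s - s₀| := by
    have := abs_sub_abs_le_abs_sub ((S s).2 - (S s₀).2) ((s - s₀) * (T s₀).2)
    rw [abs_mul] at this
    linarith
  rw [div_mul_eq_mul_div, le_div_iff₀ hTp]
  calc |(S s).2 - (S s₀).2| * |(T s₀).1|
      ≤ (|s - s₀| * |(T s₀).2| + |(T s₀).1| / 2 * |s - s₀|) * |(T s₀).1| := by gcongr
    _ = (|(T s₀).2| + |(T s₀).1| / 2) * (|s - s₀| * |(T s₀).1|) := by ring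
    _ ≤ (|(T s₀).2| + |(T s₀).1| / 2) * (2 * |(S s).1 - (S s₀).1|) := by gcongr
    _ = _ := by ring

/-- At a point of `S` whose tangent is not parallel to the `ψ`-axis, `∂q/∂ψ` does not vanish.
Otherwise the gradient of `q` would vanish there. A vertical ray from this point, together with a
sector around it, does not meet `S`; so `q - c` has a sign there, and `|q - c|` controls the squares
of the derivatives of `q`. By the equation of motion, `u'' ≤ C u` for the restriction `u` of
`|q - c|` to the ray, and `u = u' = 0` initially. -/
theorem pd₂_ne_zero (h : IsSonicArc c τ D q S T a b) {s₀ : ℝ} (hs₀ : s₀ ∈ Icc (0 : ℝ) 1)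
    (hT : (T s₀).1 ≠ 0) : b s₀ ≠ 0 := by
  intro hb
  have ha : a s₀ = 0 := by
    have := h.tangent s₀ hs₀
    rw [hb, zero_mul, add_zero] at this
    exact (mul_eq_zero.1 this).resolve_right hT
  obtain ⟨κ, hκ, hκ0, hκ1⟩ := h.exists_direction s₀
  have hκκ : κ * κ = 1 := by rcases hκ with rfl | rfl <;> norm_num
  have hκabs : ∀ y : ℝ, |κ * y| = |y| := fun y => by
    rcases hκ with rfl | rfl <;> simp
  obtain ⟨r₁, hr₁, hbox⟩ := h.exists_box hs₀ hκ hκ0 hκ1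
  obtain ⟨C₁, hC₁⟩ := h.bounded s₀ hs₀
  obtain ⟨C₂, hC₂0, hC₂⟩ := h.growth s₀ hs₀
  have hq1 : ∀ᶠ z in 𝓝[D] S s₀, |q z - c| < 1 := by
    have := ((h.tendsto_q s₀ hs₀).sub_const c).abs
    rw [sub_self, abs_zero] at this
    exact this.eventually (gt_mem_nhds one_pos)
  have hq2 : ∀ᶠ z in 𝓝[D] S s₀, pd₁ q z ^ 2 < 1 := by
    have := (h.tendsto₁ s₀ hs₀).pow 2
    rw [ha] at this
    exact this.eventually (gt_mem_nhds (by norm_num))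
  have hq3 : ∀ᶠ z in 𝓝[D] S s₀, pd₂ q z ^ 2 < 1 := by
    have := (h.tendsto₂ s₀ hs₀).pow 2
    rw [hb] at this
    exact this.eventually (gt_mem_nhds (by norm_num))
  obtain ⟨r₂, hr₂, hP⟩ := exists_forall_of_eventually_nhdsWithin
    (hC₁.and (hC₂.and (hq1.and (hq2.and hq3))))
  obtain ⟨δ, hδ, L, hL, hcone⟩ := h.exists_cone hs₀ hT
  obtain ⟨d, hd, hiso⟩ := h.exists_isolating hs₀ hδ
  set x₀ := (S s₀).1
  set y₀ := (S s₀).2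
  set m : ℝ := 1 / (L + 1) with hm
  have hm0 : 0 < m := by positivity
  have hm1 : m ≤ 1 := by rw [hm, div_le_one (by positivity)]; linarith
  obtain ⟨r, hr, hrr₁, hrr₂, hrd⟩ : ∃ r, 0 < r ∧ r ≤ r₁ ∧ r ≤ r₂ ∧ r ≤ d :=
    ⟨min (min r₁ r₂) d, lt_min (lt_min hr₁ hr₂) hd, (min_le_left _ _).trans (min_le_left _ _),
      (min_le_left _ _).trans (min_le_right _ _), min_le_right _ _⟩
  -- the sector `|x| ≤ m y`, `0 < y < r`
  have hxr : ∀ x y : ℝ, |x| ≤ m * y → 0 < y → y < r → |x| < r := fun x y hx hy hyr =>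
    (hx.trans (mul_le_of_le_one_left hy.le hm1)).trans_lt hyr
  have hsD : ∀ x y : ℝ, |x| ≤ m * y → 0 < y → y < r → (x₀ + x, y₀ + κ * y) ∈ D :=
    fun x y hx hy hyr => hbox x y ((hxr x y hx hy hyr).trans_le hrr₁) hy (hyr.trans_le hrr₁)
  have hsP := fun (x y : ℝ) (hx : |x| ≤ m * y) (hy : 0 < y) (hyr : y < r) =>
    hP _ (hsD x y hx hy hyr)
      (by simpa using (hxr x y hx hy hyr).trans_le hrr₂)
      (by simpa [hκabs, abs_of_pos hy] using hyr.trans_le hrr₂)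
  have hsS : ∀ x y : ℝ, |x| ≤ m * y → 0 < y → y < r → q (x₀ + x, y₀ + κ * y) - c ≠ 0 := by
    intro x y hx hy hyr h0
    obtain ⟨s, hs, hse⟩ := h.sonic _ (hsD x y hx hy hyr) (sub_eq_zero.1 h0)
    have e1 : (S s).1 - x₀ = x := by rw [hse]; simp
    have e2 : (S s).2 - y₀ = κ * y := by rw [hse]; simp
    have h1 := hcone s hs (hiso s hs (by rw [e1]; exact (hxr x y hx hy hyr).trans_le hrd)
      (by rw [e2, hκabs, abs_of_pos hy]; exact hyr.trans_le hrd))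
    rw [e1, e2, hκabs, abs_of_pos hy] at h1
    have h2 : L * m < 1 := by
      rw [hm, mul_one_div, div_lt_one (by positivity)]; linarith
    have h3 : L * |x| ≤ L * m * y := by
      rw [mul_assoc]; exact mul_le_mul_of_nonneg_left hx hL.le
    nlinarith
  obtain ⟨ε, hε, hsign⟩ : ∃ ε : ℝ, (ε = 1 ∨ ε = -1) ∧ ∀ x y : ℝ, |x| ≤ m * y → 0 < y → y < r →
      0 < ε * (q (x₀ + x, y₀ + κ * y) - c) := by
    let W : Set (ℝ × ℝ) := {p | |p.1| ≤ m * p.2 ∧ 0 < p.2 ∧ p.2 < r}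
    have hW : Convex ℝ W := by
      rintro p ⟨hp1, hp2, hp3⟩ p' ⟨hp1', hp2', hp3'⟩ α β hα hβ hαβ
      have hconv := convex_Ioo (0 : ℝ) r ⟨hp2, hp3⟩ ⟨hp2', hp3'⟩ hα hβ hαβ
      refine ⟨?_, hconv.1, hconv.2⟩
      simp only [Prod.fst_add, Prod.smul_fst, Prod.snd_add, Prod.smul_snd, smul_eq_mul]
      calc |α * p.1 + β * p'.1| ≤ |α * p.1| + |β * p'.1| := abs_add_le _ _
        _ = α * |p.1| + β * |p'.1| := by rw [abs_mul, abs_mul, abs_of_nonneg hα, abs_of_nonneg hβ]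
        _ ≤ α * (m * p.2) + β * (m * p'.2) := by gcongr
        _ = m * (α * p.2 + β * p'.2) := by ring
    obtain ⟨ε, hε, hs⟩ := exists_sign_of_isPreconnected (W := W)
      (f := fun p => q (x₀ + p.1, y₀ + κ * p.2) - c) hW.isPreconnected
      (by
        refine (h.contDiffOn.continuousOn.comp (by fun_prop) ?_).sub continuousOn_const
        exact fun p hp => hsD p.1 p.2 hp.1 hp.2.1 hp.2.2)
      (fun p hp => hsS p.1 p.2 hp.1 hp.2.1 hp.2.2)
    exact ⟨ε, hε, fun x y h1 h2 h3 => hs (x, y) ⟨h1, h2, h3⟩⟩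
  have hεκabs : ∀ y : ℝ, |ε * y| = |y| := fun y => by
    rcases hε with rfl | rfl <;> simp
  have hz : ∀ y, 0 < y → |(0 : ℝ)| ≤ m * y := fun y hy => by
    rw [abs_zero]; positivity
  have hrD : ∀ y, 0 < y → y < r → (x₀, y₀ + κ * y) ∈ D := fun y hy hyr => by
    simpa using hsD 0 y (hz y hy) hy hyr
  have hrP := fun (y : ℝ) (hy : 0 < y) (hyr : y < r) => hsP 0 y (hz y hy) hy hyr
  simp only [add_zero] at hrP
  have hC₁0 : 0 ≤ C₁ := (abs_nonneg _).trans
    (hrP (r / 2) (half_pos hr) (half_lt_self hr)).1.1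
  let u : ℝ → ℝ := fun y => ε * (q (x₀, y₀ + κ * y) - c)
  let u' : ℝ → ℝ := fun y => ε * (κ * pd₂ q (x₀, y₀ + κ * y))
  let u'' : ℝ → ℝ := fun y => ε * (κ * (κ * pd₂ (pd₂ q) (x₀, y₀ + κ * y)))
  have hu : ∀ y ∈ Ioo 0 r, HasDerivAt u (u' y) y := fun y hy =>
    ((hasDerivAt_ray (h.differentiableAt (hrD y hy.1 hy.2))).sub_const c).const_mul ε
  have hu' : ∀ y ∈ Ioo 0 r, HasDerivAt u' (u'' y) y := fun y hy =>
    ((hasDerivAt_ray (h.differentiableAt₂ (hrD y hy.1 hy.2))).const_mul κ).const_mul ε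
  have hupos : ∀ y ∈ Ioo 0 r, 0 < u y := fun y hy => by
    simpa using hsign 0 y (hz y hy.1) hy.1 hy.2
  have hu0 : Tendsto u (𝓝[>] 0) (𝓝 0) := by
    have := ((tendsto_ray hr (h.tendsto_q s₀ hs₀) hrD).sub_const c).const_mul ε
    simpa using this
  have hu'0 : Tendsto u' (𝓝[>] 0) (𝓝 0) := by
    have := ((tendsto_ray hr (h.tendsto₂ s₀ hs₀) hrD).const_mul κ).const_mul ε
    simpa [hb] using this
  -- the horizontal derivative, from the room in the sector
  have hx1 : ∀ y ∈ Ioo 0 r, |pd₁ q (x₀, y₀ + κ * y)| ≤ (C₁ + 1) * y := by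
    refine abs_le_mul_of_tendsto_zero (f' := fun y => κ * pd₂ (pd₁ q) (x₀, y₀ + κ * y))
      (fun y hy => hasDerivAt_ray (h.differentiableAt₁ (hrD y hy.1 hy.2))) (fun y hy => ?_) ?_
    · rw [hκabs]
      have := (hrP y hy.1 hy.2).1.2
      linarith
    · have := tendsto_ray hr (h.tendsto₁ s₀ hs₀) hrD
      rwa [ha] at this
  have hM0 : 0 < (C₁ + 1) / m := by positivity
  have hx2 : ∀ y ∈ Ioo 0 r, pd₁ q (x₀, y₀ + κ * y) ^ 2 ≤ 2 * ((C₁ + 1) / m) * u y := by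
    intro y hy
    have hmem : ∀ t ∈ Icc (x₀ - m * y) (x₀ + m * y), |t - x₀| ≤ m * y := fun t ht =>
      abs_le.2 ⟨by linarith [ht.1], by linarith [ht.2]⟩
    have hD' : ∀ t ∈ Icc (x₀ - m * y) (x₀ + m * y), (t, y₀ + κ * y) ∈ D := fun t ht => by
      simpa using hsD (t - x₀) y (hmem t ht) hy.1 hy.2
    have := sq_deriv_le_of_nonneg (f := fun t => ε * (q (t, y₀ + κ * y) - c))
      (f' := fun t => ε * pd₁ q (t, y₀ + κ * y)) (f'' := fun t => ε * pd₁ (pd₁ q) (t, y₀ + κ * y))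
      (x := x₀) (h := m * y) hM0
      (fun t ht => ((hasDerivAt_fst (h.differentiableAt (hD' t ht))).sub_const c).const_mul ε)
      (fun t ht => (hasDerivAt_fst (h.differentiableAt₁ (hD' t ht))).const_mul ε)
      (fun t ht => by
        have := hsign (t - x₀) y (hmem t ht) hy.1 hy.2
        rw [add_sub_cancel] at this
        exact this.le)
      (fun t ht => by
        have h1 := (hsP (t - x₀) y (hmem t ht) hy.1 hy.2).1.1
        rw [add_sub_cancel] at h1
        have h2 := le_abs_self (ε * pd₁ (pd₁ q) (t, y₀ + κ * y))
        rw [hεκabs] at h2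
        have h3 : C₁ + 1 ≤ (C₁ + 1) / m := by
          rw [le_div_iff₀ hm0]
          exact mul_le_of_le_one_right (by linarith) hm1
        linarith)
      (by
        rw [hεκabs, ← mul_assoc, div_mul_cancel₀ _ hm0.ne']
        exact hx1 y hy)
    have hεε : ε ^ 2 = 1 := by rcases hε with rfl | rfl <;> norm_num
    rwa [mul_pow, hεε, one_mul] at this
  -- the vertical derivative
  set N : ℝ := C₂ * 3 + 1 with hN
  have hN0 : 0 < N := by positivity
  have hu''N : ∀ y ∈ Ioo 0 r, |u'' y| ≤ N := by
    intro y hy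
    obtain ⟨-, ⟨h1, -⟩, h2, h3, h4⟩ := hrP y hy.1 hy.2
    simp only [u'', hεκabs, hκabs]
    have : C₂ * (|q (x₀, y₀ + κ * y) - c| + pd₁ q (x₀, y₀ + κ * y) ^ 2
        + pd₂ q (x₀, y₀ + κ * y) ^ 2) ≤ C₂ * 3 :=
      mul_le_mul_of_nonneg_left (by linarith) hC₂0
    linarith
  have hy1 := abs_le_mul_of_tendsto_zero hu' hu''N hu'0
  have hy2 : ∀ y ∈ Ioo 0 (r / 2), pd₂ q (x₀, y₀ + κ * y) ^ 2 ≤ 2 * (2 * N) * u y := by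
    intro y hy
    have hmem : ∀ t ∈ Icc (y - y / 2) (y + y / 2), t ∈ Ioo 0 r := fun t ht =>
      ⟨by linarith [ht.1, hy.1], by linarith [ht.2, hy.2, hy.1]⟩
    have := sq_deriv_le_of_nonneg (f := u) (f' := u') (f'' := u'') (x := y) (h := y / 2)
      (M := 2 * N) (by positivity) (fun t ht => hu t (hmem t ht)) (fun t ht => hu' t (hmem t ht))
      (fun t ht => (hupos t (hmem t ht)).le)
      (fun t ht => by linarith [le_abs_self (u'' t), hu''N t (hmem t ht)])
      (by linarith [hy1 y ⟨hy.1, by linarith [hy.2, hr]⟩])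
    have hu2 : u' y ^ 2 = pd₂ q (x₀, y₀ + κ * y) ^ 2 := by
      rw [← sq_abs (u' y), ← sq_abs (pd₂ q _)]
      simp only [u', hεκabs, hκabs]
    rwa [hu2] at this
  have hsub : Ioo 0 (r / 2) ⊆ Ioo 0 r := Ioo_subset_Ioo_right (by linarith)
  refine false_of_pos_of_second_deriv_le (half_pos hr)
    (C := C₂ * (1 + 2 * ((C₁ + 1) / m) + 2 * (2 * N))) (by positivity)
    (fun y hy => hu y (hsub hy)) (fun y hy => hu' y (hsub hy)) (fun y hy => hupos y (hsub hy))
    (fun y hy => ?_) hu0 hu'0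
  have h1 := (hrP y hy.1 (hsub hy).2).2.1.1
  have h2 : |u'' y| = |pd₂ (pd₂ q) (x₀, y₀ + κ * y)| := by simp only [u'', hεκabs, hκabs]
  have h3 : |q (x₀, y₀ + κ * y) - c| = u y := by
    rw [← abs_of_pos (hupos y (hsub hy)), hεκabs]
  rw [h3] at h1
  have h4 : C₂ * (u y + pd₁ q (x₀, y₀ + κ * y) ^ 2 + pd₂ q (x₀, y₀ + κ * y) ^ 2)
      ≤ C₂ * (u y + 2 * ((C₁ + 1) / m) * u y + 2 * (2 * N) * u y) := by
    have := hx2 y (hsub hy)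
    have := hy2 y hy
    gcongr
  calc u'' y ≤ |u'' y| := le_abs_self _
    _ ≤ C₂ * (u y + 2 * ((C₁ + 1) / m) * u y + 2 * (2 * N) * u y) := by rw [h2]; exact h1.trans h4
    _ = _ := by ring

end IsSonicArc

/-! ### Forbidden turns -/

theorem hasDerivWithinAt_coord₁ {S : ℝ → ℝ × ℝ} {S' : ℝ × ℝ} {I : Set ℝ} {s : ℝ}
    (h : HasDerivWithinAt S S' I s) : HasDerivWithinAt (fun t => (S t).1) S'.1 I s :=
  (ContinuousLinearMap.fst ℝ ℝ ℝ).hasFDerivAt.comp_hasDerivWithinAt s h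

theorem hasDerivWithinAt_coord₂ {S : ℝ → ℝ × ℝ} {S' : ℝ × ℝ} {I : Set ℝ} {s : ℝ}
    (h : HasDerivWithinAt S S' I s) : HasDerivWithinAt (fun t => (S t).2) S'.2 I s :=
  (ContinuousLinearMap.snd ℝ ℝ ℝ).hasFDerivAt.comp_hasDerivWithinAt s h

theorem hasDerivAt_coord₁ {S : ℝ → ℝ × ℝ} {S' : ℝ × ℝ} {s : ℝ}
    (h : HasDerivAt S S' s) : HasDerivAt (fun t => (S t).1) S'.1 s :=
  (ContinuousLinearMap.fst ℝ ℝ ℝ).hasFDerivAt.comp_hasDerivAt s h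

theorem hasDerivAt_coord₂ {S : ℝ → ℝ × ℝ} {S' : ℝ × ℝ} {s : ℝ}
    (h : HasDerivAt S S' s) : HasDerivAt (fun t => (S t).2) S'.2 s :=
  (ContinuousLinearMap.snd ℝ ℝ ℝ).hasFDerivAt.comp_hasDerivAt s h

namespace IsSonicArc

variable {c τ : ℝ} {D : Set (ℝ × ℝ)} {q : ℝ × ℝ → ℝ} {S T : ℝ → ℝ × ℝ} {a b : ℝ → ℝ}

theorem start_direction (h : IsSonicArc c τ D q S T a b) : 0 ≤ τ * (T 0).2 := by
  have h0 : (0 : ℝ) ∈ Icc (0 : ℝ) 1 := ⟨le_rfl, zero_le_one⟩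
  have h1 := ((hasDerivWithinAt_coord₂ (h.hasDerivWithinAt 0 h0)).const_mul τ).mono
    Ioo_subset_Icc_self
  rw [hasDerivWithinAt_iff_tendsto_slope' (by simp)] at h1
  have : (𝓝[Ioo (0 : ℝ) 1] 0).NeBot := left_nhdsWithin_Ioo_neBot one_pos
  refine ge_of_tendsto h1 ?_
  filter_upwards [self_mem_nhdsWithin] with s hs
  rw [slope_def_field]
  have := h.above s ⟨hs.1, hs.2.le⟩
  exact div_nonneg (by linarith) (by linarith [hs.1])

theorem end_direction (h : IsSonicArc c τ D q S T a b) : 0 ≤ τ * (T 1).2 := by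
  have h0 : (1 : ℝ) ∈ Icc (0 : ℝ) 1 := ⟨zero_le_one, le_rfl⟩
  have h1 := ((hasDerivWithinAt_coord₂ (h.hasDerivWithinAt 1 h0)).const_mul τ).mono
    Ioo_subset_Icc_self
  rw [hasDerivWithinAt_iff_tendsto_slope' (by simp)] at h1
  have : (𝓝[Ioo (0 : ℝ) 1] 1).NeBot := right_nhdsWithin_Ioo_neBot one_pos
  refine ge_of_tendsto h1 ?_
  filter_upwards [self_mem_nhdsWithin] with s hs
  rw [slope_def_field]
  have := h.below s ⟨hs.1.le, hs.2⟩
  exact div_nonneg_of_nonpos (by linarith) (by linarith [hs.2])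

theorem eq_of_mem (h : IsSonicArc c τ D q S T a b) {s : ℝ} (hs : s ∈ Ioo (0 : ℝ) 1) :
    q (S s) = c ∧ a s = pd₁ q (S s) ∧ b s = pd₂ q (S s) := by
  have hD := h.mem s hs
  have hs' := Ioo_subset_Icc_self hs
  have e : 𝓝[D] S s = 𝓝 (S s) := h.isOpen.nhdsWithin_eq hD
  have h1 := h.tendsto_q s hs'
  have h2 := h.tendsto₁ s hs'
  have h3 := h.tendsto₂ s hs'
  rw [e] at h1 h2 h3
  exact ⟨tendsto_nhds_unique (h.differentiableAt hD).continuousAt h1,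
    tendsto_nhds_unique h2 (h.differentiableAt₁ hD).continuousAt,
    tendsto_nhds_unique h3 (h.differentiableAt₂ hD).continuousAt⟩

/-- Where the tangent of `S` is parallel to no coordinate axis, the sign of `∂q/∂φ` is known. -/
theorem pd₁_mul_pos (h : IsSonicArc c τ D q S T a b) {s : ℝ} (hs : s ∈ Icc (0 : ℝ) 1)
    (h1 : (T s).1 ≠ 0) (h2 : (T s).2 ≠ 0) : 0 < a s * (T s).2 := by
  have hb := h.pd₂_ne_zero hs h1
  have hl : b s * (T s).1 < 0 := lt_of_le_of_ne (h.left s hs) (mul_ne_zero hb h1)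
  have e : a s * (T s).2 * (T s).1 ^ 2 = -(b s * (T s).1) * (T s).2 ^ 2 := by
    linear_combination (T s).1 * (T s).2 * h.tangent s hs
  have : 0 < a s * (T s).2 * (T s).1 ^ 2 := by
    rw [e]; exact mul_pos (by linarith) (by positivity)
  exact pos_of_mul_pos_left this (sq_nonneg _)

/-- A forbidden turn. Let the tangent of `S` be vertical at `S s₀`; then `S` cannot continue
(forwards if `σ = 1`, backwards if `σ = -1`) to the supersonic side of the vertical ray on which it
starts. Otherwise this ray (upwards if `κ = 1`, downwards if `κ = -1`) would be subsonic near
`S s₀`, and `c - q` would be a positive solution of `u'' ≤ C u` on it with `u = u' = 0`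
initially. -/
theorem no_turn (h : IsSonicArc c τ D q S T a b) {s₀ σ κ t₀ : ℝ} (hσ : σ = 1 ∨ σ = -1)
    (hκ : κ = 1 ∨ κ = -1) (hs₀ : s₀ ∈ Icc (0 : ℝ) 1) (hT₁ : (T s₀).1 = 0)
    (hT₂ : 0 < κ * σ * (T s₀).2) (ht₀ : 0 < t₀) (hst₀ : s₀ + σ * t₀ ∈ Icc (0 : ℝ) 1)
    (hpos : ∀ t ∈ Ioo 0 t₀, 0 < κ * (T (s₀ + σ * t)).1) : False := by
  have hκκ : κ * κ = 1 := by rcases hκ with rfl | rfl <;> norm_num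
  have hσσ : σ * σ = 1 := by rcases hσ with rfl | rfl <;> norm_num
  have hκabs : ∀ y : ℝ, |κ * y| = |y| := fun y => by rcases hκ with rfl | rfl <;> simp
  have hσabs : ∀ y : ℝ, |σ * y| = |y| := fun y => by rcases hσ with rfl | rfl <;> simp
  -- at an endpoint, the ray points into the region
  have hκ0 : s₀ = 0 → κ = τ := by
    rintro rfl
    have h1 := h.start_direction
    have hσ1 : σ = 1 := by
      rcases hσ with h2 | h2
      · exact h2
      · have := hst₀.1
        rw [h2] at this
        linarith
    rw [hσ1, mul_one] at hT₂
    rcases hκ with rfl | rfl <;> rcases h.sign with h2 | h2 <;> rw [h2] at h1 ⊢ <;> linarith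
  have hκ1 : s₀ = 1 → κ = -τ := by
    rintro rfl
    have h1 := h.end_direction
    have hσ1 : σ = -1 := by
      rcases hσ with h2 | h2
      · have := hst₀.2
        rw [h2] at this
        linarith
      · exact h2
    rw [hσ1] at hT₂
    rcases hκ with rfl | rfl <;> rcases h.sign with h2 | h2 <;> rw [h2] at h1 ⊢ <;> linarith
  obtain ⟨r₁, hr₁, hbox⟩ := h.exists_box hs₀ hκ hκ0 hκ1
  obtain ⟨C, hC0, hC⟩ := h.growth s₀ hs₀
  obtain ⟨r₂, hr₂, hP⟩ := exists_forall_of_eventually_nhdsWithin hC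
  set x₀ := (S s₀).1 with hx₀
  set y₀ := (S s₀).2 with hy₀
  have hb : b s₀ = 0 := by
    have := h.tangent s₀ hs₀
    rw [hT₁, mul_zero, zero_add] at this
    refine (mul_eq_zero.1 this).resolve_right fun h0 => ?_
    rw [h0, mul_zero] at hT₂
    exact lt_irrefl _ hT₂
  -- near `S s₀`, the arc is a graph over the vertical axis
  obtain ⟨δ, hδ, hδT⟩ : ∃ δ > 0, ∀ s ∈ Icc (0 : ℝ) 1, |s - s₀| < δ → 0 < κ * σ * (T s).2 := by
    have h1 : ContinuousWithinAt (fun s => κ * σ * (T s).2) (Icc 0 1) s₀ :=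
      continuousWithinAt_const.mul (h.continuousOn_deriv s₀ hs₀).snd
    obtain ⟨δ, hδ, hball⟩ := Metric.mem_nhdsWithin_iff.1 (h1.eventually (lt_mem_nhds hT₂))
    exact ⟨δ, hδ, fun s hs hsδ => hball ⟨by rwa [Metric.mem_ball, Real.dist_eq], hs⟩⟩
  obtain ⟨d, hd, hiso⟩ := h.exists_isolating hs₀ hδ
  have hmono : StrictMonoOn (fun s => κ * σ * (S s).2) (Icc 0 1 ∩ Metric.ball s₀ δ) := by
    refine strictMonoOn_of_deriv_pos ((convex_Icc _ _).inter (convex_ball _ _))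
      (continuousOn_const.mul (h.continuousOn.mono inter_subset_left).snd) fun s hs => ?_
    rw [interior_inter, interior_Icc, Metric.isOpen_ball.interior_eq] at hs
    rw [((hasDerivAt_coord₂ (h.hasDerivAt s hs.1)).const_mul (κ * σ)).deriv]
    exact hδT s (Ioo_subset_Icc_self hs.1) (by simpa [Real.dist_eq] using hs.2)
  have hIoo : ∀ t ∈ Ioo 0 t₀, s₀ + σ * t ∈ Ioo (0 : ℝ) 1 := by
    intro t ht
    rcases hσ with rfl | rfl
    · exact ⟨by linarith [hs₀.1, ht.1], by linarith [hst₀.2, ht.2]⟩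
    · exact ⟨by linarith [hst₀.1, ht.2], by linarith [hs₀.2, ht.1]⟩
  have hIcc : ∀ t ∈ Icc 0 t₀, s₀ + σ * t ∈ Icc (0 : ℝ) 1 := by
    intro t ht
    rcases hσ with rfl | rfl
    · exact ⟨by linarith [hs₀.1, ht.1], by linarith [hst₀.2, ht.2]⟩
    · exact ⟨by linarith [hst₀.1, ht.2], by linarith [hs₀.2, ht.1]⟩
  let X : ℝ → ℝ := fun t => κ * σ * ((S (s₀ + σ * t)).1 - x₀)
  let Y : ℝ → ℝ := fun t => κ * ((S (s₀ + σ * t)).2 - y₀)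
  have hScont : ContinuousOn (fun t => S (s₀ + σ * t)) (Icc 0 t₀) :=
    h.continuousOn.comp (by fun_prop) hIcc
  have hXc : ContinuousOn X (Icc 0 t₀) :=
    continuousOn_const.mul (hScont.fst.sub continuousOn_const)
  have hYc : ContinuousOn Y (Icc 0 t₀) :=
    continuousOn_const.mul (hScont.snd.sub continuousOn_const)
  have hX0 : X 0 = 0 := by simp [X, hx₀]
  have hY0 : Y 0 = 0 := by simp [Y, hy₀]
  have hXmono : StrictMonoOn X (Icc 0 t₀) := by
    refine strictMonoOn_of_deriv_pos (convex_Icc _ _) hXc fun t ht => ?_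
    rw [interior_Icc] at ht
    have h1 : HasDerivAt (fun t => s₀ + σ * t) σ t := by
      simpa using ((hasDerivAt_id t).const_mul σ).const_add s₀
    have h2 := (((hasDerivAt_coord₁ (h.hasDerivAt _ (hIoo t ht))).comp t h1).sub_const
      x₀).const_mul (κ * σ)
    have h3 : deriv X t = κ * σ * ((T (s₀ + σ * t)).1 * σ) := h2.deriv
    rw [h3]
    have := hpos t ht
    linear_combination this - (κ * (T (s₀ + σ * t)).1) * hσσ
  obtain ⟨t₁, ht₁0, ht₁t, ht₁δ, hXt₁⟩ : ∃ t₁, 0 < t₁ ∧ t₁ < t₀ ∧ t₁ < δ ∧ X t₁ < min r₁ d := by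
    have h1 : Tendsto X (𝓝[Icc 0 t₀] 0) (𝓝 (X 0)) := hXc 0 ⟨le_rfl, ht₀.le⟩
    rw [hX0] at h1
    have h2 : 𝓝[>] (0 : ℝ) ≤ 𝓝[Icc 0 t₀] 0 := by
      rw [← nhdsWithin_Ioo_eq_nhdsGT ht₀]
      exact nhdsWithin_mono _ Ioo_subset_Icc_self
    have h3 := (h1.mono_left h2).eventually (gt_mem_nhds (lt_min hr₁ hd))
    obtain ⟨t, h4, h5, h6⟩ := (h3.and ((eventually_mem_set.2 (Ioo_mem_nhdsGT ht₀)).and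
      (eventually_mem_set.2 (Ioo_mem_nhdsGT hδ)))).exists
    exact ⟨t, h5.1, h5.2, h6.2, h4⟩
  have hball : ∀ t, 0 ≤ t → t < δ → s₀ + σ * t ∈ Metric.ball s₀ δ := fun t ht htδ => by
    rw [Metric.mem_ball, Real.dist_eq, add_sub_cancel_left, hσabs, abs_of_nonneg ht]
    exact htδ
  have hYt₁ : 0 < Y t₁ := by
    have hm0 : s₀ ∈ Icc (0 : ℝ) 1 ∩ Metric.ball s₀ δ := ⟨hs₀, Metric.mem_ball_self hδ⟩
    have hm1 : s₀ + σ * t₁ ∈ Icc (0 : ℝ) 1 ∩ Metric.ball s₀ δ :=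
      ⟨hIcc t₁ ⟨ht₁0.le, ht₁t.le⟩, hball t₁ ht₁0.le ht₁δ⟩
    rcases hσ with rfl | rfl
    · have := hmono hm0 hm1 (by linarith)
      simp only [Y] at this ⊢
      linarith
    · have := hmono hm1 hm0 (by linarith)
      simp only [Y] at this ⊢
      linarith
  obtain ⟨r, hr, hrr₁, hrr₂, hrd, hrY⟩ : ∃ r, 0 < r ∧ r ≤ r₁ ∧ r ≤ r₂ ∧ r ≤ d ∧ r ≤ Y t₁ :=
    ⟨min (min r₁ r₂) (min d (Y t₁)), lt_min (lt_min hr₁ hr₂) (lt_min hd hYt₁),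
      (min_le_left _ _).trans (min_le_left _ _), (min_le_left _ _).trans (min_le_right _ _),
      (min_le_right _ _).trans (min_le_left _ _), (min_le_right _ _).trans (min_le_right _ _)⟩
  have hrD : ∀ y, 0 < y → y < r → (x₀, y₀ + κ * y) ∈ D := fun y hy hyr => by
    simpa using hbox 0 y (by simpa using hr₁) hy (hyr.trans_le hrr₁)
  -- the ray is subsonic: a horizontal segment from the arc to the ray does not meet the arc again
  have hsub : ∀ y ∈ Ioo 0 r, q (x₀, y₀ + κ * y) < c := by
    intro y hy
    obtain ⟨t, ht, hYt⟩ : ∃ t ∈ Ioo 0 t₁, Y t = y :=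
      intermediate_value_Ioo ht₁0.le (hYc.mono (Icc_subset_Icc_right ht₁t.le))
        ⟨by rw [hY0]; exact hy.1, hy.2.trans_le hrY⟩
    have htt₀ : t ∈ Ioo 0 t₀ := ⟨ht.1, ht.2.trans ht₁t⟩
    set s := s₀ + σ * t with hs
    have hsI : s ∈ Ioo (0 : ℝ) 1 := hIoo t htt₀
    have hsI' := Ioo_subset_Icc_self hsI
    have hsb : s ∈ Metric.ball s₀ δ := hball t ht.1.le (ht.2.trans ht₁δ)
    have hXt0 : 0 < X t := by
      rw [← hX0]
      exact hXmono ⟨le_rfl, ht₀.le⟩ ⟨ht.1.le, htt₀.2.le⟩ ht.1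
    have hXtt : X t < min r₁ d :=
      (hXmono ⟨ht.1.le, htt₀.2.le⟩ ⟨ht₁0.le, ht₁t.le⟩ ht.2).trans hXt₁
    have e1 : x₀ + κ * σ * X t = (S s).1 := by
      simp only [X]
      linear_combination ((S s).1 - x₀) * (σ * σ * hκκ + hσσ)
    have e2 : y₀ + κ * y = (S s).2 := by
      rw [← hYt]
      simp only [Y]
      linear_combination ((S s).2 - y₀) * hκκ
    have habs : ∀ ξ ∈ Icc 0 (X t), |κ * σ * ξ| < min r₁ d := fun ξ hξ => by
      rw [mul_assoc, hκabs, hσabs, abs_of_nonneg hξ.1]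
      exact hξ.2.trans_lt hXtt
    have hsegD : ∀ ξ ∈ Icc 0 (X t), (x₀ + κ * σ * ξ, y₀ + κ * y) ∈ D := fun ξ hξ =>
      hbox _ y ((habs ξ hξ).trans_le (min_le_left _ _)) hy.1 (hy.2.trans_le hrr₁)
    let G : ℝ → ℝ := fun ξ => q (x₀ + κ * σ * ξ, y₀ + κ * y) - c
    have hGc : ContinuousOn G (Icc 0 (X t)) :=
      (h.contDiffOn.continuousOn.comp (by fun_prop) hsegD).sub continuousOn_const
    have hGne : ∀ ξ ∈ Ico 0 (X t), G ξ ≠ 0 := by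
      intro ξ hξ hG
      have hξ' : ξ ∈ Icc 0 (X t) := Ico_subset_Icc_self hξ
      obtain ⟨s', hs', hse⟩ := h.sonic _ (hsegD ξ hξ') (sub_eq_zero.1 hG)
      have f1 : (S s').1 = x₀ + κ * σ * ξ := by rw [hse]
      have f2 : (S s').2 = y₀ + κ * y := by rw [hse]
      have hs'δ : |s' - s₀| < δ := hiso s' hs'
        (by rw [f1, add_sub_cancel_left]; exact (habs ξ hξ').trans_le (min_le_right _ _))
        (by
          rw [f2, add_sub_cancel_left, hκabs, abs_of_pos hy.1]
          exact hy.2.trans_le hrd)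
      have hss : s' = s := hmono.injOn
        ⟨hs', by rwa [Metric.mem_ball, Real.dist_eq]⟩ ⟨hsI', hsb⟩ (by simp only [f2, e2])
      rw [hss, ← e1] at f1
      have hκσ : κ * σ ≠ 0 := by
        intro h0
        have : κ * σ * (κ * σ) = 1 := by linear_combination σ * σ * hκκ + hσσ
        rw [h0] at this
        norm_num at this
      exact hξ.2.ne' (mul_left_cancel₀ hκσ (add_left_cancel f1))
    have hGX : G (X t) = 0 := by
      simp only [G]
      rw [e1, e2]
      exact sub_eq_zero.2 (h.eq_of_mem hsI).1
    have hGd : HasDerivAt G (pd₁ q (S s) * (κ * σ)) (X t) := by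
      have h1 : HasDerivAt (fun ξ => x₀ + κ * σ * ξ) (κ * σ) (X t) := by
        simpa using ((hasDerivAt_id (X t)).const_mul (κ * σ)).const_add x₀
      have h2 : HasDerivAt (fun x => q (x, y₀ + κ * y)) (pd₁ q (S s)) (x₀ + κ * σ * X t) := by
        rw [e1, e2]
        exact hasDerivAt_fst (h.differentiableAt (h.mem s hsI))
      exact (h2.comp (X t) h1).sub_const c
    have hGpos : 0 < pd₁ q (S s) * (κ * σ) := by
      rw [← (h.eq_of_mem hsI).2.1]
      have h1 := hδT s hsI' (by simpa [Real.dist_eq] using hsb)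
      have h2 : (T s).1 ≠ 0 := fun h0 => by
        have := hpos t htt₀
        rw [← hs, h0, mul_zero] at this
        exact lt_irrefl _ this
      have h3 := h.pd₁_mul_pos hsI' h2 (fun h0 => by rw [h0, mul_zero] at h1; exact lt_irrefl _ h1)
      have h4 : 0 < a s * (κ * σ) * (κ * σ * (T s).2) := by
        linear_combination h3 - (a s * (T s).2) * (σ * σ * hκκ + hσσ)
      exact pos_of_mul_pos_left h4 h1.le
    obtain ⟨ξ, hξ, hGξ⟩ : ∃ ξ ∈ Ioo 0 (X t), G ξ < 0 := by
      have h1 := (hGd.tendsto_slope.mono_left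
        (nhdsLT_le_nhdsNE (X t))).eventually (lt_mem_nhds hGpos)
      obtain ⟨ξ, h2, h3⟩ := (h1.and (eventually_mem_set.2 (Ioo_mem_nhdsLT hXt0))).exists
      refine ⟨ξ, h3, ?_⟩
      rw [slope_def_field, hGX, sub_zero] at h2
      by_contra hcon
      exact absurd (div_nonpos_of_nonneg_of_nonpos (not_lt.1 hcon) (by linarith [h3.2]))
        (not_le.2 h2)
    have hG0 : G 0 < 0 := by
      by_contra hcon
      obtain ⟨ζ, hζ, hGζ⟩ := intermediate_value_Icc' hξ.1.le
        (hGc.mono (Icc_subset_Icc_right hξ.2.le)) ⟨hGξ.le, not_lt.1 hcon⟩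
      exact hGne ζ ⟨hζ.1, hζ.2.trans_lt hξ.2⟩ hGζ
    simpa [G] using hG0
  refine false_of_pos_of_second_deriv_le (u := fun y => c - q (x₀, y₀ + κ * y))
    (u' := fun y => -(κ * pd₂ q (x₀, y₀ + κ * y)))
    (u'' := fun y => -(κ * (κ * pd₂ (pd₂ q) (x₀, y₀ + κ * y)))) hr hC0
    (fun y hy => (hasDerivAt_ray (h.differentiableAt (hrD y hy.1 hy.2))).const_sub c)
    (fun y hy => ((hasDerivAt_ray (h.differentiableAt₂ (hrD y hy.1 hy.2))).const_mul κ).neg)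
    (fun y hy => sub_pos.2 (hsub y hy)) (fun y hy => ?_) ?_ ?_
  · have h1 := (hP _ (hrD y hy.1 hy.2) (by simpa using hr₂)
      (by simpa [hκabs, abs_of_pos hy.1] using hy.2.trans_le hrr₂)).2 (hsub y hy)
    rw [← mul_assoc, hκκ, one_mul]
    exact h1
  · have := (tendsto_ray hr (h.tendsto_q s₀ hs₀) hrD).const_sub c
    simpa using this
  · have := ((tendsto_ray hr (h.tendsto₂ s₀ hs₀) hrD).const_mul κ).neg
    simpa [hb] using this

end IsSonicArc

/-! ### The angle of the secants of an arc -/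

/-- The direction of the secants of an injective regular arc on `[0,1]`, and of its tangents as
their limits, is given by an angle which depends continuously on both parameters: the secant map has
no zeros on the square `[0,1]²`, and lifts through the exponential. -/
theorem exists_secant_angle {S T : ℝ → ℝ × ℝ} {τ : ℝ} (hτ : τ ≠ 0) (hS : ContinuousOn S (Icc 0 1))
    (hST : ∀ s ∈ Ioo (0 : ℝ) 1, HasDerivAt S (T s) s) (hT : ContinuousOn T (Icc 0 1))
    (hreg : ∀ s ∈ Icc (0 : ℝ) 1, T s ≠ 0) (hinj : InjOn S (Icc 0 1)) :
    ∃ A : ℝ × ℝ → ℝ, Continuous A ∧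
      (∀ s ∈ Icc (0 : ℝ) 1, ∃ ρ > 0, τ * (T s).1 = ρ * Real.cos (A (s, s)) ∧
        τ * (T s).2 = ρ * Real.sin (A (s, s))) ∧
      ∀ s ∈ Icc (0 : ℝ) 1, ∀ t ∈ Icc (0 : ℝ) 1, s < t →
        ∃ ρ > 0, τ * ((S t).2 - (S s).2) = ρ * Real.sin (A (s, t)) := by
  obtain ⟨F, T', hT', hF, hFS, hTT⟩ := exists_antideriv_eqOn hS hST hT
  let V : ℝ × ℝ → ℝ × ℝ := fun p => ∫ r in (0 : ℝ)..1, T' (p.1 + r * (p.2 - p.1))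
  have hV : Continuous V :=
    intervalIntegral.continuous_parametric_intervalIntegral_of_continuous'
      (by
        have : Continuous fun x : (ℝ × ℝ) × ℝ => x.1.1 + x.2 * (x.1.2 - x.1.1) := by fun_prop
        exact hT'.comp this) 0 1
  have hVdiag : ∀ s, V (s, s) = T' s := fun s => by simp [V]
  have hVsec : ∀ s t, (t - s) • V (s, t) = F t - F s := by
    intro s t
    have h1 : ∀ r ∈ uIcc (0 : ℝ) 1, HasDerivAt (fun r => F (s + r * (t - s)))
        ((t - s) • T' (s + r * (t - s))) r := fun r _ => by
      have h2 : HasDerivAt (fun r => s + r * (t - s)) (t - s) r := by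
        simpa using ((hasDerivAt_id r).mul_const (t - s)).const_add s
      exact (hF _).scomp r h2
    have h3 := intervalIntegral.integral_eq_sub_of_hasDerivAt h1
      (Continuous.intervalIntegrable (by fun_prop) _ _)
    rw [intervalIntegral.integral_smul] at h3
    simpa [V] using h3
  have hVne : ∀ s ∈ Icc (0 : ℝ) 1, ∀ t ∈ Icc (0 : ℝ) 1, V (s, t) ≠ 0 := by
    intro s hs t ht h0
    rcases eq_or_ne s t with rfl | hne
    · rw [hVdiag, hTT hs] at h0
      exact hreg s hs h0
    · have := hVsec s t
      rw [h0, smul_zero, hFS hs, hFS ht, eq_comm, sub_eq_zero] at this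
      exact hne (hinj hs ht this.symm)
  let P : ℝ → ℝ := fun s => (projIcc (0 : ℝ) 1 zero_le_one s : ℝ)
  have hPc : Continuous P := continuous_subtype_val.comp continuous_projIcc
  have hPm : ∀ s, P s ∈ Icc (0 : ℝ) 1 := fun s => (projIcc (0 : ℝ) 1 zero_le_one s).2
  have hPe : ∀ s ∈ Icc (0 : ℝ) 1, P s = s := fun s hs => by
    simp only [P]; rw [projIcc_of_mem zero_le_one hs]
  let Z : C(ℝ × ℝ, ℂ) :=
    ⟨fun p => (τ : ℂ) * (((V (P p.1, P p.2)).1 : ℂ) + ((V (P p.1, P p.2)).2 : ℂ) * Complex.I),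
      by fun_prop⟩
  have hZre : ∀ p, (Z p).re = τ * (V (P p.1, P p.2)).1 := fun p => by simp [Z]
  have hZim : ∀ p, (Z p).im = τ * (V (P p.1, P p.2)).2 := fun p => by simp [Z]
  have hZ : ∀ p, Z p ∈ ({0}ᶜ : Set ℂ) := by
    intro p h0
    have h0' : Z p = 0 := h0
    refine hVne _ (hPm p.1) _ (hPm p.2) (Prod.ext ?_ ?_)
    · have := hZre p
      rw [h0', Complex.zero_re, eq_comm] at this
      exact (mul_eq_zero.1 this).resolve_left hτ
    · have := hZim p
      rw [h0', Complex.zero_im, eq_comm] at this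
      exact (mul_eq_zero.1 this).resolve_left hτ
  obtain ⟨W, ⟨-, hW⟩, -⟩ := Complex.isCoveringMapOn_exp.existsUnique_continuousMap_lifts Z
    (a₀ := (0, 0)) (Complex.exp_log (hZ _)) hZ
  have hWre : ∀ p, (Z p).re = Real.exp (W p).re * Real.cos (W p).im := fun p => by
    rw [← Complex.exp_re, ← hW]; rfl
  have hWim : ∀ p, (Z p).im = Real.exp (W p).re * Real.sin (W p).im := fun p => by
    rw [← Complex.exp_im, ← hW]; rfl
  refine ⟨fun p => (W p).im, Complex.continuous_im.comp W.continuous, fun s hs => ?_,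
    fun s hs t ht hst => ?_⟩
  · refine ⟨_, Real.exp_pos (W (s, s)).re, ?_, ?_⟩
    · rw [← hWre, hZre]
      simp only
      rw [hPe s hs, hVdiag, hTT hs]
    · rw [← hWim, hZim]
      simp only
      rw [hPe s hs, hVdiag, hTT hs]
  · refine ⟨(t - s) * Real.exp (W (s, t)).re, mul_pos (sub_pos.2 hst) (Real.exp_pos _), ?_⟩
    rw [mul_assoc, ← hWim, hZim]
    simp only
    rw [hPe s hs, hPe t ht]
    have := congrArg Prod.snd (hVsec s t)
    rw [hFS hs, hFS ht] at this
    simp only [Prod.smul_snd, smul_eq_mul, Prod.snd_sub] at this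
    rw [← this]
    ring

/-- If the sine is positive along a continuous function, then values in `[0, π]` persist. -/
theorem mem_Icc_of_sin_pos {B : ℝ → ℝ} (hB : Continuous B) {e : ℝ} (he : B e ∈ Icc 0 Real.pi)
    (hsin : 0 < Real.sin (B e)) {t : ℝ} (hpos : ∀ r ∈ uIcc t e, r ≠ t → 0 < Real.sin (B r)) :
    B t ∈ Icc 0 Real.pi := by
  have he0 : 0 < B e := he.1.lt_of_ne fun h => by rw [← h, Real.sin_zero] at hsin; exact hsin.false
  have heπ : B e < Real.pi := he.2.lt_of_ne fun h => by
    rw [h, Real.sin_pi] at hsin; exact hsin.false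
  constructor
  · by_contra! hcon
    obtain ⟨r, hr, hr0⟩ := intermediate_value_uIcc hB.continuousOn
      (show (0 : ℝ) ∈ uIcc (B t) (B e) from mem_uIcc.2 (Or.inl ⟨hcon.le, he0.le⟩))
    have := hpos r hr (by rintro rfl; exact hcon.ne hr0)
    rw [hr0, Real.sin_zero] at this
    exact this.false
  · by_contra! hcon
    obtain ⟨r, hr, hr0⟩ := intermediate_value_uIcc hB.continuousOn
      (show Real.pi ∈ uIcc (B t) (B e) from mem_uIcc.2 (Or.inr ⟨heπ.le, hcon.le⟩))
    have := hpos r hr (by rintro rfl; exact hcon.ne' hr0)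
    rw [hr0, Real.sin_pi] at this
    exact this.false

namespace IsSonicArc

variable {c τ : ℝ} {D : Set (ℝ × ℝ)} {q : ℝ × ℝ → ℝ} {S T : ℝ → ℝ × ℝ} {a b : ℝ → ℝ}

/-- The tangent angle `α` of a sonic arc can pass a vertical direction `β` only upwards: this is
what `no_turn` says about the last (first) parameter at which `α ≥ β` (`α ≤ β`). -/
theorem angle_crossing (h : IsSonicArc c τ D q S T a b) {α : ℝ → ℝ} (hα : Continuous α)
    (hαT : ∀ s ∈ Icc (0 : ℝ) 1, ∃ ρ > 0, τ * (T s).1 = ρ * Real.cos (α s) ∧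
      τ * (T s).2 = ρ * Real.sin (α s)) {β : ℝ} (hβ : Real.cos β = 0) {σ s₀ t₀ : ℝ}
    (hσ : σ = 1 ∨ σ = -1) (hs₀ : s₀ ∈ Icc (0 : ℝ) 1) (ht₀ : 0 ≤ t₀)
    (hst₀ : s₀ + σ * t₀ ∈ Icc (0 : ℝ) 1) (h0 : 0 ≤ σ * (α s₀ - β)) :
    0 ≤ σ * (α (s₀ + σ * t₀) - β) := by
  by_contra! hcon
  have hσσ : σ * σ = 1 := by rcases hσ with rfl | rfl <;> norm_num
  have hττ : τ * τ = 1 := by rcases h.sign with h1 | h1 <;> rw [h1] <;> norm_num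
  have hβs : Real.sin β = 1 ∨ Real.sin β = -1 := by
    have := Real.sin_sq_add_cos_sq β
    rw [hβ] at this
    exact sq_eq_one_iff.1 (by linarith)
  have hββ : Real.sin β * Real.sin β = 1 := by rcases hβs with h1 | h1 <;> rw [h1] <;> norm_num
  let g : ℝ → ℝ := fun t => σ * (α (s₀ + σ * t) - β)
  have hg : Continuous g := by fun_prop
  have hg0 : 0 ≤ g 0 := by simpa [g] using h0
  have hK : IsCompact (Icc 0 t₀ ∩ g ⁻¹' Ici 0) :=
    isCompact_Icc.inter_right (isClosed_Ici.preimage hg)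
  obtain ⟨t₁, ⟨ht₁, hgt₁⟩, hmax⟩ := hK.exists_isGreatest ⟨0, ⟨le_rfl, ht₀⟩, hg0⟩
  have hgt₁' : 0 ≤ g t₁ := hgt₁
  have ht₁t₀ : t₁ < t₀ := ht₁.2.lt_of_ne (by rintro rfl; exact absurd hgt₁' (not_le.2 hcon))
  have hneg : ∀ t, t₁ < t → t ≤ t₀ → g t < 0 := fun t h1 h2 => by
    by_contra! h3
    exact absurd (hmax ⟨⟨ht₁.1.trans h1.le, h2⟩, h3⟩) (not_le.2 h1)
  have hgt₁0 : g t₁ = 0 := by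
    refine le_antisymm (le_of_tendsto (hg.continuousAt.tendsto.mono_left
      (nhdsWithin_le_nhds (s := Ioi t₁))) ?_) hgt₁'
    filter_upwards [Ioc_mem_nhdsGT ht₁t₀] with t ht using (hneg t ht.1 ht.2).le
  obtain ⟨η, hη, hηball⟩ := Metric.mem_nhds_iff.1
    (hg.continuousAt.eventually (lt_mem_nhds (show -Real.pi < g t₁ by
      rw [hgt₁0]; exact neg_lt_zero.2 Real.pi_pos)))
  have hmem : ∀ t ∈ Icc 0 t₀, s₀ + σ * t ∈ Icc (0 : ℝ) 1 := by
    intro t ht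
    rcases hσ with rfl | rfl
    · exact ⟨by linarith [hs₀.1, ht.1], by linarith [hst₀.2, ht.2]⟩
    · exact ⟨by linarith [hst₀.1, ht.2], by linarith [hs₀.2, ht.1]⟩
  have hα₁ : α (s₀ + σ * t₁) = β := by
    have : σ * g t₁ = 0 := by rw [hgt₁0, mul_zero]
    simp only [g] at this
    linear_combination this - (α (s₀ + σ * t₁) - β) * hσσ
  have hm₁ := hmem t₁ ht₁
  obtain ⟨ρ₁, hρ₁, h1, h2⟩ := hαT _ hm₁
  rw [hα₁] at h1 h2
  rw [hβ, mul_zero] at h1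
  have hκ : τ * σ * Real.sin β = 1 ∨ τ * σ * Real.sin β = -1 := by
    rcases h.sign with h3 | h3 <;> rcases hσ with h4 | h4 <;> rcases hβs with h5 | h5 <;>
      rw [h3, h4, h5] <;> norm_num
  refine h.no_turn (t₀ := min η (t₀ - t₁)) hσ hκ hm₁ ?_ ?_ (lt_min hη (sub_pos.2 ht₁t₀)) ?_
    fun t ht => ?_
  · linear_combination τ * h1 - (T (s₀ + σ * t₁)).1 * hττ
  · have : τ * σ * Real.sin β * σ * (T (s₀ + σ * t₁)).2 = ρ₁ := by
      linear_combination Real.sin β * σ * σ * h2 + ρ₁ * Real.sin β * Real.sin β * hσσ + ρ₁ * hββ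
    rw [this]
    exact hρ₁
  · rw [add_assoc, ← mul_add]
    exact hmem _ ⟨add_nonneg ht₁.1 (lt_min hη (sub_pos.2 ht₁t₀)).le,
      by linarith [min_le_right η (t₀ - t₁)]⟩
  · have ht2 : t < t₀ - t₁ := ht.2.trans_le (min_le_right _ _)
    have hgn : g (t₁ + t) < 0 := hneg _ (by linarith [ht.1]) (by linarith)
    have hgπ : -Real.pi < g (t₁ + t) := hηball (by
      rw [Metric.mem_ball, Real.dist_eq, add_sub_cancel_left, abs_of_pos ht.1]
      exact ht.2.trans_le (min_le_left _ _))
    have e : s₀ + σ * t₁ + σ * t = s₀ + σ * (t₁ + t) := by ring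
    rw [e]
    obtain ⟨ρ, hρ, h3, -⟩ := hαT _ (hmem (t₁ + t) ⟨by linarith [ht.1, ht₁.1], by linarith⟩)
    have h4 : Real.sin (-g (t₁ + t)) = σ * (Real.sin β * Real.cos (α (s₀ + σ * (t₁ + t)))) := by
      have : Real.sin (β - α (s₀ + σ * (t₁ + t)))
          = Real.sin β * Real.cos (α (s₀ + σ * (t₁ + t))) := by
        rw [Real.sin_sub, hβ, zero_mul, sub_zero]
      rw [← this]
      rcases hσ with h5 | h5
      · simp [g, h5]
      · have h6 : -g (t₁ + t) = -(β - α (s₀ + σ * (t₁ + t))) := by simp [g, h5]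
        rw [h6, Real.sin_neg, h5]
        ring
    have h6 := Real.sin_pos_of_pos_of_lt_pi (neg_pos.2 hgn) (by linarith)
    rw [h4] at h6
    have h7 : τ * σ * Real.sin β * (T (s₀ + σ * (t₁ + t))).1
        = ρ * (σ * (Real.sin β * Real.cos (α (s₀ + σ * (t₁ + t))))) := by
      linear_combination σ * Real.sin β * h3
    rw [h7]
    exact mul_pos hρ h6

/-- If the tangent of a sonic arc is vertical at `S s`, then `τ φ` is nondecreasing along the arc
before and nonincreasing after this point. Hopf's comparison of the angles of secants and tangents
shows that the tangent angle belongs to `[0, π]` at both ends of the arc; since it passes the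
vertical directions only upwards, it remains between `-π/2` and `3π/2`. -/
theorem monotone_before_antitone_after (h : IsSonicArc c τ D q S T a b) {s : ℝ}
    (hs : s ∈ Icc (0 : ℝ) 1) (hTs : (T s).1 = 0) {t : ℝ} (ht : t ∈ Icc (0 : ℝ) 1) :
    (t < s → 0 ≤ τ * (T t).1) ∧ (s < t → τ * (T t).1 ≤ 0) := by
  have hτ : τ ≠ 0 := by rcases h.sign with h1 | h1 <;> rw [h1] <;> norm_num
  obtain ⟨A₀, hA₀, hdiag₀, hsec₀⟩ := exists_secant_angle hτ h.continuousOn h.hasDerivAt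
    h.continuousOn_deriv h.regular h.injOn
  have m0 : (0 : ℝ) ∈ Icc (0 : ℝ) 1 := ⟨le_rfl, zero_le_one⟩
  have m1 : (1 : ℝ) ∈ Icc (0 : ℝ) 1 := ⟨zero_le_one, le_rfl⟩
  -- normalize the angle of the secant from the start to the end
  obtain ⟨A, hA, hdiag, hsec, hA01⟩ : ∃ A : ℝ × ℝ → ℝ, Continuous A ∧
      (∀ s ∈ Icc (0 : ℝ) 1, ∃ ρ > 0, τ * (T s).1 = ρ * Real.cos (A (s, s)) ∧
        τ * (T s).2 = ρ * Real.sin (A (s, s))) ∧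
      (∀ s ∈ Icc (0 : ℝ) 1, ∀ t ∈ Icc (0 : ℝ) 1, s < t →
        ∃ ρ > 0, τ * ((S t).2 - (S s).2) = ρ * Real.sin (A (s, t))) ∧
      A (0, 1) ∈ Icc (-Real.pi) Real.pi := by
    obtain ⟨k, hk⟩ : ∃ k : ℤ, A₀ (0, 1) - k * (2 * Real.pi) ∈ Icc (-Real.pi) Real.pi := by
      have h1 := toIocMod_mem_Ioc Real.two_pi_pos (-Real.pi) (A₀ (0, 1))
      refine ⟨toIocDiv Real.two_pi_pos (-Real.pi) (A₀ (0, 1)), ?_⟩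
      rw [toIocMod, zsmul_eq_mul] at h1
      exact ⟨h1.1.le, by linarith [h1.2]⟩
    refine ⟨fun p => A₀ p - k * (2 * Real.pi), by fun_prop, fun s hs => ?_, fun s hs t ht hst => ?_,
      hk⟩
    · simp only [Real.cos_sub_int_mul_two_pi, Real.sin_sub_int_mul_two_pi]
      exact hdiag₀ s hs
    · simp only [Real.sin_sub_int_mul_two_pi]
      exact hsec₀ s hs t ht hst
  have hsin0 : ∀ t ∈ Ioc (0 : ℝ) 1, 0 < Real.sin (A (0, t)) := fun t ht => by
    obtain ⟨ρ, hρ, h1⟩ := hsec 0 m0 t ⟨ht.1.le, ht.2⟩ ht.1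
    have h2 := h.above t ht
    rw [h1] at h2
    exact pos_of_mul_pos_right h2 hρ.le
  have hsin1 : ∀ t ∈ Ico (0 : ℝ) 1, 0 < Real.sin (A (t, 1)) := fun t ht => by
    obtain ⟨ρ, hρ, h1⟩ := hsec t ⟨ht.1, ht.2.le⟩ 1 m1 ht.2
    have h2 := h.below t ht
    rw [h1] at h2
    exact pos_of_mul_pos_right h2 hρ.le
  have hA01' : A (0, 1) ∈ Icc 0 Real.pi := by
    refine ⟨?_, hA01.2⟩
    by_contra! hcon
    exact absurd (hsin0 1 ⟨one_pos, le_rfl⟩)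
      (not_lt.2 (Real.sin_nonpos_of_nonpos_of_neg_pi_le hcon.le hA01.1))
  have hα0 : A (0, 0) ∈ Icc 0 Real.pi :=
    mem_Icc_of_sin_pos (B := fun t => A (0, t)) (by fun_prop) hA01' (hsin0 1 ⟨one_pos, le_rfl⟩)
      fun r hr hr0 => by
        rw [uIcc_of_le zero_le_one] at hr
        exact hsin0 r ⟨hr.1.lt_of_ne hr0.symm, hr.2⟩
  have hα1 : A (1, 1) ∈ Icc 0 Real.pi :=
    mem_Icc_of_sin_pos (B := fun t => A (t, 1)) (by fun_prop) hA01' (hsin1 0 ⟨le_rfl, one_pos⟩)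
      fun r hr hr0 => by
        rw [uIcc_of_ge zero_le_one] at hr
        exact hsin1 r ⟨hr.1, hr.2.lt_of_ne hr0⟩
  let α : ℝ → ℝ := fun s => A (s, s)
  have hα : Continuous α := by fun_prop
  have hfwd : ∀ β, Real.cos β = 0 → ∀ r ∈ Icc (0 : ℝ) 1, ∀ r' ∈ Icc (0 : ℝ) 1, r ≤ r' →
      β ≤ α r → β ≤ α r' := by
    intro β hβ r hr r' hr' hrr' hβr
    have := h.angle_crossing hα hdiag hβ (σ := 1) (t₀ := r' - r) (Or.inl rfl) hr
      (by linarith) (by simpa using hr') (by linarith)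
    simpa using this
  have hbwd : ∀ β, Real.cos β = 0 → ∀ r ∈ Icc (0 : ℝ) 1, ∀ r' ∈ Icc (0 : ℝ) 1, r' ≤ r →
      α r ≤ β → α r' ≤ β := by
    intro β hβ r hr r' hr' hrr' hβr
    have := h.angle_crossing hα hdiag hβ (σ := -1) (t₀ := r - r') (Or.inr rfl) hr
      (by linarith) (by simpa using hr') (by linarith)
    simpa using this
  have hcos1 : Real.cos (3 * Real.pi / 2) = 0 := by
    rw [show 3 * Real.pi / 2 = Real.pi / 2 + Real.pi by ring, Real.cos_add_pi, Real.cos_pi_div_two,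
      neg_zero]
  have hcos2 : Real.cos (-(Real.pi / 2)) = 0 := by rw [Real.cos_neg, Real.cos_pi_div_two]
  have hπ := Real.pi_pos
  have hrange : ∀ r ∈ Icc (0 : ℝ) 1, -(Real.pi / 2) < α r ∧ α r < 3 * Real.pi / 2 := by
    intro r hr
    constructor
    · by_contra! hcon
      have := hbwd _ hcos2 r hr 0 m0 hr.1 hcon
      linarith [hα0.1]
    · by_contra! hcon
      have := hfwd _ hcos1 r hr 1 m1 hr.2 hcon
      linarith [hα1.2]
  have hαs : α s = Real.pi / 2 := by
    obtain ⟨ρ, hρ, h1, -⟩ := hdiag s hs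
    rw [hTs, mul_zero, eq_comm] at h1
    have h2 : Real.cos (α s) = 0 := (mul_eq_zero.1 h1).resolve_left hρ.ne'
    obtain ⟨h3, h4⟩ := hrange s hs
    rcases lt_trichotomy (α s) (Real.pi / 2) with h5 | h5 | h5
    · exact absurd h2 (Real.cos_pos_of_mem_Ioo ⟨h3, h5⟩).ne'
    · exact h5
    · exact absurd h2 (Real.cos_neg_of_pi_div_two_lt_of_lt h5 (by linarith)).ne
  obtain ⟨h3, h4⟩ := hrange t ht
  obtain ⟨ρ, hρ, h1, -⟩ := hdiag t ht
  rw [h1]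
  constructor
  · intro hts
    have := hbwd _ Real.cos_pi_div_two s hs t ht hts.le hαs.le
    exact mul_nonneg hρ.le (Real.cos_nonneg_of_mem_Icc ⟨h3.le, this⟩)
  · intro hts
    have := hfwd _ Real.cos_pi_div_two s hs t ht hts.le hαs.ge
    exact mul_nonpos_of_nonneg_of_nonpos hρ.le
      (Real.cos_nonpos_of_pi_div_two_le_of_le this (by linarith))

end IsSonicArc

/-! ### The three parts of the curve -/

/-- The sign pattern of the derivative `f` of `φ` along the curve: once `f` vanishes, `τ f` has been
nonnegative before and will be nonpositive afterwards. -/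
def IsUnimodalSign (τ : ℝ) (f : ℝ → ℝ) : Prop :=
  ∀ s ∈ Icc (0 : ℝ) 1, f s = 0 → ∀ t ∈ Icc (0 : ℝ) 1,
    (t < s → 0 ≤ τ * f t) ∧ (s < t → τ * f t ≤ 0)

namespace IsUnimodalSign

variable {τ : ℝ} {f : ℝ → ℝ}

theorem exists_zero (hf : ContinuousOn f (Icc 0 1)) {s t : ℝ} (hs : s ∈ Icc (0 : ℝ) 1)
    (ht : t ∈ Icc (0 : ℝ) 1) (h1 : τ * f s < 0) (h2 : 0 < τ * f t) :
    ∃ z ∈ Icc (0 : ℝ) 1, z ∈ uIcc s t ∧ f z = 0 := by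
  have hτ : τ ≠ 0 := by rintro rfl; simp at h1
  have hsub : uIcc s t ⊆ Icc 0 1 := (convex_Icc (0 : ℝ) 1).ordConnected.uIcc_subset hs ht
  obtain ⟨z, hz, h0⟩ := intermediate_value_uIcc ((continuousOn_const.mul hf).mono hsub)
    (mem_uIcc.2 (Or.inl ⟨h1.le, h2.le⟩))
  exact ⟨z, hsub hz, hz, (mul_eq_zero.1 h0).resolve_left hτ⟩

theorem pos_of_le (h : IsUnimodalSign τ f) (hf : ContinuousOn f (Icc 0 1)) {s t : ℝ}
    (hs : s ∈ Icc (0 : ℝ) 1) (ht : t ∈ Icc (0 : ℝ) 1) (hst : s ≤ t) (h2 : 0 < τ * f t) :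
    0 < τ * f s := by
  rcases hst.eq_or_lt with rfl | hlt
  · exact h2
  by_contra! h1
  rcases h1.lt_or_eq with h1 | h1
  · obtain ⟨z, hz, hzm, h0⟩ := exists_zero hf hs ht h1 h2
    rw [uIcc_of_le hst] at hzm
    have hzt : z < t := hzm.2.lt_of_ne (by rintro rfl; rw [h0, mul_zero] at h2; exact h2.false)
    exact absurd ((h z hz h0 t ht).2 hzt) (not_le.2 h2)
  · have hτ : τ ≠ 0 := by rintro rfl; simp at h2
    exact absurd ((h s hs ((mul_eq_zero.1 h1).resolve_left hτ) t ht).2 hlt) (not_le.2 h2)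

theorem neg_of_le (h : IsUnimodalSign τ f) (hf : ContinuousOn f (Icc 0 1)) {s t : ℝ}
    (hs : s ∈ Icc (0 : ℝ) 1) (ht : t ∈ Icc (0 : ℝ) 1) (hst : s ≤ t) (h1 : τ * f s < 0) :
    τ * f t < 0 := by
  by_contra! h2
  rcases h2.lt_or_eq with h2 | h2
  · exact absurd (h.pos_of_le hf hs ht hst h2) (not_lt.2 h1.le)
  · have hτ : τ ≠ 0 := by rintro rfl; simp at h1
    have hlt : s < t := hst.lt_of_ne (by rintro rfl; rw [← h2] at h1; exact h1.false)
    exact absurd ((h t ht ((mul_eq_zero.1 h2.symm).resolve_left hτ) s hs).1 hlt) (not_le.2 h1)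

theorem ordConnected_pos (h : IsUnimodalSign τ f) (hf : ContinuousOn f (Icc 0 1)) :
    OrdConnected {s ∈ Icc (0 : ℝ) 1 | 0 < τ * f s} :=
  ⟨fun _ hs _ ht r hr =>
    have hr' : r ∈ Icc (0 : ℝ) 1 := ⟨hs.1.1.trans hr.1, hr.2.trans ht.1.2⟩
    ⟨hr', h.pos_of_le hf hr' ht.1 hr.2 ht.2⟩⟩

theorem ordConnected_neg (h : IsUnimodalSign τ f) (hf : ContinuousOn f (Icc 0 1)) :
    OrdConnected {s ∈ Icc (0 : ℝ) 1 | τ * f s < 0} :=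
  ⟨fun _ hs _ ht r hr =>
    have hr' : r ∈ Icc (0 : ℝ) 1 := ⟨hs.1.1.trans hr.1, hr.2.trans ht.1.2⟩
    ⟨hr', h.neg_of_le hf hs.1 hr' hr.1 hs.2⟩⟩

theorem ordConnected_zero (h : IsUnimodalSign τ f) (hτ : τ ≠ 0) :
    OrdConnected {s ∈ Icc (0 : ℝ) 1 | f s = 0} := by
  refine ⟨fun s hs t ht r hr => ?_⟩
  have hr' : r ∈ Icc (0 : ℝ) 1 := ⟨hs.1.1.trans hr.1, hr.2.trans ht.1.2⟩
  refine ⟨hr', ?_⟩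
  rcases hr.1.eq_or_lt with rfl | h1
  · exact hs.2
  rcases hr.2.eq_or_lt with rfl | h2
  · exact ht.2
  exact (mul_eq_zero.1 (le_antisymm ((h s hs.1 hs.2 r hr').2 h1)
    ((h t ht.1 ht.2 r hr').1 h2))).resolve_left hτ

theorem zero_eq_Icc (h : IsUnimodalSign τ f) (hτ : τ ≠ 0) (hf : ContinuousOn f (Icc 0 1)) :
    {s ∈ Icc (0 : ℝ) 1 | f s = 0} = ∅ ∨
      ∃ a b, 0 ≤ a ∧ a ≤ b ∧ b ≤ 1 ∧ {s ∈ Icc (0 : ℝ) 1 | f s = 0} = Icc a b := by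
  rcases eq_empty_or_nonempty {s ∈ Icc (0 : ℝ) 1 | f s = 0} with he | hne
  · exact Or.inl he
  right
  have hK : IsCompact {s ∈ Icc (0 : ℝ) 1 | f s = 0} :=
    isCompact_Icc.of_isClosed_subset (hf.preimage_isClosed_of_isClosed isClosed_Icc
      (isClosed_singleton (x := (0 : ℝ)))) inter_subset_left
  obtain ⟨a, ha⟩ := hK.exists_isLeast hne
  obtain ⟨b, hb⟩ := hK.exists_isGreatest hne
  refine ⟨a, b, ha.1.1.1, ha.2 hb.1, hb.1.1.2, Subset.antisymm (fun s hs => ⟨ha.2 hs, hb.2 hs⟩) ?_⟩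
  exact (h.ordConnected_zero hτ).out ha.1 hb.1

theorem ordConnected_parts (h : IsUnimodalSign τ f) (hτ : τ = 1 ∨ τ = -1)
    (hf : ContinuousOn f (Icc 0 1)) : OrdConnected {s ∈ Icc (0 : ℝ) 1 | f s < 0} ∧
      OrdConnected {s ∈ Icc (0 : ℝ) 1 | 0 < f s} := by
  have h1 := h.ordConnected_pos hf
  have h2 := h.ordConnected_neg hf
  rcases hτ with rfl | rfl
  · simp only [one_mul] at h1 h2
    exact ⟨h2, h1⟩
  · simp only [neg_mul, one_mul, Left.neg_pos_iff, Left.neg_neg_iff] at h1 h2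
    exact ⟨h1, h2⟩

/-- The decomposition of a curve according to the sign of `f`. -/
theorem isDecomposition (h : IsUnimodalSign τ f) (hf : ContinuousOn f (Icc 0 1)) {S : ℝ → ℝ × ℝ}
    (hS : ContinuousOn S (Icc 0 1)) (hinj : InjOn S (Icc 0 1)) {Wl Wu : Set (ℝ × ℝ)}
    (hends : (τ = 1 ∧ S 0 ∈ Wl ∧ S 1 ∈ Wu) ∨ (τ = -1 ∧ S 0 ∈ Wu ∧ S 1 ∈ Wl)) :
    IsDecomposition Wl Wu (S '' Icc 0 1) (S '' {s ∈ Icc (0 : ℝ) 1 | f s = 0})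
      (S '' {s ∈ Icc (0 : ℝ) 1 | f s < 0}) (S '' {s ∈ Icc (0 : ℝ) 1 | 0 < f s}) := by
  have hτ : τ = 1 ∨ τ = -1 := hends.imp (fun h => h.1) (fun h => h.1)
  have hτ0 : τ ≠ 0 := by rcases hτ with rfl | rfl <;> norm_num
  have m0 : (0 : ℝ) ∈ Icc (0 : ℝ) 1 := ⟨le_rfl, zero_le_one⟩
  have m1 : (1 : ℝ) ∈ Icc (0 : ℝ) 1 := ⟨zero_le_one, le_rfl⟩
  obtain ⟨hP, hN⟩ := h.ordConnected_parts hτ hf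
  have hdisj : ∀ p q : ℝ → Prop, (∀ s, p s → ¬ q s) →
      Disjoint (S '' {s ∈ Icc (0 : ℝ) 1 | p s}) (S '' {s ∈ Icc (0 : ℝ) 1 | q s}) := by
    intro p q hpq
    rw [Set.disjoint_left]
    rintro _ ⟨s, hs, rfl⟩ ⟨t, ht, he⟩
    rw [hinj ht.1 hs.1 he] at ht
    exact hpq s hs.2 ht.2
  refine ⟨?_, hdisj _ _ fun s h1 h2 => h2.ne h1, hdisj _ _ fun s h1 h2 => h2.ne' h1,
    hdisj _ _ fun s h1 h2 => h1.not_gt h2,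
    (h.ordConnected_zero hτ0).isPreconnected.image _ (hS.mono (sep_subset _ _)),
    hP.isPreconnected.image _ (hS.mono (sep_subset _ _)),
    hN.isPreconnected.image _ (hS.mono (sep_subset _ _)), ?_, ?_, ?_⟩
  · refine Subset.antisymm ?_ ?_
    · rintro _ ⟨s, hs, rfl⟩
      rcases lt_trichotomy (f s) 0 with h1 | h1 | h1
      · exact Or.inl (Or.inr ⟨s, ⟨hs, h1⟩, rfl⟩)
      · exact Or.inl (Or.inl ⟨s, ⟨hs, h1⟩, rfl⟩)
      · exact Or.inr ⟨s, ⟨hs, h1⟩, rfl⟩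
    · exact union_subset (union_subset (image_mono (sep_subset _ _))
        (image_mono (sep_subset _ _))) (image_mono (sep_subset _ _))
  · rintro ⟨_, s, ⟨hs, hfs⟩, rfl⟩
    rcases hends with ⟨rfl, -, h1⟩ | ⟨rfl, h1, -⟩
    · have := h.neg_of_le hf hs m1 hs.2 (by linarith)
      exact ⟨S 1, ⟨1, ⟨m1, by linarith⟩, rfl⟩, h1⟩
    · have := h.pos_of_le hf m0 hs hs.1 (by linarith)
      exact ⟨S 0, ⟨0, ⟨m0, by linarith⟩, rfl⟩, h1⟩
  · rintro ⟨_, s, ⟨hs, hfs⟩, rfl⟩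
    rcases hends with ⟨rfl, h1, -⟩ | ⟨rfl, -, h1⟩
    · have := h.pos_of_le hf m0 hs hs.1 (by linarith)
      exact ⟨S 0, ⟨0, ⟨m0, by linarith⟩, rfl⟩, h1⟩
    · have := h.neg_of_le hf hs m1 hs.2 (by linarith)
      exact ⟨S 1, ⟨1, ⟨m1, by linarith⟩, rfl⟩, h1⟩
  · intro he
    rw [image_eq_empty] at he
    obtain ⟨ε, hε, hsign⟩ := exists_sign_of_isPreconnected isPreconnected_Icc hf
      (fun s hs h0 => (he ▸ (⟨hs, h0⟩ : s ∈ {s ∈ Icc (0 : ℝ) 1 | f s = 0}) : s ∈ (∅ : Set ℝ)))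
    rcases hε with rfl | rfl
    · right
      congr 1
      exact Subset.antisymm (fun s hs => ⟨hs, by simpa using hsign s hs⟩) (sep_subset _ _)
    · left
      congr 1
      exact Subset.antisymm (fun s hs => ⟨hs, by simpa using hsign s hs⟩) (sep_subset _ _)

end IsUnimodalSign

theorem exists_graph {P : Set (ℝ × ℝ)} (h : ∀ p ∈ P, ∀ p' ∈ P, p.1 = p'.1 → p = p') :
    ∃ g : ℝ → ℝ, ∀ p ∈ P, p.2 = g p.1 := by
  classical
  refine ⟨fun x => if hx : ∃ p ∈ P, p.1 = x then hx.choose.2 else 0, fun p hp => ?_⟩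
  have hx : ∃ p' ∈ P, p'.1 = p.1 := ⟨p, hp, rfl⟩
  simp only [dif_pos hx]
  exact congrArg Prod.snd (h p hp _ hx.choose_spec.1 hx.choose_spec.2.symm)

/-- A function whose derivative vanishes on `[a, b] ⊆ [0, 1]` is constant there. -/
theorem eq_of_deriv_eq_zero {g g' : ℝ → ℝ} {a b : ℝ}
    (hg : ∀ s ∈ Icc (0 : ℝ) 1, HasDerivWithinAt g (g' s) (Icc 0 1) s) (ha : 0 ≤ a) (hb : b ≤ 1)
    (h0 : ∀ s ∈ Icc a b, g' s = 0) : ∀ s ∈ Icc a b, g s = g a := by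
  intro s hs
  have hsub : Icc a b ⊆ Icc 0 1 := Icc_subset_Icc ha hb
  have := (convex_Icc a b).norm_image_sub_le_of_norm_hasDerivWithin_le (f := g) (f' := g') (C := 0)
    (fun x hx => (hg x (hsub hx)).mono hsub) (fun x hx => by simp [h0 x hx])
    (left_mem_Icc.2 (hs.1.trans hs.2)) hs
  rw [zero_mul, norm_le_zero_iff, sub_eq_zero] at this
  exact this

theorem IsUnimodalSign.hasPotentialShape {τ : ℝ} {S T : ℝ → ℝ × ℝ}
    (h : IsUnimodalSign τ fun s => (T s).1) (hτ : τ = 1 ∨ τ = -1)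
    (hS : ∀ s ∈ Icc (0 : ℝ) 1, HasDerivWithinAt S (T s) (Icc 0 1) s)
    (hT : ContinuousOn T (Icc 0 1)) (hinj : InjOn S (Icc 0 1)) :
    HasPotentialShape S (S '' {s ∈ Icc (0 : ℝ) 1 | (T s).1 = 0})
      (S '' {s ∈ Icc (0 : ℝ) 1 | (T s).1 < 0}) (S '' {s ∈ Icc (0 : ℝ) 1 | 0 < (T s).1}) := by
  have hτ0 : τ ≠ 0 := by rcases hτ with rfl | rfl <;> norm_num
  have hSc : ContinuousOn S (Icc 0 1) := fun s hs => (hS s hs).continuousWithinAt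
  obtain ⟨hP, hN⟩ := h.ordConnected_parts hτ hT.fst
  have hderiv : ∀ s ∈ Ioo (0 : ℝ) 1, deriv (fun s => (S s).1) s = (T s).1 := fun s hs =>
    ((hasDerivWithinAt_coord₁ (hS s (Ioo_subset_Icc_self hs))).hasDerivAt
      (Icc_mem_nhds hs.1 hs.2)).deriv
  have hint : ∀ A : Set ℝ, A ⊆ Icc 0 1 → interior A ⊆ Ioo 0 1 := fun A hA => by
    rw [← interior_Icc]; exact interior_mono hA
  have hanti : StrictAntiOn (fun s => (S s).1) {s ∈ Icc (0 : ℝ) 1 | (T s).1 < 0} :=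
    strictAntiOn_of_deriv_neg hP.convex (hSc.fst.mono (sep_subset _ _)) fun s hs => by
      rw [hderiv s (hint _ (sep_subset _ _) hs)]
      exact (interior_subset hs).2
  have hmono : StrictMonoOn (fun s => (S s).1) {s ∈ Icc (0 : ℝ) 1 | 0 < (T s).1} :=
    strictMonoOn_of_deriv_pos hN.convex (hSc.fst.mono (sep_subset _ _)) fun s hs => by
      rw [hderiv s (hint _ (sep_subset _ _) hs)]
      exact (interior_subset hs).2
  have hback : ∀ A : Set ℝ, A ⊆ Icc 0 1 → ∀ s ∈ Icc (0 : ℝ) 1, S s ∈ S '' A → s ∈ A := by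
    rintro A hA s hs ⟨t, ht, he⟩
    rwa [← hinj (hA ht) hs he]
  refine ⟨?_, exists_graph ?_, exists_graph ?_, ?_, ?_⟩
  · rcases h.zero_eq_Icc hτ0 hT.fst with he | ⟨a, b, ha, hab, hb, he⟩
    · left
      rw [he, image_empty]
    · right
      rw [he]
      have hsub : Icc a b ⊆ Icc 0 1 := Icc_subset_Icc ha hb
      have hconst : ∀ s ∈ Icc a b, (S s).1 = (S a).1 :=
        eq_of_deriv_eq_zero (g := fun s => (S s).1) (g' := fun s => (T s).1)
          (fun s hs => hasDerivWithinAt_coord₁ (hS s hs)) ha hb fun s hs => by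
          rw [← he] at hs
          exact hs.2
      obtain ⟨y₁, y₂, himg⟩ : ∃ y₁ y₂, (fun s => (S s).2) '' Icc a b = Icc y₁ y₂ :=
        ⟨_, _, (hSc.snd.mono hsub).image_Icc hab⟩
      refine ⟨(S a).1, y₁, y₂, ?_, ?_⟩
      · rw [← nonempty_Icc, ← himg]
        exact (nonempty_Icc.2 hab).image _
      · ext p
        rw [mem_prod, ← himg]
        constructor
        · rintro ⟨s, hs, rfl⟩
          exact ⟨hconst s hs, s, hs, rfl⟩
        · rintro ⟨h1, s, hs, h2⟩
          exact ⟨s, hs, Prod.ext ((hconst s hs).trans h1.symm) h2⟩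
  · rintro _ ⟨s, hs, rfl⟩ _ ⟨t, ht, rfl⟩ he
    rw [hanti.injOn hs ht he]
  · rintro _ ⟨s, hs, rfl⟩ _ ⟨t, ht, rfl⟩ he
    rw [hmono.injOn hs ht he]
  · intro s hs t ht hSs hSt hst
    exact hanti (hback _ (sep_subset _ _) s hs hSs) (hback _ (sep_subset _ _) t ht hSt) hst
  · intro s hs t ht hSs hSt hst
    exact hmono (hback _ (sep_subset _ _) s hs hSs) (hback _ (sep_subset _ _) t ht hSt) hst

/-- An injective path on a straight line covers the segment between its endpoints. -/
theorem image_Icc_eq_segment {S : ℝ → ℝ × ℝ} {a b : ℝ} (hab : a ≤ b)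
    (hS : ContinuousOn S (Icc a b)) (hinj : InjOn S (Icc a b)) {n : ℝ × ℝ} (hn : n ≠ 0)
    (hline : ∀ s ∈ Icc a b, n.1 * ((S s).1 - (S a).1) + n.2 * ((S s).2 - (S a).2) = 0) :
    S '' Icc a b = segment ℝ (S a) (S b) := by
  have hnn : 0 < n.1 ^ 2 + n.2 ^ 2 := by
    by_contra! hcon
    have h1 : n.1 = 0 := by nlinarith [sq_nonneg n.1, sq_nonneg n.2]
    have h2 : n.2 = 0 := by nlinarith [sq_nonneg n.1, sq_nonneg n.2]
    exact hn (Prod.ext h1 h2)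
  -- the coordinate along the line
  let l : ℝ → ℝ := fun s =>
    (-n.2 * ((S s).1 - (S a).1) + n.1 * ((S s).2 - (S a).2)) / (n.1 ^ 2 + n.2 ^ 2)
  let L : ℝ →ᵃ[ℝ] ℝ × ℝ := AffineMap.lineMap (S a) (S a + (-n.2, n.1))
  have hL : ∀ s ∈ Icc a b, L (l s) = S s := by
    intro s hs
    have h0 := hline s hs
    simp only [L, AffineMap.lineMap_apply, vsub_eq_sub, vadd_eq_add, add_sub_cancel_left]
    refine Prod.ext ?_ ?_
    · simp only [l, Prod.fst_add, Prod.smul_fst, smul_eq_mul]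
      field_simp
      linear_combination -n.1 * h0
    · simp only [l, Prod.snd_add, Prod.smul_snd, smul_eq_mul]
      field_simp
      linear_combination -n.2 * h0
  have hlc : ContinuousOn l (Icc a b) :=
    ((continuousOn_const.mul (hS.fst.sub continuousOn_const)).add
      (continuousOn_const.mul (hS.snd.sub continuousOn_const))).div_const _
  have hli : InjOn l (Icc a b) := fun s hs t ht he =>
    hinj hs ht (by rw [← hL s hs, ← hL t ht, he])
  have himg : l '' Icc a b = uIcc (l a) (l b) := by
    refine Subset.antisymm ?_ ?_
    · rintro _ ⟨s, hs, rfl⟩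
      rcases hlc.strictMonoOn_of_injOn_Icc' hab hli with hm | hm
      · exact mem_uIcc.2 (Or.inl ⟨hm.monotoneOn (left_mem_Icc.2 hab) hs hs.1,
          hm.monotoneOn hs (right_mem_Icc.2 hab) hs.2⟩)
      · exact mem_uIcc.2 (Or.inr ⟨hm.antitoneOn hs (right_mem_Icc.2 hab) hs.2,
          hm.antitoneOn (left_mem_Icc.2 hab) hs hs.1⟩)
    · have := intermediate_value_uIcc (a := a) (b := b) (by rwa [uIcc_of_le hab])
      rwa [uIcc_of_le hab] at this
  rw [← hL a (left_mem_Icc.2 hab), ← hL b (right_mem_Icc.2 hab), ← image_segment, segment_eq_uIcc,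
    ← himg, image_image]
  exact image_congr fun s hs => (hL s hs).symm

/-! ### The equation of motion near the sonic speed -/

theorem pd₁_pd₂_comm {f : ℝ × ℝ → ℝ} {D : Set (ℝ × ℝ)} (hD : IsOpen D) (hf : ContDiffOn ℝ 2 f D)
    {z : ℝ × ℝ} (hz : z ∈ D) : pd₁ (pd₂ f) z = pd₂ (pd₁ f) z := by
  have h2 : ContDiffAt ℝ 2 f z := hf.contDiffAt (hD.mem_nhds hz)
  have hd : DifferentiableAt ℝ (fderiv ℝ f) z :=
    (h2.fderiv_right (m := 1) (by norm_num)).differentiableAt (by norm_num)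
  have hsymm := h2.isSymmSndFDerivAt (by simp) (1, 0) (0, 1)
  have e : ∀ v w : ℝ × ℝ, fderiv ℝ (fun p => fderiv ℝ f p v) z w = fderiv ℝ (fderiv ℝ f) z w v := by
    intro v w
    have := (hd.hasFDerivAt.clm_apply (hasFDerivAt_const v z)).fderiv
    rw [this]
    simp
  unfold pd₁ pd₂
  rw [e, e]
  exact hsymm

/-- Properties of the coefficients of the Chaplygin system `θ_ψ = -K(q) q_φ`, `θ_φ = B(q) q_ψ` near
the sonic speed `c`: the system changes its type there. -/
structure IsSonicCoefficient (c : ℝ) (K B : ℝ → ℝ) : Prop where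
  contDiffAt_K : ContDiffAt ℝ 1 K c
  contDiffAt_B : ContDiffAt ℝ 1 B c
  K_eq : K c = 0
  B_pos : 0 < B c
  deriv_K_neg : deriv K c < 0
  deriv_B_neg : deriv B c < 0

/-- Elimination of `θ` from the Chaplygin system gives
`q_ψψ = -(K q_φφ + K' q_φ² + B' q_ψ²) / B`. -/
theorem pd₂_pd₂_eq_of_chaplygin {K B : ℝ → ℝ} {D : Set (ℝ × ℝ)} (hD : IsOpen D)
    {q θ : ℝ × ℝ → ℝ} (hq : ContDiffOn ℝ 2 q D) (hθ : ContDiffOn ℝ 2 θ D)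
    (h₁ : ∀ z ∈ D, pd₂ θ z = -(K (q z) * pd₁ q z)) (h₂ : ∀ z ∈ D, pd₁ θ z = B (q z) * pd₂ q z)
    {z : ℝ × ℝ} (hz : z ∈ D) (hK : DifferentiableAt ℝ K (q z)) (hB : DifferentiableAt ℝ B (q z)) :
    B (q z) * pd₂ (pd₂ q) z
      = -(K (q z) * pd₁ (pd₁ q) z + deriv K (q z) * pd₁ q z ^ 2 + deriv B (q z) * pd₂ q z ^ 2) := by
  have hdiff : ∀ {f : ℝ × ℝ → ℝ}, ContDiffOn ℝ 1 f D → DifferentiableAt ℝ f z := fun hf =>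
    (hf.contDiffAt (hD.mem_nhds hz)).differentiableAt (by norm_num)
  have hq0 : DifferentiableAt ℝ q z := hdiff (hq.of_le (by norm_num))
  have hq1 := hdiff (contDiffOn_pd₁ (m := 1) hD hq (by norm_num))
  have hq2 := hdiff (contDiffOn_pd₂ (m := 1) hD hq (by norm_num))
  have hθ1 := hdiff (contDiffOn_pd₁ (m := 1) hD hθ (by norm_num))
  have hθ2 := hdiff (contDiffOn_pd₂ (m := 1) hD hθ (by norm_num))
  have hDz := hD.mem_nhds hz
  have e1 : pd₁ (pd₂ θ) z = -(deriv K (q z) * pd₁ q z * pd₁ q z + K (q z) * pd₁ (pd₁ q) z) := by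
    refine (hasDerivAt_fst (x := z.1) (y := z.2) hθ2).unique ?_
    have h3 := ((hK.hasDerivAt.comp z.1 (hasDerivAt_fst (x := z.1) (y := z.2) hq0)).mul
      (hasDerivAt_fst (x := z.1) (y := z.2) hq1)).neg
    refine h3.congr_of_eventuallyEq ?_
    have hc : Tendsto (fun t : ℝ => (t, z.2)) (𝓝 z.1) (𝓝 z) :=
      Continuous.tendsto' (by fun_prop) _ _ rfl
    filter_upwards [hc.eventually hDz] with t ht using h₁ _ ht
  have e2 : pd₂ (pd₁ θ) z = deriv B (q z) * pd₂ q z * pd₂ q z + B (q z) * pd₂ (pd₂ q) z := by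
    refine (hasDerivAt_snd (x := z.1) (y := z.2) hθ1).unique ?_
    have h3 := (hB.hasDerivAt.comp z.2 (hasDerivAt_snd (x := z.1) (y := z.2) hq0)).mul
      (hasDerivAt_snd (x := z.1) (y := z.2) hq2)
    refine h3.congr_of_eventuallyEq ?_
    have hc : Tendsto (fun t : ℝ => (z.1, t)) (𝓝 z.2) (𝓝 z) :=
      Continuous.tendsto' (by fun_prop) _ _ rfl
    filter_upwards [hc.eventually hDz] with t ht using h₂ _ ht
  rw [pd₁_pd₂_comm hD hθ hz, e2] at e1
  linear_combination e1

/-- Near sonic points, `q_ψψ` is controlled by terms which vanish with `q - c` and the gradient of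
`q`; in the subsonic region the squares of the first derivatives have a favourable sign, because `K'`
and `B'` are negative. -/
theorem growth_of_chaplygin {c : ℝ} {K B : ℝ → ℝ} (hKB : IsSonicCoefficient c K B)
    {D : Set (ℝ × ℝ)} (hD : IsOpen D) {q θ : ℝ × ℝ → ℝ} (hq : ContDiffOn ℝ 2 q D)
    (hθ : ContDiffOn ℝ 2 θ D) (h₁ : ∀ z ∈ D, pd₂ θ z = -(K (q z) * pd₁ q z))
    (h₂ : ∀ z ∈ D, pd₁ θ z = B (q z) * pd₂ q z) {p : ℝ × ℝ} (hp : Tendsto q (𝓝[D] p) (𝓝 c))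
    {M : ℝ} (hM : ∀ᶠ z in 𝓝[D] p, |pd₁ (pd₁ q) z| ≤ M) :
    ∃ C ≥ 0, ∀ᶠ z in 𝓝[D] p,
      |pd₂ (pd₂ q) z| ≤ C * (|q z - c| + pd₁ q z ^ 2 + pd₂ q z ^ 2) ∧
      (q z < c → -pd₂ (pd₂ q) z ≤ C * (c - q z)) := by
  have hdiff : ∀ {f : ℝ → ℝ}, ContDiffAt ℝ 1 f c → ∀ᶠ x in 𝓝 c, DifferentiableAt ℝ f x :=
      fun hf => by
    filter_upwards [hf.eventually (by simp)] with x hx using hx.differentiableAt (by norm_num)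
  have hcont : ∀ {f : ℝ → ℝ}, ContDiffAt ℝ 1 f c → ContinuousAt (deriv f) c := fun {f} hf => by
    have h3 : ContinuousAt (fderiv ℝ f) c := (hf.fderiv_right (m := 0) (by norm_num)).continuousAt
    exact h3.clm_apply continuousAt_const
  obtain ⟨L, hL, hKL⟩ := ((hKB.contDiffAt_K.differentiableAt (by norm_num)).isBigO_sub).exists_pos
  have hKL' := hKL.bound
  set N : ℝ := |deriv K c| + |deriv B c| + 1 with hN
  have b1 : ∀ᶠ x in 𝓝 c, |deriv K x| < N := (hcont hKB.contDiffAt_K).abs.eventually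
    (gt_mem_nhds (by linarith [abs_nonneg (deriv B c)]))
  have b2 : ∀ᶠ x in 𝓝 c, |deriv B x| < N := (hcont hKB.contDiffAt_B).abs.eventually
    (gt_mem_nhds (by linarith [abs_nonneg (deriv K c)]))
  have b3 : ∀ᶠ x in 𝓝 c, deriv K x < 0 :=
    (hcont hKB.contDiffAt_K).eventually (gt_mem_nhds hKB.deriv_K_neg)
  have b4 : ∀ᶠ x in 𝓝 c, deriv B x < 0 :=
    (hcont hKB.contDiffAt_B).eventually (gt_mem_nhds hKB.deriv_B_neg)
  have b5 : ∀ᶠ x in 𝓝 c, B c / 2 < B x :=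
    hKB.contDiffAt_B.continuousAt.eventually (lt_mem_nhds (half_lt_self hKB.B_pos))
  have hB0 := hKB.B_pos
  have hN0 : 0 ≤ N := by positivity
  refine ⟨(L * |M| + N) / (B c / 2), by positivity, ?_⟩
  filter_upwards [hM, self_mem_nhdsWithin, hp.eventually b1, hp.eventually b2, hp.eventually b3,
    hp.eventually b4, hp.eventually b5, hp.eventually hKL', hp.eventually (hdiff hKB.contDiffAt_K),
    hp.eventually (hdiff hKB.contDiffAt_B)] with z hMz hz c1 c2 c3 c4 c5 c6 c7 c8
  have heq := pd₂_pd₂_eq_of_chaplygin hD hq hθ h₁ h₂ hz c7 c8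
  rw [hKB.K_eq, sub_zero, Real.norm_eq_abs, Real.norm_eq_abs] at c6
  have hBz : 0 < B (q z) := by linarith
  have hKq : |K (q z) * pd₁ (pd₁ q) z| ≤ L * |M| * |q z - c| := by
    rw [abs_mul]
    calc |K (q z)| * |pd₁ (pd₁ q) z| ≤ (L * |q z - c|) * |M| :=
          mul_le_mul c6 (hMz.trans (le_abs_self M)) (abs_nonneg _) (by positivity)
      _ = _ := by ring
  constructor
  · rw [div_mul_eq_mul_div, le_div_iff₀ (by linarith)]
    have e1 : B (q z) * |pd₂ (pd₂ q) z| ≤ L * |M| * |q z - c| + N * pd₁ q z ^ 2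
        + N * pd₂ q z ^ 2 := by
      rw [← abs_of_pos hBz, ← abs_mul, heq, abs_neg]
      refine (abs_add_three _ _ _).trans ?_
      rw [abs_mul (deriv K _), abs_mul (deriv B _), abs_of_nonneg (sq_nonneg (pd₁ q z)),
        abs_of_nonneg (sq_nonneg (pd₂ q z))]
      gcongr
    have e2 : |pd₂ (pd₂ q) z| * (B c / 2) ≤ B (q z) * |pd₂ (pd₂ q) z| := by
      rw [mul_comm]
      gcongr
    have e3 : 0 ≤ N * |q z - c| + L * |M| * pd₁ q z ^ 2 + L * |M| * pd₂ q z ^ 2 := by positivity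
    nlinarith
  · intro hqc
    rw [abs_of_neg (sub_neg.2 hqc), neg_sub] at hKq
    rw [div_mul_eq_mul_div, le_div_iff₀ (by linarith)]
    have e1 : B (q z) * -pd₂ (pd₂ q) z ≤ L * |M| * (c - q z) := by
      have h4 := (abs_le.1 hKq).2
      have h5 := mul_nonneg (neg_nonneg.2 c3.le) (sq_nonneg (pd₁ q z))
      have h6 := mul_nonneg (neg_nonneg.2 c4.le) (sq_nonneg (pd₂ q z))
      linarith
    have e2 : 0 ≤ N * (c - q z) := mul_nonneg hN0 (by linarith)
    have e3 : 0 ≤ L * |M| * (c - q z) := mul_nonneg (by positivity) (by linarith)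
    rcases le_total (-pd₂ (pd₂ q) z) 0 with hn | hn
    · have : -pd₂ (pd₂ q) z * (B c / 2) ≤ 0 := mul_nonpos_of_nonpos_of_nonneg hn (by linarith)
      linarith
    · have : -pd₂ (pd₂ q) z * (B c / 2) ≤ -pd₂ (pd₂ q) z * B (q z) :=
        mul_le_mul_of_nonneg_left c5.le hn
      linarith

/-- The coefficient of `-q_φ` in the first Chaplygin equation. -/
def coeffK (γ q : ℝ) : ℝ :=
  (density γ (q ^ 2) + 2 * q ^ 2 * deriv (density γ) (q ^ 2)) / (q * density γ (q ^ 2) ^ 2)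

/-- The coefficient of `q_ψ` in the second Chaplygin equation, solved for `θ_φ`. -/
def coeffB (γ q : ℝ) : ℝ := density γ (q ^ 2) / q

theorem hasDerivAt_density {γ s : ℝ} (hγ : 1 < γ) (hs : 0 < 1 - (γ - 1) / 2 * s) :
    HasDerivAt (density γ) (-(1 / 2) * (1 - (γ - 1) / 2 * s) ^ (1 / (γ - 1) - 1)) s := by
  have h1 : HasDerivAt (fun s : ℝ => 1 - (γ - 1) / 2 * s) (-((γ - 1) / 2)) s := by
    simpa using ((hasDerivAt_id s).const_mul ((γ - 1) / 2)).const_sub 1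
  have h2 := h1.rpow_const (p := 1 / (γ - 1)) (Or.inl hs.ne')
  refine h2.congr_deriv ?_
  have : γ - 1 ≠ 0 := by linarith
  field_simp

theorem critSpeed_pos {γ : ℝ} (hγ : 1 < γ) : 0 < critSpeed γ :=
  Real.sqrt_pos.2 (div_pos two_pos (by linarith))

theorem critSpeed_sq {γ : ℝ} (hγ : 1 < γ) : critSpeed γ ^ 2 = 2 / (γ + 1) :=
  Real.sq_sqrt (div_nonneg two_pos.le (by linarith))

theorem base_pos_of_lt_maxSpeed {γ q : ℝ} (hγ : 1 < γ) (h0 : 0 < q) (h : q < maxSpeed γ) :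
    0 < 1 - (γ - 1) / 2 * q ^ 2 := by
  have h1 : q ^ 2 < 2 / (γ - 1) := by
    rw [maxSpeed] at h
    exact (Real.lt_sqrt h0.le).1 h
  rw [lt_div_iff₀ (by linarith)] at h1
  linarith

theorem density_pos_of_lt_maxSpeed {γ q : ℝ} (hγ : 1 < γ) (h0 : 0 < q) (h : q < maxSpeed γ) :
    0 < density γ (q ^ 2) :=
  Real.rpow_pos_of_pos (base_pos_of_lt_maxSpeed hγ h0 h) _

/-- For a polytropic gas, `K` is a positive multiple of `1 - (γ + 1) / 2 q²`, which changes its sign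
at `q = c`. -/
theorem isSonicCoefficient {γ : ℝ} (hγ : 1 < γ) :
    IsSonicCoefficient (critSpeed γ) (coeffK γ) (coeffB γ) := by
  set c := critSpeed γ with hc
  have hc0 : 0 < c := critSpeed_pos hγ
  have hc2 : c ^ 2 = 2 / (γ + 1) := critSpeed_sq hγ
  have hγ1 : γ + 1 ≠ 0 := by linarith
  set β : ℝ → ℝ := fun q => 1 - (γ - 1) / 2 * q ^ 2 with hβ
  have hβc : 0 < β c := by
    have : β c = 2 / (γ + 1) := by
      simp only [hβ, hc2]
      field_simp
      ring
    rw [this]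
    exact div_pos two_pos (by linarith)
  have hβs : ContDiff ℝ 1 β := by fun_prop
  set e : ℝ := 1 / (γ - 1) with he
  have hpow : ∀ p : ℝ, ContDiffAt ℝ 1 (fun q => β q ^ p) c := fun p =>
    hβs.contDiffAt.rpow_const_of_ne hβc.ne'
  -- the factor `M` of `K = M (1 - (γ + 1) / 2 q²)`
  let M : ℝ → ℝ := fun q => β q ^ (e - 1) / (q * (β q ^ e) ^ 2)
  have hMs : ContDiffAt ℝ 1 M c :=
    (hpow _).div (contDiffAt_id.mul ((hpow _).pow 2))
      (mul_pos hc0 (pow_pos (Real.rpow_pos_of_pos hβc _) 2)).ne'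
  have hMc : 0 < M c := by
    have h1 := Real.rpow_pos_of_pos hβc (e - 1)
    have h2 := Real.rpow_pos_of_pos hβc e
    exact div_pos h1 (mul_pos hc0 (pow_pos h2 2))
  have hev : ∀ᶠ q in 𝓝 c, 0 < β q := hβs.continuous.continuousAt.eventually (lt_mem_nhds hβc)
  have hK : coeffK γ =ᶠ[𝓝 c] fun q => M q * (1 - (γ + 1) / 2 * q ^ 2) := by
    filter_upwards [hev] with q hq
    have h1 : density γ (q ^ 2) = β q ^ (e - 1) * β q := by
      rw [← Real.rpow_add_one hq.ne', sub_add_cancel]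
      rfl
    have h1' : density γ (q ^ 2) = β q ^ e := rfl
    have h2 : deriv (density γ) (q ^ 2) = -(1 / 2) * β q ^ (e - 1) :=
      (hasDerivAt_density hγ hq).deriv
    simp only [coeffK, M]
    rw [h2]
    nth_rw 1 [h1]
    rw [h1', div_mul_eq_mul_div]
    congr 1
    simp only [hβ]
    ring
  have hlin : HasDerivAt (fun q : ℝ => 1 - (γ + 1) / 2 * q ^ 2) (-((γ + 1) * c)) c := by
    have := (((hasDerivAt_id c).pow 2).const_mul ((γ + 1) / 2)).const_sub 1
    refine this.congr_deriv ?_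
    simp
    ring
  have hfac : 1 - (γ + 1) / 2 * c ^ 2 = 0 := by
    rw [hc2]
    field_simp
    ring
  have hKd : HasDerivAt (coeffK γ) (M c * -((γ + 1) * c)) c := by
    have := (hMs.differentiableAt (by norm_num)).hasDerivAt.mul hlin
    rw [hfac, mul_zero, zero_add] at this
    exact this.congr_of_eventuallyEq hK
  have hBeq : coeffB γ = fun q => β q ^ e / q := rfl
  have hβd : HasDerivAt β (-((γ - 1) * c)) c := by
    have := (((hasDerivAt_id c).pow 2).const_mul ((γ - 1) / 2)).const_sub 1
    refine this.congr_deriv ?_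
    simp
    ring
  have hBd := (hβd.rpow_const (p := e) (Or.inl hβc.ne')).div (hasDerivAt_id c) hc0.ne'
  refine ⟨?_, ?_, ?_, ?_, ?_, ?_⟩
  · exact (hMs.mul (by fun_prop)).congr_of_eventuallyEq hK
  · rw [hBeq]
    exact (hpow e).div contDiffAt_id hc0.ne'
  · rw [hK.eq_of_nhds, hfac, mul_zero]
  · exact div_pos (Real.rpow_pos_of_pos hβc _) hc0
  · rw [hKd.deriv]
    have : 0 < (γ + 1) * c := mul_pos (by linarith) hc0
    exact mul_neg_of_pos_of_neg hMc (by linarith)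
  · have h3 : deriv (coeffB γ) c = _ := hBd.deriv
    rw [h3]
    refine div_neg_of_neg_of_pos ?_ (pow_pos hc0 2)
    have h4 := Real.rpow_pos_of_pos hβc e
    have h5 := Real.rpow_pos_of_pos hβc (e - 1)
    have he0 : (γ - 1) * e = 1 := mul_one_div_cancel (by linarith)
    have h6 : -((γ - 1) * c) * e * β c ^ (e - 1) = -(c * β c ^ (e - 1)) := by
      linear_combination (-(c * β c ^ (e - 1))) * he0
    rw [h6]
    simp only [id]
    have := mul_pos (mul_pos hc0 h5) hc0
    linarith

theorem pd₂_θ_of_chaplygin {γ : ℝ} {q θ : ℝ × ℝ → ℝ} {p : ℝ × ℝ}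
    (h : pd₂ θ p + (density γ (q p ^ 2) + 2 * q p ^ 2 * deriv (density γ) (q p ^ 2)) /
      (q p * density γ (q p ^ 2) ^ 2) * pd₁ q p = 0) :
    pd₂ θ p = -(coeffK γ (q p) * pd₁ q p) :=
  eq_neg_of_add_eq_zero_left h

theorem pd₁_θ_of_chaplygin {γ : ℝ} {q θ : ℝ × ℝ → ℝ} {p : ℝ × ℝ} (hρ : density γ (q p ^ 2) ≠ 0)
    (h : 1 / q p * pd₂ q p - 1 / density γ (q p ^ 2) * pd₁ θ p = 0) :
    pd₁ θ p = coeffB γ (q p) * pd₂ q p := by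
  have h1 : 1 / density γ (q p ^ 2) * pd₁ θ p = 1 / q p * pd₂ q p := by linarith
  calc pd₁ θ p = density γ (q p ^ 2) * (1 / density γ (q p ^ 2) * pd₁ θ p) := by
        rw [← mul_assoc, mul_one_div_cancel hρ, one_mul]
    _ = _ := by
        rw [h1, coeffB]
        ring

/-! ### Limits from the region -/

theorem continuousOn_Icc_of_tendsto {f : ℝ → ℝ}
    (h : ∀ s ∈ Icc (0 : ℝ) 1, Tendsto f (𝓝[Ioo 0 1] s) (𝓝 (f s))) : ContinuousOn f (Icc 0 1) := by
  intro s hs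
  have h1 : ContinuousWithinAt f (insert s (Ioo 0 1)) s :=
    ContinuousWithinAt.insert (h s hs)
  refine h1.mono_of_mem_nhdsWithin ?_
  rcases hs.1.eq_or_lt with rfl | h0
  · rw [Ioo_insert_left one_pos, nhdsWithin_Icc_eq_nhdsGE one_pos]
    exact Ico_mem_nhdsGE one_pos
  rcases hs.2.eq_or_lt with rfl | h2
  · rw [Ioo_insert_right one_pos, nhdsWithin_Icc_eq_nhdsLE one_pos]
    exact Ioc_mem_nhdsLE one_pos
  · exact mem_nhdsWithin_of_mem_nhds (mem_of_superset (Ioo_mem_nhds h0 h2) (subset_insert _ _))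

theorem nonpos_on_Icc_of_Ioo {f : ℝ → ℝ} (hf : ContinuousOn f (Icc 0 1))
    (h : ∀ s ∈ Ioo (0 : ℝ) 1, f s ≤ 0) : ∀ s ∈ Icc (0 : ℝ) 1, f s ≤ 0 := by
  intro s hs
  have : (𝓝[Ioo (0 : ℝ) 1] s).NeBot := by
    rw [← mem_closure_iff_nhdsWithin_neBot, closure_Ioo one_ne_zero.symm]
    exact hs
  refine le_of_tendsto ((hf s hs).mono_left (nhdsWithin_mono _ Ioo_subset_Icc_self)) ?_
  filter_upwards [self_mem_nhdsWithin] with t ht using h t ht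

theorem eq_zero_on_Icc_of_Ioo {f : ℝ → ℝ} (hf : ContinuousOn f (Icc 0 1))
    (h : ∀ s ∈ Ioo (0 : ℝ) 1, f s = 0) : ∀ s ∈ Icc (0 : ℝ) 1, f s = 0 := fun s hs =>
  le_antisymm (nonpos_on_Icc_of_Ioo hf (fun t ht => (h t ht).le) s hs)
    (neg_nonpos.1 (nonpos_on_Icc_of_Ioo hf.neg (fun t ht => by simp [h t ht]) s hs))

/-- The limits along `S` of a function which is continuous in `D` form a continuous function of the
parameter. -/
theorem continuousOn_limit {D : Set (ℝ × ℝ)} (hD : IsOpen D) {S : ℝ → ℝ × ℝ} {F : ℝ × ℝ → ℝ}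
    {a : ℝ → ℝ} (hS : ContinuousOn S (Icc 0 1)) (hmem : ∀ s ∈ Ioo (0 : ℝ) 1, S s ∈ D)
    (hF : ContinuousOn F D) (ha : ∀ s ∈ Icc (0 : ℝ) 1, Tendsto F (𝓝[D] S s) (𝓝 (a s))) :
    (∀ s ∈ Ioo (0 : ℝ) 1, a s = F (S s)) ∧ ContinuousOn a (Icc 0 1) := by
  have h1 : ∀ s ∈ Ioo (0 : ℝ) 1, a s = F (S s) := fun s hs => by
    have h2 := ha s (Ioo_subset_Icc_self hs)
    rw [hD.nhdsWithin_eq (hmem s hs)] at h2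
    exact tendsto_nhds_unique h2 (hF.continuousAt (hD.mem_nhds (hmem s hs)))
  refine ⟨h1, continuousOn_Icc_of_tendsto fun s hs => ?_⟩
  have h3 : Tendsto S (𝓝[Ioo 0 1] s) (𝓝[D] S s) :=
    tendsto_nhdsWithin_iff.2 ⟨(hS s hs).mono_left (nhdsWithin_mono _ Ioo_subset_Icc_self),
      eventually_mem_nhdsWithin.mono hmem⟩
  refine ((ha s hs).comp h3).congr' ?_
  filter_upwards [self_mem_nhdsWithin] with t ht using (h1 t ht).symm

/-- A function of class `C^(n+1)` up to a boundary point `p` of `D` has a gradient in `D` which is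
of class `C^n` up to `p`. -/
theorem exists_gradient {n : WithTop ℕ∞} (hn : n ≠ ((⊤ : ℕ∞) : WithTop ℕ∞)) {f : ℝ × ℝ → ℝ}
    {C D : Set (ℝ × ℝ)} (hD : IsOpen D) (hDC : D ⊆ C) {p : ℝ × ℝ} (hp : p ∈ C)
    (hf : ContDiffWithinAt ℝ (n + 1) f C p) :
    ∃ g : ℝ × ℝ → (ℝ × ℝ →L[ℝ] ℝ), ContDiffWithinAt ℝ n g D p ∧
      ∀ᶠ z in 𝓝[D] p, HasFDerivAt f (g z) z := by
  obtain ⟨u, hu, -, g, hg, hg'⟩ := (contDiffWithinAt_succ_iff_hasFDerivWithinAt hn).1 hf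
  rw [insert_eq_of_mem hp] at hu
  have huD : u ∈ 𝓝[D] p := nhdsWithin_mono _ hDC hu
  refine ⟨g, hg'.mono_of_mem_nhdsWithin huD, ?_⟩
  filter_upwards [eventually_eventually_nhdsWithin.2 huD, self_mem_nhdsWithin, huD]
    with z hz hzD hzu
  rw [hD.nhdsWithin_eq hzD] at hz
  exact (hg z hzu).hasFDerivAt hz

/-- Derivatives along vector fields of a function of class `C²(closure D)`: near every point `p` of
the closure they agree in `D` with a function which is `C¹` up to `p`. -/
theorem exists_gradient_family {D : Set (ℝ × ℝ)} (hD : IsOpen D) {q : ℝ × ℝ → ℝ}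
    (hq : ContDiffOn ℝ 2 q (closure D)) :
    ∃ g : ℝ × ℝ → ℝ × ℝ → (ℝ × ℝ →L[ℝ] ℝ), ∀ E : ℝ × ℝ → ℝ × ℝ, ContDiffOn ℝ 2 E (closure D) →
      ∀ p ∈ closure D, ContDiffWithinAt ℝ 1 (fun z => g p z (E z)) D p ∧
        (fun z => fderiv ℝ q z (E z)) =ᶠ[𝓝[D] p] fun z => g p z (E z) := by
  have hgrad : ∀ p, ∃ g : ℝ × ℝ → (ℝ × ℝ →L[ℝ] ℝ), p ∈ closure D → ContDiffWithinAt ℝ 1 g D p ∧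
      ∀ᶠ z in 𝓝[D] p, HasFDerivAt q (g z) z := fun p => by
    by_cases hp : p ∈ closure D
    · obtain ⟨g, hg⟩ := exists_gradient (n := 1) (by simp) hD subset_closure hp
        (by simpa [one_add_one_eq_two] using hq p hp)
      exact ⟨g, fun _ => hg⟩
    · exact ⟨0, fun h => absurd h hp⟩
  choose g hg using hgrad
  exact ⟨g, fun E hE p hp =>
    ⟨(hg p hp).1.clm_apply (((hE p hp).mono subset_closure).of_le one_le_two),
      (hg p hp).2.mono fun z hz => by simp only [hz.fderiv]⟩⟩

theorem tendsto_of_eventuallyEq_contDiff {n : WithTop ℕ∞} {F F' : ℝ × ℝ → ℝ} {D : Set (ℝ × ℝ)}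
    {p : ℝ × ℝ} (hF' : ContDiffWithinAt ℝ n F' D p) (h : F =ᶠ[𝓝[D] p] F') :
    Tendsto F (𝓝[D] p) (𝓝 (F' p)) :=
  (hF'.continuousWithinAt : Tendsto F' _ _).congr' h.symm

/-- The derivative of a function that agrees in `D` with one of class `C¹` up to `p` is bounded near
`p`. -/
theorem exists_bound_fderiv {F F' : ℝ × ℝ → ℝ} {D : Set (ℝ × ℝ)} (hD : IsOpen D)
    {p : ℝ × ℝ} (hF' : ContDiffWithinAt ℝ 1 F' D p) (h : F =ᶠ[𝓝[D] p] F') :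
    ∃ M, ∀ᶠ z in 𝓝[D] p, ‖fderiv ℝ F z‖ ≤ M := by
  obtain ⟨g, hg, hgF⟩ := exists_gradient (n := 0) (by simp) hD (subset_insert p D)
    (mem_insert p D) (by simpa [contDiffWithinAt_insert] using hF')
  have h1 : Tendsto (fun z => ‖g z‖) (𝓝[D] p) (𝓝 ‖g p‖) :=
    (hg.continuousWithinAt : Tendsto g _ _).norm
  refine ⟨‖g p‖ + 1, ?_⟩
  filter_upwards [hgF, h1.eventually (gt_mem_nhds (lt_add_one _)), self_mem_nhdsWithin,
    eventually_eventually_nhdsWithin.2 h] with z h2 h3 hz h4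
  rw [hD.nhdsWithin_eq hz] at h4
  rw [(h2.congr_of_eventuallyEq h4).fderiv]
  exact h3.le

theorem abs_pd₁_le (f : ℝ × ℝ → ℝ) (z : ℝ × ℝ) : |pd₁ f z| ≤ ‖fderiv ℝ f z‖ := by
  have := (fderiv ℝ f z).le_opNorm (1, 0)
  simpa [pd₁, Prod.norm_def] using this

theorem abs_pd₂_le (f : ℝ × ℝ → ℝ) (z : ℝ × ℝ) : |pd₂ f z| ≤ ‖fderiv ℝ f z‖ := by
  have := (fderiv ℝ f z).le_opNorm (0, 1)
  simpa [pd₂, Prod.norm_def] using this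

/-- The strict inequality to the left of the sonic curve yields a sign of the normal derivative. -/
theorem fderiv_nonpos_of_eventually_lt {q : ℝ × ℝ → ℝ} {p w : ℝ × ℝ} {c : ℝ}
    (hq : DifferentiableAt ℝ q p) (hp : q p = c) (h : ∀ᶠ t in 𝓝[>] (0 : ℝ), q (p + t • w) < c) :
    fderiv ℝ q p w ≤ 0 := by
  have h1 : HasDerivAt (fun t : ℝ => q (p + t • w)) (fderiv ℝ q p w) 0 :=
    (hq.hasFDerivAt.hasLineDerivAt w : HasLineDerivAt ℝ q _ p w)
  have h2 := h1.tendsto_slope.mono_left (nhdsGT_le_nhdsNE 0)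
  refine le_of_tendsto h2 ?_
  filter_upwards [h, self_mem_nhdsWithin] with t ht ht0
  rw [slope_def_field]
  have h0 : (0 : ℝ) < t := ht0
  refine div_nonpos_of_nonpos_of_nonneg ?_ (by linarith)
  simp only [zero_smul, add_zero, hp]
  linarith

/-! ### From the flow to the sonic arc -/

theorem hasDerivAt_comp_curve {f : ℝ × ℝ → ℝ} {S : ℝ → ℝ × ℝ} {s : ℝ} {v : ℝ × ℝ}
    (hf : DifferentiableAt ℝ f (S s)) (hS : HasDerivAt S v s) :
    HasDerivAt (fun r => f (S r)) (pd₁ f (S s) * v.1 + pd₂ f (S s) * v.2) s := by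
  rw [← fderiv_eq_pd]
  exact hf.hasFDerivAt.comp_hasDerivAt s hS

/-- A flow in the region `D` of the potential plane, inside the strip `ψ₁ < ψ < ψ₂`, together with
its sonic curve `S`, where `T`, `τ`, `a`, `b` have the same meaning as in `IsSonicArc`. What happens
on the boundary of `D` is stated in terms of limits from `D`, because the speed and the angle need
not be differentiable there. -/
structure IsSonicFlow (γ τ ψ₁ ψ₂ : ℝ) (D : Set (ℝ × ℝ)) (q θ : ℝ × ℝ → ℝ) (S T : ℝ → ℝ × ℝ)
    (a b : ℝ → ℝ) : Prop where
  isOpen : IsOpen D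
  strip : ∀ z ∈ D, z.2 ∈ Ioo ψ₁ ψ₂
  lt : ψ₁ < ψ₂
  contDiffOn_q : ContDiffOn ℝ 2 q D
  contDiffOn_θ : ContDiffOn ℝ 2 θ D
  chaplygin₁ : ∀ z ∈ D, pd₂ θ z = -(coeffK γ (q z) * pd₁ q z)
  chaplygin₂ : ∀ z ∈ D, pd₁ θ z = coeffB γ (q z) * pd₂ q z
  continuousOn : ContinuousOn S (Icc 0 1)
  hasDerivAt : ∀ s ∈ Ioo (0 : ℝ) 1, HasDerivAt S (T s) s
  continuousOn_deriv : ContinuousOn T (Icc 0 1)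
  regular : ∀ s ∈ Icc (0 : ℝ) 1, T s ≠ 0
  injOn : InjOn S (Icc 0 1)
  mem : ∀ s ∈ Ioo (0 : ℝ) 1, S s ∈ D
  ends : (τ = 1 ∧ (S 0).2 = ψ₁ ∧ (S 1).2 = ψ₂) ∨ (τ = -1 ∧ (S 0).2 = ψ₂ ∧ (S 1).2 = ψ₁)
  start_box : HasHalfBox τ D (S 0)
  end_box : HasHalfBox (-τ) D (S 1)
  sonic : ∀ z ∈ D, q z = critSpeed γ → z ∈ S '' Icc 0 1
  q_eq : ∀ s ∈ Ioo (0 : ℝ) 1, q (S s) = critSpeed γ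
  tendsto_q : ∀ s ∈ Icc (0 : ℝ) 1, Tendsto q (𝓝[D] S s) (𝓝 (critSpeed γ))
  tendsto₁ : ∀ s ∈ Icc (0 : ℝ) 1, Tendsto (pd₁ q) (𝓝[D] S s) (𝓝 (a s))
  tendsto₂ : ∀ s ∈ Icc (0 : ℝ) 1, Tendsto (pd₂ q) (𝓝[D] S s) (𝓝 (b s))
  bounded : ∀ s ∈ Icc (0 : ℝ) 1, ∃ C, ∀ᶠ z in 𝓝[D] S s,
    |pd₁ (pd₁ q) z| ≤ C ∧ |pd₂ (pd₁ q) z| ≤ C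
  left : ∀ s ∈ Ioo (0 : ℝ) 1, fderiv ℝ q (S s) (rotLeft (T s)) ≤ 0

namespace IsSonicFlow

variable {γ τ ψ₁ ψ₂ : ℝ} {D : Set (ℝ × ℝ)} {q θ : ℝ × ℝ → ℝ} {S T : ℝ → ℝ × ℝ} {a b : ℝ → ℝ}

theorem sign (h : IsSonicFlow γ τ ψ₁ ψ₂ D q θ S T a b) : τ = 1 ∨ τ = -1 :=
  h.ends.imp (fun h => h.1) (fun h => h.1)

theorem limit₁ (h : IsSonicFlow γ τ ψ₁ ψ₂ D q θ S T a b) :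
    (∀ s ∈ Ioo (0 : ℝ) 1, a s = pd₁ q (S s)) ∧ ContinuousOn a (Icc 0 1) :=
  continuousOn_limit h.isOpen h.continuousOn h.mem
    (contDiffOn_pd₁ (m := 1) h.isOpen h.contDiffOn_q (by norm_num)).continuousOn h.tendsto₁

theorem limit₂ (h : IsSonicFlow γ τ ψ₁ ψ₂ D q θ S T a b) :
    (∀ s ∈ Ioo (0 : ℝ) 1, b s = pd₂ q (S s)) ∧ ContinuousOn b (Icc 0 1) :=
  continuousOn_limit h.isOpen h.continuousOn h.mem
    (contDiffOn_pd₂ (m := 1) h.isOpen h.contDiffOn_q (by norm_num)).continuousOn h.tendsto₂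

theorem isSonicArc (h : IsSonicFlow γ τ ψ₁ ψ₂ D q θ S T a b) (hγ : 1 < γ) :
    IsSonicArc (critSpeed γ) τ D q S T a b := by
  obtain ⟨ha, hac⟩ := h.limit₁
  obtain ⟨hb, hbc⟩ := h.limit₂
  have hdiff : ∀ s ∈ Ioo (0 : ℝ) 1, DifferentiableAt ℝ q (S s) := fun s hs =>
    (h.contDiffOn_q.contDiffAt (h.isOpen.mem_nhds (h.mem s hs))).differentiableAt (by norm_num)
  have htan : ∀ s ∈ Icc (0 : ℝ) 1, a s * (T s).1 + b s * (T s).2 = 0 := by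
    refine eq_zero_on_Icc_of_Ioo ((hac.mul h.continuousOn_deriv.fst).add
      (hbc.mul h.continuousOn_deriv.snd)) fun s hs => ?_
    rw [ha s hs, hb s hs]
    refine (hasDerivAt_comp_curve (hdiff s hs) (h.hasDerivAt s hs)).unique ?_
    refine (hasDerivAt_const s (critSpeed γ)).congr_of_eventuallyEq ?_
    filter_upwards [Ioo_mem_nhds hs.1 hs.2] with t ht using h.q_eq t ht
  refine ⟨h.sign, h.isOpen, h.contDiffOn_q, h.continuousOn, h.hasDerivAt, h.continuousOn_deriv,
    h.regular, h.injOn, h.mem, h.start_box, h.end_box, ?_, ?_, h.sonic, h.tendsto_q, h.tendsto₁,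
    h.tendsto₂, h.bounded, ?_, htan, ?_⟩
  · intro s hs
    have hlt := h.lt
    rcases hs.2.eq_or_lt with rfl | h1
    · rcases h.ends with ⟨rfl, e0, e1⟩ | ⟨rfl, e0, e1⟩ <;> rw [e0, e1] <;> linarith
    · have h2 := h.strip _ (h.mem s ⟨hs.1, h1⟩)
      rcases h.ends with ⟨rfl, e0, e1⟩ | ⟨rfl, e0, e1⟩ <;> rw [e0] <;> linarith [h2.1, h2.2]
  · intro s hs
    have hlt := h.lt
    rcases hs.1.eq_or_lt with rfl | h1
    · rcases h.ends with ⟨rfl, e0, e1⟩ | ⟨rfl, e0, e1⟩ <;> rw [e0, e1] <;> linarith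
    · have h2 := h.strip _ (h.mem s ⟨h1, hs.2⟩)
      rcases h.ends with ⟨rfl, e0, e1⟩ | ⟨rfl, e0, e1⟩ <;> rw [e1] <;> linarith [h2.1, h2.2]
  · intro s hs
    obtain ⟨M, hM⟩ := h.bounded s hs
    exact growth_of_chaplygin (isSonicCoefficient hγ) h.isOpen h.contDiffOn_q h.contDiffOn_θ
      h.chaplygin₁ h.chaplygin₂ (h.tendsto_q s hs) (hM.mono fun z hz => hz.1)
  · refine nonpos_on_Icc_of_Ioo (hbc.mul h.continuousOn_deriv.fst) fun s hs => ?_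
    have h1 := h.left s hs
    rw [fderiv_eq_pd, ← ha s hs, ← hb s hs] at h1
    simp only [rotLeft] at h1
    have h2 := htan s (Ioo_subset_Icc_self hs)
    have h3 : b s * (T s).1 * ((T s).1 ^ 2 + (T s).2 ^ 2)
        = (a s * -(T s).2 + b s * (T s).1) * (T s).1 ^ 2 := by
      linear_combination (T s).1 * (T s).2 * h2
    have h4 : 0 < (T s).1 ^ 2 + (T s).2 ^ 2 := by
      by_contra! hcon
      refine h.regular s (Ioo_subset_Icc_self hs) (Prod.ext ?_ ?_)
      · simp only [Prod.fst_zero]; nlinarith [sq_nonneg (T s).1, sq_nonneg (T s).2]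
      · simp only [Prod.snd_zero]; nlinarith [sq_nonneg (T s).1, sq_nonneg (T s).2]
    by_contra! hcon
    have h5 := mul_pos hcon h4
    rw [h3] at h5
    exact absurd (mul_nonpos_of_nonpos_of_nonneg h1 (sq_nonneg _)) (not_le.2 h5)

theorem isUnimodalSign (h : IsSonicFlow γ τ ψ₁ ψ₂ D q θ S T a b) (hγ : 1 < γ) :
    IsUnimodalSign τ fun s => (T s).1 :=
  fun _ hs h0 _ ht => (h.isSonicArc hγ).monotone_before_antitone_after hs h0 ht

/-- Along the sonic curve `K(c) = 0`, so that only the `φ`-derivative of `θ` contributes to the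
derivative of the flow angle. -/
theorem hasDerivWithinAt_angle (h : IsSonicFlow γ τ ψ₁ ψ₂ D q θ S T a b) (hγ : 1 < γ)
    {g : ℝ → ℝ} (hg : ContinuousOn g (Icc 0 1)) (hgθ : ∀ s ∈ Ioo (0 : ℝ) 1, g s = θ (S s)) {s : ℝ}
    (hs : s ∈ Icc (0 : ℝ) 1) :
    HasDerivWithinAt g (coeffB γ (critSpeed γ) * b s * (T s).1) (Icc 0 1) s := by
  obtain ⟨hb, hbc⟩ := h.limit₂
  refine hasDerivWithinAt_Icc_of_Ioo hg (fun r hr => ?_)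
    ((continuousOn_const.mul hbc).mul h.continuousOn_deriv.fst) s hs
  have hD := h.mem r hr
  have hθ : DifferentiableAt ℝ θ (S r) :=
    (h.contDiffOn_θ.contDiffAt (h.isOpen.mem_nhds hD)).differentiableAt (by norm_num)
  have h1 := hasDerivAt_comp_curve hθ (h.hasDerivAt r hr)
  rw [h.chaplygin₁ _ hD, h.chaplygin₂ _ hD, h.q_eq r hr, (isSonicCoefficient hγ).K_eq,
    ← hb r hr] at h1
  simp only [zero_mul, neg_zero, add_zero] at h1
  refine h1.congr_of_eventuallyEq ?_
  filter_upwards [Ioo_mem_nhds hr.1 hr.2] with t ht using hgθ t ht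

/-- The exceptional points are those with a vertical tangent. -/
theorem derivWithin_angle_eq_zero_iff (h : IsSonicFlow γ τ ψ₁ ψ₂ D q θ S T a b) (hγ : 1 < γ)
    {g : ℝ → ℝ} (hg : ContinuousOn g (Icc 0 1)) (hgθ : ∀ s ∈ Ioo (0 : ℝ) 1, g s = θ (S s)) {s : ℝ}
    (hs : s ∈ Icc (0 : ℝ) 1) : derivWithin g (Icc 0 1) s = 0 ↔ (T s).1 = 0 := by
  rw [(h.hasDerivWithinAt_angle hγ hg hgθ hs).derivWithin (uniqueDiffOn_Icc one_pos s hs)]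
  constructor
  · intro h3
    by_contra hT
    have hb0 := (h.isSonicArc hγ).pd₂_ne_zero hs hT
    exact mul_ne_zero (mul_ne_zero (isSonicCoefficient hγ).B_pos.ne' hb0) hT h3
  · intro h3
    rw [h3, mul_zero]

end IsSonicFlow

/-! ### Geometry of the nozzles -/

theorem HasHalfBox.of_eventually {κ : ℝ} {G D : Set (ℝ × ℝ)} {p : ℝ × ℝ} (hκ : κ = 1 ∨ κ = -1)
    (h : HasHalfBox κ G p) (hD : ∀ᶠ z in 𝓝[G] p, z ∈ D) : HasHalfBox κ D p := by
  obtain ⟨r, hr, hbox⟩ := h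
  obtain ⟨r', hr', hbox'⟩ := exists_forall_of_eventually_nhdsWithin hD
  refine ⟨min r r', lt_min hr hr', fun z h1 h2 h3 => ?_⟩
  have h4 : |z.2 - p.2| = κ * (z.2 - p.2) := by
    rcases hκ with rfl | rfl
    · rw [one_mul] at h2 ⊢
      exact abs_of_pos h2
    · rw [abs_of_neg (by linarith)]
      ring
  exact hbox' z (hbox z (h1.trans_le (min_le_left _ _)) h2 (h3.trans_le (min_le_left _ _)))
    (h1.trans_le (min_le_right _ _)) (by rw [h4]; exact h3.trans_le (min_le_right _ _))

namespace IsPotNozzle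

variable {g₁ g₂ : ℝ → ℝ} {ψ₁ ψ₂ : ℝ}

theorem continuousWithinAt_comp_snd {g : ℝ → ℝ} (hg : ContinuousOn g (Icc ψ₁ ψ₂)) {p : ℝ × ℝ}
    (hp : p.2 ∈ Icc ψ₁ ψ₂) :
    ContinuousWithinAt (fun z : ℝ × ℝ => g z.2) {z | z.2 ∈ Icc ψ₁ ψ₂} p :=
  ContinuousWithinAt.comp (f := fun z : ℝ × ℝ => z.2) (g := g) (hg _ hp)
    continuousWithinAt_snd fun _ hz => hz

theorem exists_box (h : IsPotNozzle g₁ g₂ ψ₁ ψ₂) {p : ℝ × ℝ} (hp : p.2 ∈ Icc ψ₁ ψ₂)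
    (hp' : p.1 ∈ Ioo (g₁ p.2) (g₂ p.2)) :
    ∃ r > 0, ∀ z : ℝ × ℝ, z.2 ∈ Icc ψ₁ ψ₂ → |z.1 - p.1| < r → |z.2 - p.2| < r →
      z.1 ∈ Ioo (g₁ z.2) (g₂ z.2) := by
  have h1 := (continuousWithinAt_comp_snd h.cont₁ hp : Tendsto _ _ _).eventually_lt
    (continuousWithinAt_fst : Tendsto _ (𝓝[_] p) _) hp'.1
  have h2 := (continuousWithinAt_fst : Tendsto _ (𝓝[_] p) _).eventually_lt
    (continuousWithinAt_comp_snd h.cont₂ hp : Tendsto _ _ _) hp'.2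
  exact exists_forall_of_eventually_nhdsWithin (h1.and h2)

theorem isOpen (h : IsPotNozzle g₁ g₂ ψ₁ ψ₂) : IsOpen (potNozzle g₁ g₂ ψ₁ ψ₂) := by
  refine isOpen_iff_mem_nhds.2 fun p hp => ?_
  have hI : {z : ℝ × ℝ | z.2 ∈ Ioo ψ₁ ψ₂} ∈ 𝓝 p :=
    (isOpen_Ioo.preimage continuous_snd).mem_nhds hp.1
  have hI' : {z : ℝ × ℝ | z.2 ∈ Icc ψ₁ ψ₂} ∈ 𝓝 p := mem_of_superset hI fun z hz =>
    Ioo_subset_Icc_self hz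
  have hp2 := Ioo_subset_Icc_self hp.1
  have h1 := ((continuousWithinAt_comp_snd h.cont₁ hp2).continuousAt hI').eventually_lt
    continuousAt_fst hp.2.1
  have h2 := continuousAt_fst.eventually_lt
    ((continuousWithinAt_comp_snd h.cont₂ hp2).continuousAt hI') hp.2.2
  filter_upwards [hI, h1, h2] with z hz hz1 hz2 using ⟨hz, hz1, hz2⟩

theorem closure_subset (h : IsPotNozzle g₁ g₂ ψ₁ ψ₂) {p : ℝ × ℝ}
    (hp : p ∈ closure (potNozzle g₁ g₂ ψ₁ ψ₂)) :
    p.2 ∈ Icc ψ₁ ψ₂ ∧ p.1 ∈ Icc (g₁ p.2) (g₂ p.2) := by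
  have hsub : potNozzle g₁ g₂ ψ₁ ψ₂ ⊆ {z : ℝ × ℝ | z.2 ∈ Icc ψ₁ ψ₂} := fun z hz =>
    Ioo_subset_Icc_self hz.1
  have hp2 : p.2 ∈ Icc ψ₁ ψ₂ := closure_minimal hsub (isClosed_Icc.preimage continuous_snd) hp
  have hne := mem_closure_iff_nhdsWithin_neBot.1 hp
  have hmono := nhdsWithin_mono p hsub
  refine ⟨hp2, ?_, ?_⟩
  · refine le_of_tendsto_of_tendsto
      ((continuousWithinAt_comp_snd h.cont₁ hp2 : Tendsto _ _ _).mono_left hmono)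
      (continuousWithinAt_fst : Tendsto _ (𝓝[potNozzle g₁ g₂ ψ₁ ψ₂] p) _) ?_
    filter_upwards [self_mem_nhdsWithin] with z hz using hz.2.1.le
  · refine le_of_tendsto_of_tendsto
      (continuousWithinAt_fst : Tendsto _ (𝓝[potNozzle g₁ g₂ ψ₁ ψ₂] p) _)
      ((continuousWithinAt_comp_snd h.cont₂ hp2 : Tendsto _ _ _).mono_left hmono) ?_
    filter_upwards [self_mem_nhdsWithin] with z hz using hz.2.2.le

theorem hasHalfBox (h : IsPotNozzle g₁ g₂ ψ₁ ψ₂) {κ : ℝ} {p : ℝ × ℝ}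
    (hp : (κ = 1 ∧ p ∈ potWall g₁ g₂ ψ₁) ∨ (κ = -1 ∧ p ∈ potWall g₁ g₂ ψ₂)) :
    HasHalfBox κ (potNozzle g₁ g₂ ψ₁ ψ₂) p := by
  have hlt := h.lt
  have hp2 : p.2 ∈ Icc ψ₁ ψ₂ ∧ p.1 ∈ Ioo (g₁ p.2) (g₂ p.2) := by
    rcases hp with ⟨-, h1, h2⟩ | ⟨-, h1, h2⟩ <;> rw [h1]
    · exact ⟨left_mem_Icc.2 hlt.le, h2⟩
    · exact ⟨right_mem_Icc.2 hlt.le, h2⟩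
  obtain ⟨r, hr, hbox⟩ := h.exists_box hp2.1 hp2.2
  refine ⟨min r (ψ₂ - ψ₁), lt_min hr (sub_pos.2 hlt), fun z h1 h2 h3 => ?_⟩
  have h4 := h3.trans_le (min_le_left _ _)
  have h5 := h3.trans_le (min_le_right _ _)
  have h6 : z.2 ∈ Ioo ψ₁ ψ₂ := by
    rcases hp with ⟨rfl, e, -⟩ | ⟨rfl, e, -⟩ <;> rw [e] at h2 h5 <;> constructor <;> linarith
  refine ⟨h6, hbox z (Ioo_subset_Icc_self h6) (h1.trans_le (min_le_left _ _)) ?_⟩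
  rcases hp with ⟨rfl, e, -⟩ | ⟨rfl, e, -⟩ <;> rw [abs_lt] <;> constructor <;> linarith

end IsPotNozzle

namespace IsMeyerSonicCurve

variable {c : ℝ} {D Wl Wu : Set (ℝ × ℝ)} {q : ℝ × ℝ → ℝ} {S : ℝ → ℝ × ℝ}

theorem continuousOn_deriv (h : IsMeyerSonicCurve c D Wl Wu q S) :
    ContinuousOn (derivWithin S (Icc 0 1)) (Icc 0 1) :=
  h.contDiffOn.continuousOn_derivWithin (uniqueDiffOn_Icc one_pos) (by norm_num)

theorem hasDerivAt (h : IsMeyerSonicCurve c D Wl Wu q S) {s : ℝ} (hs : s ∈ Ioo (0 : ℝ) 1) :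
    HasDerivAt S (derivWithin S (Icc 0 1) s) s :=
  ((h.contDiffOn.differentiableOn (by norm_num) s
    (Ioo_subset_Icc_self hs)).hasDerivWithinAt).hasDerivAt (Icc_mem_nhds hs.1 hs.2)

theorem hasDerivWithinAt (h : IsMeyerSonicCurve c D Wl Wu q S) {s : ℝ} (hs : s ∈ Icc (0 : ℝ) 1) :
    HasDerivWithinAt S (derivWithin S (Icc 0 1) s) (Icc 0 1) s :=
  (h.contDiffOn.differentiableOn (by norm_num) s hs).hasDerivWithinAt

theorem mem_closure (h : IsMeyerSonicCurve c D Wl Wu q S) {s : ℝ} (hs : s ∈ Icc (0 : ℝ) 1) :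
    S s ∈ closure D ∧ q (S s) = c := by
  have := mem_image_of_mem S hs
  rwa [h.image_eq] at this

end IsMeyerSonicCurve

/-! ### The potential plane -/

theorem exists_isSonicFlow_of_pot {γ : ℝ} (hγ : 1 < γ) {g₁ g₂ : ℝ → ℝ} {ψ₁ ψ₂ : ℝ}
    {q θ : ℝ × ℝ → ℝ} {S : ℝ → ℝ × ℝ} (hG : IsPotNozzle g₁ g₂ ψ₁ ψ₂)
    (hq : IsPotFlow γ (potNozzle g₁ g₂ ψ₁ ψ₂) q θ)
    (hS : IsMeyerSonicCurve (critSpeed γ) (potNozzle g₁ g₂ ψ₁ ψ₂) (potWall g₁ g₂ ψ₁)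
      (potWall g₁ g₂ ψ₂) q S) :
    ∃ τ a b, ((τ = 1 ∧ S 0 ∈ potWall g₁ g₂ ψ₁ ∧ S 1 ∈ potWall g₁ g₂ ψ₂) ∨
        (τ = -1 ∧ S 0 ∈ potWall g₁ g₂ ψ₂ ∧ S 1 ∈ potWall g₁ g₂ ψ₁)) ∧
      IsSonicFlow γ τ ψ₁ ψ₂ (potNozzle g₁ g₂ ψ₁ ψ₂) q θ S (derivWithin S (Icc 0 1)) a b := by
  have hopen := hG.isOpen
  set D := potNozzle g₁ g₂ ψ₁ ψ₂
  obtain ⟨τ, hτ⟩ : ∃ τ : ℝ, (τ = 1 ∧ S 0 ∈ potWall g₁ g₂ ψ₁ ∧ S 1 ∈ potWall g₁ g₂ ψ₂) ∨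
      (τ = -1 ∧ S 0 ∈ potWall g₁ g₂ ψ₂ ∧ S 1 ∈ potWall g₁ g₂ ψ₁) := by
    rcases hS.ends with h | h
    · exact ⟨1, Or.inl ⟨rfl, h⟩⟩
    · exact ⟨-1, Or.inr ⟨rfl, h⟩⟩
  obtain ⟨g, hg⟩ := exists_gradient_family hopen hq.contDiffOn_q
  have hpart := fun w : ℝ × ℝ => hg (fun _ => w) contDiffOn_const
  refine ⟨τ, fun s => g (S s) (S s) (1, 0), fun s => g (S s) (S s) (0, 1), hτ, ?_⟩
  have hqD : ∀ z ∈ D, 0 < q z ∧ q z < maxSpeed γ := fun z hz =>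
    ⟨hq.pos z (subset_closure hz), hq.lt_max z (subset_closure hz)⟩
  have hqC : ContDiffOn ℝ 2 q D := hq.contDiffOn_q.mono subset_closure
  refine
    { isOpen := hopen
      strip := fun z hz => hz.1
      lt := hG.lt
      contDiffOn_q := hqC
      contDiffOn_θ := hq.contDiffOn_θ.mono subset_closure
      chaplygin₁ := fun z hz => pd₂_θ_of_chaplygin (hq.chaplygin₁ z hz)
      chaplygin₂ := fun z hz => pd₁_θ_of_chaplygin
        (density_pos_of_lt_maxSpeed hγ (hqD z hz).1 (hqD z hz).2).ne' (hq.chaplygin₂ z hz)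
      continuousOn := hS.contDiffOn.continuousOn
      hasDerivAt := fun s hs => hS.hasDerivAt hs
      continuousOn_deriv := hS.continuousOn_deriv
      regular := hS.regular
      injOn := hS.injOn
      mem := hS.mem_nozzle
      ends := hτ.imp (fun h => ⟨h.1, h.2.1.1, h.2.2.1⟩) (fun h => ⟨h.1, h.2.1.1, h.2.2.1⟩)
      start_box := hG.hasHalfBox (hτ.imp (fun h => ⟨h.1, h.2.1⟩) (fun h => ⟨h.1, h.2.1⟩))
      end_box := hG.hasHalfBox (hτ.symm.imp (fun h => ⟨by rw [h.1, neg_neg], h.2.2⟩)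
        (fun h => ⟨by rw [h.1], h.2.2⟩))
      sonic := fun z hz hzc => by
        rw [hS.image_eq]
        exact ⟨subset_closure hz, hzc⟩
      q_eq := fun s hs => (hS.mem_closure (Ioo_subset_Icc_self hs)).2
      tendsto_q := fun s hs => by
        obtain ⟨h1, h2⟩ := hS.mem_closure hs
        have h3 : Tendsto q _ _ := (hq.contDiffOn_q (S s) h1).continuousWithinAt
        rw [h2] at h3
        exact h3.mono_left (nhdsWithin_mono _ subset_closure)
      tendsto₁ := fun s hs =>
        let h := hpart (1, 0) (S s) (hS.mem_closure hs).1
        tendsto_of_eventuallyEq_contDiff h.1 h.2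
      tendsto₂ := fun s hs =>
        let h := hpart (0, 1) (S s) (hS.mem_closure hs).1
        tendsto_of_eventuallyEq_contDiff h.1 h.2
      bounded := fun s hs => by
        have h := hpart (1, 0) (S s) (hS.mem_closure hs).1
        obtain ⟨M, hM⟩ := exists_bound_fderiv (F := pd₁ q) hopen h.1 h.2
        exact ⟨M, hM.mono fun z hz => ⟨(abs_pd₁_le _ _).trans hz, (abs_pd₂_le _ _).trans hz⟩⟩
      left := fun s hs => fderiv_nonpos_of_eventually_lt
        ((hqC.contDiffAt (hopen.mem_nhds (hS.mem_nozzle s hs))).differentiableAt (by norm_num))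
        (hS.mem_closure (Ioo_subset_Icc_self hs)).2 (hS.left_subsonic s hs) }

theorem exists_decomposition_of_pot {γ : ℝ} (hγ : 1 < γ) {g₁ g₂ : ℝ → ℝ} {ψ₁ ψ₂ : ℝ}
    {q θ : ℝ × ℝ → ℝ} {S : ℝ → ℝ × ℝ} (hG : IsPotNozzle g₁ g₂ ψ₁ ψ₂)
    (hq : IsPotFlow γ (potNozzle g₁ g₂ ψ₁ ψ₂) q θ)
    (hS : IsMeyerSonicCurve (critSpeed γ) (potNozzle g₁ g₂ ψ₁ ψ₂) (potWall g₁ g₂ ψ₁)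
      (potWall g₁ g₂ ψ₂) q S) :
    ∃ Sp Sm : Set (ℝ × ℝ),
      IsDecomposition (potWall g₁ g₂ ψ₁) (potWall g₁ g₂ ψ₂) (S '' Icc 0 1) (exceptionalSet θ S)
        Sp Sm ∧ HasPotentialShape S (exceptionalSet θ S) Sp Sm := by
  obtain ⟨τ, a, b, hτ, h⟩ := exists_isSonicFlow_of_pot hγ hG hq hS
  have huni := h.isUnimodalSign hγ
  have hθ : ContinuousOn (fun s => θ (S s)) (Icc 0 1) :=
    hq.contDiffOn_θ.continuousOn.comp h.continuousOn fun s hs => (hS.mem_closure hs).1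
  have hE : exceptionalSet θ S = S '' {s ∈ Icc (0 : ℝ) 1 | (derivWithin S (Icc 0 1) s).1 = 0} :=
    congrArg (S '' ·) (ext fun s => and_congr_right fun hs =>
      h.derivWithin_angle_eq_zero_iff hγ hθ (fun _ _ => rfl) hs)
  refine ⟨S '' {s ∈ Icc (0 : ℝ) 1 | (derivWithin S (Icc 0 1) s).1 < 0},
    S '' {s ∈ Icc (0 : ℝ) 1 | 0 < (derivWithin S (Icc 0 1) s).1}, ?_⟩
  rw [hE]
  exact ⟨huni.isDecomposition h.continuousOn_deriv.fst h.continuousOn h.injOn hτ,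
    huni.hasPotentialShape h.sign (fun s hs => hS.hasDerivWithinAt hs) h.continuousOn_deriv
      h.injOn⟩

/-! ### The coordinate transformation -/

namespace IsPhysNozzle

variable {f₁ f₂ : ℝ → ℝ} {l₁ l₂ : ℝ}

/-- Exchanging the coordinates turns a nozzle of the physical plane into one of the potential plane,
with the roles of the walls and of the ends exchanged. -/
theorem isPotNozzle (h : IsPhysNozzle f₁ f₂ l₁ l₂) : IsPotNozzle f₁ f₂ l₁ l₂ :=
  ⟨h.lt, h.contDiffOn₁.continuousOn, h.contDiffOn₂.continuousOn, h.f_lt⟩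

theorem isOpen (h : IsPhysNozzle f₁ f₂ l₁ l₂) : IsOpen (physNozzle f₁ f₂ l₁ l₂) :=
  h.isPotNozzle.isOpen.preimage continuous_swap

theorem closure_subset (h : IsPhysNozzle f₁ f₂ l₁ l₂) {p : ℝ × ℝ}
    (hp : p ∈ closure (physNozzle f₁ f₂ l₁ l₂)) :
    p.1 ∈ Icc l₁ l₂ ∧ p.2 ∈ Icc (f₁ p.1) (f₂ p.1) := by
  have h1 : p.swap ∈ closure (potNozzle f₁ f₂ l₁ l₂) :=
    map_mem_closure continuous_swap hp fun z hz => hz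
  exact h.isPotNozzle.closure_subset h1

theorem isCompact_closure (h : IsPhysNozzle f₁ f₂ l₁ l₂) :
    IsCompact (closure (physNozzle f₁ f₂ l₁ l₂)) := by
  obtain ⟨m, hm⟩ := (isCompact_Icc.image_of_continuousOn h.contDiffOn₁.continuousOn).bddBelow
  obtain ⟨M, hM⟩ := (isCompact_Icc.image_of_continuousOn h.contDiffOn₂.continuousOn).bddAbove
  refine (isCompact_Icc.prod isCompact_Icc : IsCompact (Icc l₁ l₂ ×ˢ Icc m M)).of_isClosed_subset
    isClosed_closure fun p hp => ?_
  obtain ⟨h1, h2⟩ := h.closure_subset hp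
  exact ⟨h1, (hm (mem_image_of_mem _ h1)).trans h2.1, h2.2.trans (hM (mem_image_of_mem _ h1))⟩

theorem mem_closure (h : IsPhysNozzle f₁ f₂ l₁ l₂) {x y : ℝ} (hx : x ∈ Ioo l₁ l₂)
    (hy : y ∈ Icc (f₁ x) (f₂ x)) : (x, y) ∈ closure (physNozzle f₁ f₂ l₁ l₂) := by
  have h1 : y ∈ closure (Ioo (f₁ x) (f₂ x)) := by
    rwa [closure_Ioo (h.f_lt x (Ioo_subset_Icc_self hx)).ne]
  exact map_mem_closure (f := fun y => (x, y)) (by fun_prop) h1 fun z hz => ⟨hx, hz⟩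

end IsPhysNozzle

/-- A flow in a nozzle of the physical plane together with its representation in the potential
plane. -/
structure IsRepresentedFlow (γ : ℝ) (f₁ f₂ : ℝ → ℝ) (l₁ l₂ : ℝ) (g₁ g₂ : ℝ → ℝ) (ψ₁ ψ₂ : ℝ)
    (u v θ φ ψ : ℝ × ℝ → ℝ) : Prop where
  one_lt : 1 < γ
  nozzle : IsPhysNozzle f₁ f₂ l₁ l₂
  potNozzle : IsPotNozzle g₁ g₂ ψ₁ ψ₂
  flow : IsPhysFlow γ (physNozzle f₁ f₂ l₁ l₂) u v
  angle : IsFlowAngle (physNozzle f₁ f₂ l₁ l₂) u v θ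
  potential : IsVelocityPotential (physNozzle f₁ f₂ l₁ l₂) u v φ
  stream : IsStreamFunction γ (physNozzle f₁ f₂ l₁ l₂) u v ψ
  rep : IsPotRepresentation f₁ f₂ l₁ l₂ g₁ g₂ ψ₁ ψ₂ φ ψ

/-- The inverse of the coordinate transformation from `closure D` to the potential plane. -/
def fromPot (D : Set (ℝ × ℝ)) (φ ψ : ℝ × ℝ → ℝ) : ℝ × ℝ → ℝ × ℝ :=
  Function.invFunOn (toPot φ ψ) (closure D)

/-- The derivative of the coordinate transformation. -/
def potDeriv (γ : ℝ) (u v : ℝ × ℝ → ℝ) (z w : ℝ × ℝ) : ℝ × ℝ :=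
  (u z * w.1 + v z * w.2, flowDensity γ u v z * (-(v z * w.1) + u z * w.2))

/-- The vector field which the coordinate transformation maps to `∂/∂φ`. -/
def potField₁ (u v : ℝ × ℝ → ℝ) (z : ℝ × ℝ) : ℝ × ℝ :=
  (u z / speed u v z ^ 2, v z / speed u v z ^ 2)

/-- The vector field which the coordinate transformation maps to `∂/∂ψ`. -/
def potField₂ (γ : ℝ) (u v : ℝ × ℝ → ℝ) (z : ℝ × ℝ) : ℝ × ℝ :=
  (-v z / (flowDensity γ u v z * speed u v z ^ 2), u z / (flowDensity γ u v z * speed u v z ^ 2))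

theorem speed_sq (u v : ℝ × ℝ → ℝ) (z : ℝ × ℝ) : speed u v z ^ 2 = u z ^ 2 + v z ^ 2 :=
  Real.sq_sqrt (by positivity)

namespace IsPhysFlow

variable {γ : ℝ} {D : Set (ℝ × ℝ)} {u v : ℝ × ℝ → ℝ} {z : ℝ × ℝ}

theorem density_pos (h : IsPhysFlow γ D u v) (hγ : 1 < γ) (hz : z ∈ closure D) :
    0 < flowDensity γ u v z :=
  density_pos_of_lt_maxSpeed hγ (h.pos z hz) (h.lt_max z hz)

theorem contDiffOn_speed (h : IsPhysFlow γ D u v) : ContDiffOn ℝ 2 (speed u v) (closure D) := by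
  refine ((h.contDiffOn_u.pow 2).add (h.contDiffOn_v.pow 2)).sqrt fun z hz => ?_
  have := pow_pos (h.pos z hz) 2
  rw [speed_sq] at this
  exact this.ne'

theorem contDiffOn_density (h : IsPhysFlow γ D u v) (hγ : 1 < γ) :
    ContDiffOn ℝ 2 (flowDensity γ u v) (closure D) :=
  (contDiffOn_const.sub (contDiffOn_const.mul (h.contDiffOn_speed.pow 2))).rpow_const_of_ne
    fun z hz => (base_pos_of_lt_maxSpeed hγ (h.pos z hz) (h.lt_max z hz)).ne'

theorem potDeriv_potField₁ (h : IsPhysFlow γ D u v) (hz : z ∈ closure D) :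
    potDeriv γ u v z (potField₁ u v z) = (1, 0) := by
  have h1 := speed_sq u v z
  have h2 := pow_pos (h.pos z hz) 2
  simp only [potDeriv, potField₁]
  ext
  · simp only
    rw [mul_div_assoc', mul_div_assoc', ← add_div, div_eq_one_iff_eq h2.ne']
    linarith
  · simp only
    field_simp
    ring

theorem potDeriv_potField₂ (h : IsPhysFlow γ D u v) (hγ : 1 < γ) (hz : z ∈ closure D) :
    potDeriv γ u v z (potField₂ γ u v z) = (0, 1) := by
  have h1 := speed_sq u v z
  have h2 := pow_pos (h.pos z hz) 2
  have h3 := h.density_pos hγ hz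
  simp only [potDeriv, potField₂]
  ext
  · simp only
    field_simp
    ring
  · simp only
    rw [h1] at h2 ⊢
    field_simp
    ring

theorem eq_zero_of_potDeriv_eq_zero (h : IsPhysFlow γ D u v) (hγ : 1 < γ) (hz : z ∈ closure D)
    {w : ℝ × ℝ} (hw : potDeriv γ u v z w = 0) : w = 0 := by
  have h1 := speed_sq u v z
  have h2 := pow_pos (h.pos z hz) 2
  have h3 := h.density_pos hγ hz
  simp only [potDeriv, Prod.mk_eq_zero, mul_eq_zero, h3.ne', false_or] at hw
  obtain ⟨h4, h5⟩ := hw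
  rw [h1] at h2
  ext
  · refine (mul_eq_zero.1 (?_ : (u z ^ 2 + v z ^ 2) * w.1 = 0)).resolve_left h2.ne'
    linear_combination u z * h4 - v z * h5
  · refine (mul_eq_zero.1 (?_ : (u z ^ 2 + v z ^ 2) * w.2 = 0)).resolve_left h2.ne'
    linear_combination v z * h4 + u z * h5

end IsPhysFlow

/-- A flow angle is `C²`: near each point it is given by an arcsine of the normalized
component of the velocity orthogonal to its direction at the point. -/
theorem IsFlowAngle.contDiffOn {γ : ℝ} {D : Set (ℝ × ℝ)} {u v θ : ℝ × ℝ → ℝ}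
    (h : IsFlowAngle D u v θ) (hf : IsPhysFlow γ D u v) (hD : IsOpen D) : ContDiffOn ℝ 2 θ D := by
  intro p hp
  have hn := hD.mem_nhds hp
  have hu : ContDiffAt ℝ 2 u p := (hf.contDiffOn_u.mono subset_closure).contDiffAt hn
  have hv : ContDiffAt ℝ 2 v p := (hf.contDiffOn_v.mono subset_closure).contDiffAt hn
  have hq : ContDiffAt ℝ 2 (speed u v) p := (hf.contDiffOn_speed.mono subset_closure).contDiffAt hn
  have hpos : ∀ z ∈ D, 0 < speed u v z := fun z hz => hf.pos z (subset_closure hz)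
  set F : ℝ × ℝ → ℝ := fun z =>
    (v z * Real.cos (θ p) - u z * Real.sin (θ p)) / speed u v z
  have hF : ContDiffAt ℝ 2 F p :=
    ((hv.mul contDiffAt_const).sub (hu.mul contDiffAt_const)).div hq (hpos p hp).ne'
  have hFz : ∀ z ∈ D, F z = Real.sin (θ z - θ p) := fun z hz => by
    have h1 := hpos z hz
    simp only [F]
    rw [h.u_eq z (subset_closure hz), h.v_eq z (subset_closure hz), Real.sin_sub, div_eq_iff h1.ne']
    ring
  have hF0 : F p = 0 := by rw [hFz p hp, sub_self, Real.sin_zero]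
  have hθ : ContDiffAt ℝ 2 (fun z => θ p + Real.arcsin (F z)) p := by
    have h1 : ContDiffAt ℝ 2 Real.arcsin (F p) := by
      rw [hF0]
      exact Real.contDiffAt_arcsin (by norm_num) (by norm_num)
    exact contDiffAt_const.add (ContDiffAt.comp (g := Real.arcsin) p h1 hF)
  refine (hθ.congr_of_eventuallyEq ?_).contDiffWithinAt
  have hc : ContinuousAt θ p := (h.cont.mono subset_closure).continuousAt hn
  have hpi : (0 : ℝ) < Real.pi / 2 := by positivity
  filter_upwards [hn, Metric.continuousAt_iff'.1 hc _ hpi] with z hz hd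
  rw [Real.dist_eq, abs_lt] at hd
  rw [hFz z hz, Real.arcsin_sin hd.1.le hd.2.le]
  ring

namespace IsRepresentedFlow

variable {γ : ℝ} {f₁ f₂ : ℝ → ℝ} {l₁ l₂ : ℝ} {g₁ g₂ : ℝ → ℝ} {ψ₁ ψ₂ : ℝ} {u v θ φ ψ : ℝ × ℝ → ℝ}

theorem continuousOn_toPot (h : IsRepresentedFlow γ f₁ f₂ l₁ l₂ g₁ g₂ ψ₁ ψ₂ u v θ φ ψ) :
    ContinuousOn (toPot φ ψ) (closure (physNozzle f₁ f₂ l₁ l₂)) :=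
  h.potential.cont.prodMk h.stream.cont

theorem fromPot_toPot (h : IsRepresentedFlow γ f₁ f₂ l₁ l₂ g₁ g₂ ψ₁ ψ₂ u v θ φ ψ) {z : ℝ × ℝ}
    (hz : z ∈ closure (physNozzle f₁ f₂ l₁ l₂)) :
    fromPot (physNozzle f₁ f₂ l₁ l₂) φ ψ (toPot φ ψ z) = z :=
  h.rep.bijOn.injOn.leftInvOn_invFunOn hz

theorem toPot_fromPot (h : IsRepresentedFlow γ f₁ f₂ l₁ l₂ g₁ g₂ ψ₁ ψ₂ u v θ φ ψ) {w : ℝ × ℝ}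
    (hw : w ∈ closure (TransonicFlow.potNozzle g₁ g₂ ψ₁ ψ₂)) :
    toPot φ ψ (fromPot (physNozzle f₁ f₂ l₁ l₂) φ ψ w) = w :=
  h.rep.bijOn.surjOn.rightInvOn_invFunOn hw

theorem fromPot_mem (h : IsRepresentedFlow γ f₁ f₂ l₁ l₂ g₁ g₂ ψ₁ ψ₂ u v θ φ ψ) {w : ℝ × ℝ}
    (hw : w ∈ closure (TransonicFlow.potNozzle g₁ g₂ ψ₁ ψ₂)) :
    fromPot (physNozzle f₁ f₂ l₁ l₂) φ ψ w ∈ closure (physNozzle f₁ f₂ l₁ l₂) :=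
  h.rep.bijOn.surjOn.mapsTo_invFunOn hw

/-- A continuous bijection of a compact set has a continuous inverse. -/
theorem continuousOn_fromPot (h : IsRepresentedFlow γ f₁ f₂ l₁ l₂ g₁ g₂ ψ₁ ψ₂ u v θ φ ψ) :
    ContinuousOn (fromPot (physNozzle f₁ f₂ l₁ l₂) φ ψ)
      (closure (TransonicFlow.potNozzle g₁ g₂ ψ₁ ψ₂)) := by
  refine continuousOn_iff_isClosed.2 fun t ht =>
    ⟨toPot φ ψ '' (closure (physNozzle f₁ f₂ l₁ l₂) ∩ t), ?_, ?_⟩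
  · exact ((h.nozzle.isCompact_closure.inter_right ht).image_of_continuousOn
      (h.continuousOn_toPot.mono inter_subset_left)).isClosed
  · ext w
    constructor
    · rintro ⟨h1, h2⟩
      exact ⟨⟨_, ⟨h.fromPot_mem h2, h1⟩, h.toPot_fromPot h2⟩, h2⟩
    · rintro ⟨⟨z, ⟨hz, hzt⟩, rfl⟩, h2⟩
      refine ⟨?_, h2⟩
      rw [mem_preimage, h.fromPot_toPot hz]
      exact hzt

theorem contDiffOn_toPot (h : IsRepresentedFlow γ f₁ f₂ l₁ l₂ g₁ g₂ ψ₁ ψ₂ u v θ φ ψ) :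
    ContDiffOn ℝ 2 (toPot φ ψ) (physNozzle f₁ f₂ l₁ l₂) := by
  have hopen := h.nozzle.isOpen
  have key : ∀ f F₁ F₂ : ℝ × ℝ → ℝ, DifferentiableOn ℝ f (physNozzle f₁ f₂ l₁ l₂) →
      ContDiffOn ℝ 2 F₁ (physNozzle f₁ f₂ l₁ l₂) → ContDiffOn ℝ 2 F₂ (physNozzle f₁ f₂ l₁ l₂) →
      (∀ p ∈ physNozzle f₁ f₂ l₁ l₂, pd₁ f p = F₁ p) →
      (∀ p ∈ physNozzle f₁ f₂ l₁ l₂, pd₂ f p = F₂ p) →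
      ContDiffOn ℝ 2 f (physNozzle f₁ f₂ l₁ l₂) := by
    intro f F₁ F₂ hf h1 h2 e1 e2
    rw [← one_add_one_eq_two, contDiffOn_succ_iff_fderiv_of_isOpen hopen]
    refine ⟨hf, by simp, ?_⟩
    have h3 : ContDiffOn ℝ 1 (fun z => F₁ z • ContinuousLinearMap.fst ℝ ℝ ℝ +
        F₂ z • ContinuousLinearMap.snd ℝ ℝ ℝ) (physNozzle f₁ f₂ l₁ l₂) :=
      ((h1.of_le one_le_two).smul contDiffOn_const).add
        ((h2.of_le one_le_two).smul contDiffOn_const)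
    refine h3.congr fun z hz => ContinuousLinearMap.ext fun w => ?_
    rw [fderiv_eq_pd, e1 z hz, e2 z hz]
    simp
  have hu := h.flow.contDiffOn_u.mono subset_closure
  have hv := h.flow.contDiffOn_v.mono subset_closure
  have hρ := (h.flow.contDiffOn_density h.one_lt).mono subset_closure
  exact (key φ u v h.potential.diff hu hv h.potential.dx h.potential.dy).prodMk
    (key ψ _ _ h.stream.diff (hρ.mul hv).neg (hρ.mul hu) h.stream.dx h.stream.dy)

theorem differentiableAt_toPot (h : IsRepresentedFlow γ f₁ f₂ l₁ l₂ g₁ g₂ ψ₁ ψ₂ u v θ φ ψ)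
    {z : ℝ × ℝ} (hz : z ∈ physNozzle f₁ f₂ l₁ l₂) : DifferentiableAt ℝ (toPot φ ψ) z :=
  (h.contDiffOn_toPot.contDiffAt (h.nozzle.isOpen.mem_nhds hz)).differentiableAt (by norm_num)

theorem fderiv_toPot (h : IsRepresentedFlow γ f₁ f₂ l₁ l₂ g₁ g₂ ψ₁ ψ₂ u v θ φ ψ)
    {z : ℝ × ℝ} (hz : z ∈ physNozzle f₁ f₂ l₁ l₂) (w : ℝ × ℝ) :
    fderiv ℝ (toPot φ ψ) z w = potDeriv γ u v z w := by
  have hn := h.nozzle.isOpen.mem_nhds hz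
  have h1 := (h.potential.diff z hz).differentiableAt hn
  have h2 := (h.stream.diff z hz).differentiableAt hn
  have h3 : HasFDerivAt (toPot φ ψ) ((fderiv ℝ φ z).prod (fderiv ℝ ψ z)) z :=
    h1.hasFDerivAt.prodMk h2.hasFDerivAt
  rw [h3.fderiv, ContinuousLinearMap.prod_apply, fderiv_eq_pd, fderiv_eq_pd, h.potential.dx z hz,
    h.potential.dy z hz, h.stream.dx z hz, h.stream.dy z hz, potDeriv]
  congr 1
  ring

theorem exists_hasFDerivAt_equiv (h : IsRepresentedFlow γ f₁ f₂ l₁ l₂ g₁ g₂ ψ₁ ψ₂ u v θ φ ψ)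
    {z : ℝ × ℝ} (hz : z ∈ physNozzle f₁ f₂ l₁ l₂) :
    ∃ e : (ℝ × ℝ) ≃L[ℝ] ℝ × ℝ, HasFDerivAt (toPot φ ψ) (e : (ℝ × ℝ) →L[ℝ] ℝ × ℝ) z := by
  have hinj : Function.Injective (fderiv ℝ (toPot φ ψ) z : (ℝ × ℝ) →ₗ[ℝ] ℝ × ℝ) := by
    refine (injective_iff_map_eq_zero _).2 fun w hw => ?_
    refine h.flow.eq_zero_of_potDeriv_eq_zero h.one_lt (subset_closure hz) ?_
    rw [← h.fderiv_toPot hz]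
    exact hw
  refine ⟨(LinearEquiv.ofInjectiveEndo _ hinj).toContinuousLinearEquiv, ?_⟩
  exact (h.differentiableAt_toPot hz).hasFDerivAt

theorem isOpen_image (h : IsRepresentedFlow γ f₁ f₂ l₁ l₂ g₁ g₂ ψ₁ ψ₂ u v θ φ ψ) :
    IsOpen (toPot φ ψ '' physNozzle f₁ f₂ l₁ l₂) := by
  refine isOpen_iff_mem_nhds.2 ?_
  rintro _ ⟨z, hz, rfl⟩
  have hn := h.nozzle.isOpen.mem_nhds hz
  obtain ⟨e, he⟩ := h.exists_hasFDerivAt_equiv hz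
  rw [← ((h.contDiffOn_toPot.contDiffAt hn).hasStrictFDerivAt' he
    (by norm_num)).map_nhds_eq_of_equiv]
  exact image_mem_map hn

theorem image_subset (h : IsRepresentedFlow γ f₁ f₂ l₁ l₂ g₁ g₂ ψ₁ ψ₂ u v θ φ ψ) :
    toPot φ ψ '' physNozzle f₁ f₂ l₁ l₂ ⊆ closure (TransonicFlow.potNozzle g₁ g₂ ψ₁ ψ₂) :=
  (image_mono subset_closure).trans h.rep.bijOn.mapsTo.image_subset

/-- The stream function takes its extreme values only on the boundary, since the change of
coordinates is open. -/
theorem image_strip (h : IsRepresentedFlow γ f₁ f₂ l₁ l₂ g₁ g₂ ψ₁ ψ₂ u v θ φ ψ) {w : ℝ × ℝ}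
    (hw : w ∈ toPot φ ψ '' physNozzle f₁ f₂ l₁ l₂) : w.2 ∈ Ioo ψ₁ ψ₂ := by
  have h1 : Prod.snd '' (toPot φ ψ '' physNozzle f₁ f₂ l₁ l₂) ⊆ Icc ψ₁ ψ₂ := by
    rintro _ ⟨p, hp, rfl⟩
    exact (h.potNozzle.closure_subset (h.image_subset hp)).1
  rw [← interior_Icc]
  exact interior_maximal h1 (isOpenMap_snd _ h.isOpen_image) (mem_image_of_mem _ hw)

theorem contDiffOn_fromPot (h : IsRepresentedFlow γ f₁ f₂ l₁ l₂ g₁ g₂ ψ₁ ψ₂ u v θ φ ψ) :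
    ContDiffOn ℝ 2 (fromPot (physNozzle f₁ f₂ l₁ l₂) φ ψ)
      (toPot φ ψ '' physNozzle f₁ f₂ l₁ l₂) := by
  rintro _ ⟨z, hz, rfl⟩
  have hn := h.nozzle.isOpen.mem_nhds hz
  obtain ⟨e, he⟩ := h.exists_hasFDerivAt_equiv hz
  have hc := h.contDiffOn_toPot.contDiffAt hn
  refine ((hc.to_localInverse he (by norm_num)).congr_of_eventuallyEq ?_).contDiffWithinAt
  refine (hc.hasStrictFDerivAt' he (by norm_num)).localInverse_unique ?_
  filter_upwards [hn] with x hx using h.fromPot_toPot (subset_closure hx)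

theorem contDiffOn_comp_fromPot (h : IsRepresentedFlow γ f₁ f₂ l₁ l₂ g₁ g₂ ψ₁ ψ₂ u v θ φ ψ)
    {n : WithTop ℕ∞} (hn : n ≤ 2) {f : ℝ × ℝ → ℝ} (hf : ContDiffOn ℝ n f (physNozzle f₁ f₂ l₁ l₂)) :
    ContDiffOn ℝ n (fun w => f (fromPot (physNozzle f₁ f₂ l₁ l₂) φ ψ w))
      (toPot φ ψ '' physNozzle f₁ f₂ l₁ l₂) := by
  refine hf.comp (h.contDiffOn_fromPot.of_le hn) ?_
  rintro _ ⟨z, hz, rfl⟩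
  rw [h.fromPot_toPot (subset_closure hz)]
  exact hz

/-- The chain rule for the change of coordinates. -/
theorem fderiv_comp_fromPot (h : IsRepresentedFlow γ f₁ f₂ l₁ l₂ g₁ g₂ ψ₁ ψ₂ u v θ φ ψ)
    {f : ℝ × ℝ → ℝ} {z : ℝ × ℝ} (hz : z ∈ physNozzle f₁ f₂ l₁ l₂) (hf : DifferentiableAt ℝ f z)
    (w : ℝ × ℝ) :
    fderiv ℝ (fun w => f (fromPot (physNozzle f₁ f₂ l₁ l₂) φ ψ w)) (toPot φ ψ z)
      (potDeriv γ u v z w) = fderiv ℝ f z w := by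
  have hn := h.nozzle.isOpen.mem_nhds hz
  have e := h.fromPot_toPot (subset_closure hz)
  have hΦ : DifferentiableAt ℝ (fromPot (physNozzle f₁ f₂ l₁ l₂) φ ψ) (toPot φ ψ z) :=
    (h.contDiffOn_fromPot.contDiffAt (h.isOpen_image.mem_nhds
      (mem_image_of_mem _ hz))).differentiableAt (by norm_num)
  have h1 : DifferentiableAt ℝ (fun w => f (fromPot (physNozzle f₁ f₂ l₁ l₂) φ ψ w))
      (toPot φ ψ z) := DifferentiableAt.comp (g := f) _ (by rwa [e]) hΦ
  have h2 := h1.hasFDerivAt.comp z (h.differentiableAt_toPot hz).hasFDerivAt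
  have h3 : f =ᶠ[𝓝 z] fun x => f (fromPot (physNozzle f₁ f₂ l₁ l₂) φ ψ (toPot φ ψ x)) := by
    filter_upwards [hn] with x hx
    rw [h.fromPot_toPot (subset_closure hx)]
  rw [h3.fderiv_eq, ← h.fderiv_toPot hz, ← ContinuousLinearMap.comp_apply, ← h2.fderiv]
  rfl

theorem pd₁_comp_fromPot (h : IsRepresentedFlow γ f₁ f₂ l₁ l₂ g₁ g₂ ψ₁ ψ₂ u v θ φ ψ)
    {f : ℝ × ℝ → ℝ} {z : ℝ × ℝ} (hz : z ∈ physNozzle f₁ f₂ l₁ l₂) (hf : DifferentiableAt ℝ f z) :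
    pd₁ (fun w => f (fromPot (physNozzle f₁ f₂ l₁ l₂) φ ψ w)) (toPot φ ψ z) =
      fderiv ℝ f z (potField₁ u v z) := by
  rw [← h.fderiv_comp_fromPot hz hf, h.flow.potDeriv_potField₁ (subset_closure hz), pd₁]

theorem pd₂_comp_fromPot (h : IsRepresentedFlow γ f₁ f₂ l₁ l₂ g₁ g₂ ψ₁ ψ₂ u v θ φ ψ)
    {f : ℝ × ℝ → ℝ} {z : ℝ × ℝ} (hz : z ∈ physNozzle f₁ f₂ l₁ l₂) (hf : DifferentiableAt ℝ f z) :
    pd₂ (fun w => f (fromPot (physNozzle f₁ f₂ l₁ l₂) φ ψ w)) (toPot φ ψ z) =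
      fderiv ℝ f z (potField₂ γ u v z) := by
  rw [← h.fderiv_comp_fromPot hz hf, h.flow.potDeriv_potField₂ h.one_lt (subset_closure hz), pd₂]

end IsRepresentedFlow

/-! ### The flow equations in the new coordinates -/

theorem pd_of_eq_mul {f q g : ℝ × ℝ → ℝ} {z : ℝ × ℝ} (h : f =ᶠ[𝓝 z] fun x => q x * g x)
    (hq : DifferentiableAt ℝ q z) (hg : DifferentiableAt ℝ g z) (w : ℝ × ℝ) :
    fderiv ℝ f z w = fderiv ℝ q z w * g z + q z * fderiv ℝ g z w := by
  rw [h.fderiv_eq, fderiv_fun_mul hq hg]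
  simp only [add_apply, smul_apply, smul_eq_mul]
  ring

/-- Irrotationality and mass conservation, expressed by the derivatives of the speed and the flow
angle along and orthogonal to the velocity. -/
theorem flow_equations_of_angle {γ : ℝ} {D : Set (ℝ × ℝ)} {u v θ : ℝ × ℝ → ℝ} (hγ : 1 < γ)
    (hf : IsPhysFlow γ D u v) (hθ : IsFlowAngle D u v θ) (hD : IsOpen D) {z : ℝ × ℝ} (hz : z ∈ D) :
    fderiv ℝ (speed u v) z (-v z, u z) = speed u v z * fderiv ℝ θ z (u z, v z) ∧
    (density γ (speed u v z ^ 2) + 2 * speed u v z ^ 2 * deriv (density γ) (speed u v z ^ 2)) *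
        fderiv ℝ (speed u v) z (u z, v z) +
      density γ (speed u v z ^ 2) * speed u v z * fderiv ℝ θ z (-v z, u z) = 0 := by
  have hn := hD.mem_nhds hz
  have hzc := subset_closure hz
  set q := speed u v with hqdef
  have hq : DifferentiableAt ℝ q z :=
    ((hf.contDiffOn_speed.mono subset_closure).contDiffAt hn).differentiableAt (by norm_num)
  have hθd : DifferentiableAt ℝ θ z :=
    ((hθ.contDiffOn hf hD).contDiffAt hn).differentiableAt (by norm_num)
  have hcos := hθd.hasFDerivAt.cos
  have hsin := hθd.hasFDerivAt.sin
  have hu : u =ᶠ[𝓝 z] fun x => q x * Real.cos (θ x) := by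
    filter_upwards [hn] with x hx using hθ.u_eq x (subset_closure hx)
  have hv : v =ᶠ[𝓝 z] fun x => q x * Real.sin (θ x) := by
    filter_upwards [hn] with x hx using hθ.v_eq x (subset_closure hx)
  have hqz : 0 < q z := hf.pos z hzc
  have hbase := base_pos_of_lt_maxSpeed hγ hqz (hf.lt_max z hzc)
  have hρ' := (hasDerivAt_density hγ hbase).differentiableAt.hasDerivAt
  -- the derivative of the mass flux `ρ(q²) q`
  have hm : HasFDerivAt (fun x => density γ (q x ^ 2) * q x)
      ((density γ (q z ^ 2) + 2 * q z ^ 2 * deriv (density γ) (q z ^ 2)) • fderiv ℝ q z) z := by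
    have h1 : HasFDerivAt (fun x => q x ^ 2) ((2 * q z) • fderiv ℝ q z) z := by
      simpa using hq.hasFDerivAt.pow 2
    have h2 : HasFDerivAt (fun x => density γ (q x ^ 2))
      (deriv (density γ) (q z ^ 2) • ((2 * q z) • fderiv ℝ q z)) z := by
      exact HasDerivAt.comp_hasFDerivAt (h₂ := density γ) z hρ' h1
    refine (h2.mul hq.hasFDerivAt).congr_fderiv ?_
    ext <;> simp <;> ring
  have hmu : (fun x => flowDensity γ u v x * u x) =ᶠ[𝓝 z]
      fun x => (density γ (q x ^ 2) * q x) * Real.cos (θ x) := by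
    filter_upwards [hu] with x hx
    rw [mul_assoc, ← hx, flowDensity]
  have hmv : (fun x => flowDensity γ u v x * v x) =ᶠ[𝓝 z]
      fun x => (density γ (q x ^ 2) * q x) * Real.sin (θ x) := by
    filter_upwards [hv] with x hx
    rw [mul_assoc, ← hx, flowDensity]
  have h1 := hf.irrotational z hz
  have h2 := hf.mass z hz
  rw [pd₂, pd₁, pd_of_eq_mul hu hq hcos.differentiableAt, pd_of_eq_mul hv hq hsin.differentiableAt,
    hcos.fderiv, hsin.fderiv] at h1
  rw [pd₂, pd₁, pd_of_eq_mul hmu hm.differentiableAt hcos.differentiableAt,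
    pd_of_eq_mul hmv hm.differentiableAt hsin.differentiableAt, hcos.fderiv, hsin.fderiv,
    hm.fderiv] at h2
  simp only [smul_apply, smul_eq_mul, fderiv_eq_pd] at h1 h2 ⊢
  rw [hu.eq_of_nhds, hv.eq_of_nhds]
  constructor
  · linear_combination q z * h1
  · linear_combination q z * h2

namespace IsRepresentedFlow

variable {γ : ℝ} {f₁ f₂ : ℝ → ℝ} {l₁ l₂ : ℝ} {g₁ g₂ : ℝ → ℝ} {ψ₁ ψ₂ : ℝ} {u v θ φ ψ : ℝ × ℝ → ℝ}

theorem chaplygin (h : IsRepresentedFlow γ f₁ f₂ l₁ l₂ g₁ g₂ ψ₁ ψ₂ u v θ φ ψ)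
    {z : ℝ × ℝ} (hz : z ∈ physNozzle f₁ f₂ l₁ l₂) :
    fderiv ℝ θ z (potField₂ γ u v z) =
        -(coeffK γ (speed u v z) * fderiv ℝ (speed u v) z (potField₁ u v z)) ∧
      fderiv ℝ θ z (potField₁ u v z) =
        coeffB γ (speed u v z) * fderiv ℝ (speed u v) z (potField₂ γ u v z) := by
  obtain ⟨h1, h2⟩ := flow_equations_of_angle h.one_lt h.flow h.angle h.nozzle.isOpen hz
  have hq := h.flow.pos z (subset_closure hz)
  have hρ := h.flow.density_pos h.one_lt (subset_closure hz)
  have e1 : potField₁ u v z = (1 / speed u v z ^ 2) • (u z, v z) := by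
    ext <;> simp [potField₁, div_eq_inv_mul]
  have e2 : potField₂ γ u v z = (1 / (flowDensity γ u v z * speed u v z ^ 2)) • (-v z, u z) := by
    ext <;> simp only [potField₂, Prod.smul_mk, smul_eq_mul] <;> ring
  rw [e1, e2]
  simp only [map_smul, smul_eq_mul, coeffK, coeffB]
  rw [flowDensity] at *
  generalize speed u v z = q at *
  generalize deriv (density γ) (q ^ 2) = ρ' at *
  generalize density γ (q ^ 2) = ρ at *
  constructor
  · field_simp
    linear_combination h2
  · field_simp
    linear_combination -h1

/-! ### The sonic curve in the new coordinates -/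

/-- A point of a wall which is not a corner is mapped to an interior point of the corresponding wall
in the potential plane: along the wall `φ` is continuous and injective, hence strictly monotone. -/
theorem toPot_mem_wall (h : IsRepresentedFlow γ f₁ f₂ l₁ l₂ g₁ g₂ ψ₁ ψ₂ u v θ φ ψ) {f : ℝ → ℝ}
    {ψ₀ : ℝ} (hf : (f = f₁ ∧ ψ₀ = ψ₁) ∨ (f = f₂ ∧ ψ₀ = ψ₂)) {p : ℝ × ℝ}
    (hp : p ∈ physWall f l₁ l₂) : toPot φ ψ p ∈ potWall g₁ g₂ ψ₀ := by
  have hcl : ∀ x ∈ Ioo l₁ l₂, (x, f x) ∈ closure (physNozzle f₁ f₂ l₁ l₂) := fun x hx => by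
    have hlt := (h.nozzle.f_lt x (Ioo_subset_Icc_self hx)).le
    rcases hf with ⟨rfl, -⟩ | ⟨rfl, -⟩
    · exact h.nozzle.mem_closure hx (left_mem_Icc.2 hlt)
    · exact h.nozzle.mem_closure hx (right_mem_Icc.2 hlt)
  have hψ : ∀ x ∈ Ioo l₁ l₂, ψ (x, f x) = ψ₀ := fun x hx => by
    rcases hf with ⟨rfl, rfl⟩ | ⟨rfl, rfl⟩
    · exact h.rep.lower x (Ioo_subset_Icc_self hx)
    · exact h.rep.upper x (Ioo_subset_Icc_self hx)
  have hfc : ContinuousOn f (Icc l₁ l₂) := by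
    rcases hf with ⟨rfl, -⟩ | ⟨rfl, -⟩
    · exact h.nozzle.contDiffOn₁.continuousOn
    · exact h.nozzle.contDiffOn₂.continuousOn
  set m : ℝ → ℝ := fun x => φ (x, f x)
  have hm : ContinuousOn m (Ioo l₁ l₂) :=
    h.potential.cont.comp (continuousOn_id.prodMk (hfc.mono Ioo_subset_Icc_self)) hcl
  have hinj : InjOn m (Ioo l₁ l₂) := fun x hx y hy hxy => by
    have := h.rep.bijOn.injOn (hcl x hx) (hcl y hy)
      (Prod.ext hxy ((hψ x hx).trans (hψ y hy).symm))
    exact congrArg Prod.fst this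
  have hbd : ∀ x ∈ Ioo l₁ l₂, m x ∈ Icc (g₁ ψ₀) (g₂ ψ₀) := fun x hx => by
    have := (h.potNozzle.closure_subset (h.rep.bijOn.mapsTo (hcl x hx))).2
    rwa [toPot, hψ x hx] at this
  obtain ⟨x₀, y₀⟩ := p
  obtain ⟨hx : x₀ ∈ Ioo l₁ l₂, rfl : y₀ = f x₀⟩ := hp
  refine ⟨hψ x₀ hx, ?_⟩
  obtain ⟨x, h1, h2⟩ := exists_between hx.1
  obtain ⟨y, h3, h4⟩ := exists_between hx.2
  have hx' : x ∈ Ioo l₁ l₂ := ⟨h1, h2.trans hx.2⟩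
  have hy' : y ∈ Ioo l₁ l₂ := ⟨hx.1.trans h3, h4⟩
  have hmono := ContinuousOn.strictMonoOn_of_injOn_Ioo h.nozzle.lt hm hinj
  rcases hmono with hmono | hmono
  · exact ⟨(hbd x hx').1.trans_lt (hmono hx' hx h2), (hmono hx hy' h3).trans_le (hbd y hy').2⟩
  · exact ⟨(hbd y hy').1.trans_lt (hmono hx hy' h3), (hmono hx' hx h2).trans_le (hbd x hx').2⟩

theorem tendsto_fromPot (h : IsRepresentedFlow γ f₁ f₂ l₁ l₂ g₁ g₂ ψ₁ ψ₂ u v θ φ ψ) {p : ℝ × ℝ}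
    (hp : p ∈ closure (physNozzle f₁ f₂ l₁ l₂)) :
    Tendsto (fromPot (physNozzle f₁ f₂ l₁ l₂) φ ψ)
      (𝓝[toPot φ ψ '' physNozzle f₁ f₂ l₁ l₂] toPot φ ψ p) (𝓝[physNozzle f₁ f₂ l₁ l₂] p) := by
  refine tendsto_nhdsWithin_iff.2 ⟨?_, ?_⟩
  · have h1 : Tendsto _ _ _ := h.continuousOn_fromPot _ (h.rep.bijOn.mapsTo hp)
    rw [h.fromPot_toPot hp] at h1
    exact h1.mono_left (nhdsWithin_mono _ h.image_subset)
  · filter_upwards [self_mem_nhdsWithin]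
    rintro _ ⟨z, hz, rfl⟩
    rw [h.fromPot_toPot (subset_closure hz)]
    exact hz

/-- Near a wall point, every point of the nozzle of the potential plane comes from an interior point
of the physical nozzle, since it is close to the wall and does not lie on it. -/
theorem eventually_mem_image (h : IsRepresentedFlow γ f₁ f₂ l₁ l₂ g₁ g₂ ψ₁ ψ₂ u v θ φ ψ)
    {p : ℝ × ℝ} (hp : p ∈ closure (physNozzle f₁ f₂ l₁ l₂)) (hp' : p.1 ∈ Ioo l₁ l₂) :
    ∀ᶠ w in 𝓝[TransonicFlow.potNozzle g₁ g₂ ψ₁ ψ₂] toPot φ ψ p,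
      w ∈ toPot φ ψ '' physNozzle f₁ f₂ l₁ l₂ := by
  have h1 : Tendsto _ _ _ := h.continuousOn_fromPot _ (h.rep.bijOn.mapsTo hp)
  rw [h.fromPot_toPot hp] at h1
  have h2 := (h1.mono_left (nhdsWithin_mono _ subset_closure)).eventually
    ((isOpen_Ioo.preimage continuous_fst).mem_nhds hp')
  filter_upwards [h2, self_mem_nhdsWithin] with w hw hwG
  have hwc := subset_closure hwG
  have hz := h.fromPot_mem hwc
  have hzw := h.toPot_fromPot hwc
  refine ⟨_, ⟨hw, ?_⟩, hzw⟩
  set z := fromPot (physNozzle f₁ f₂ l₁ l₂) φ ψ w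
  have h3 := (h.nozzle.closure_subset hz)
  have h4 : ψ z ∈ Ioo ψ₁ ψ₂ := by
    rw [← hzw] at hwG
    exact hwG.1
  refine ⟨lt_of_le_of_ne h3.2.1 fun he => ?_, lt_of_le_of_ne h3.2.2 fun he => ?_⟩
  · have h5 := h.rep.lower z.1 h3.1
    rw [he] at h5
    exact h4.1.ne' h5
  · have h5 := h.rep.upper z.1 h3.1
    rw [← he] at h5
    exact h4.2.ne h5

end IsRepresentedFlow

/-! ### The physical plane -/

theorem IsPhysFlow.contDiffOn_potField₁ {γ : ℝ} {D : Set (ℝ × ℝ)} {u v : ℝ × ℝ → ℝ}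
    (h : IsPhysFlow γ D u v) : ContDiffOn ℝ 2 (potField₁ u v) (closure D) :=
  (h.contDiffOn_u.div (h.contDiffOn_speed.pow 2) fun z hz => (pow_pos (h.pos z hz) 2).ne').prodMk
    (h.contDiffOn_v.div (h.contDiffOn_speed.pow 2) fun z hz => (pow_pos (h.pos z hz) 2).ne')

theorem IsPhysFlow.contDiffOn_potField₂ {γ : ℝ} {D : Set (ℝ × ℝ)} {u v : ℝ × ℝ → ℝ}
    (h : IsPhysFlow γ D u v) (hγ : 1 < γ) : ContDiffOn ℝ 2 (potField₂ γ u v) (closure D) := by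
  have h1 := (h.contDiffOn_density hγ).mul (h.contDiffOn_speed.pow 2)
  have h2 : ∀ z ∈ closure D, flowDensity γ u v z * speed u v z ^ 2 ≠ 0 := fun z hz =>
    (mul_pos (h.density_pos hγ hz) (pow_pos (h.pos z hz) 2)).ne'
  exact (h.contDiffOn_v.neg.div h1 h2).prodMk (h.contDiffOn_u.div h1 h2)

/-- The orientation of a curve is preserved by the change of coordinates, whose Jacobian is
positive: if the speed does not increase to the left of the sonic curve in the physical plane, the
same holds in the potential plane. -/
theorem left_nonpos_transfer {q ρ u v a b x y : ℝ} (hρ : 0 < ρ) (hq : 0 < q)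
    (hT : (x, y) ≠ ((0, 0) : ℝ × ℝ)) (h1 : a * x + b * y = 0) (h2 : a * -y + b * x ≤ 0) :
    (a * (u / q ^ 2) + b * (v / q ^ 2)) * -(ρ * (-(v * x) + u * y)) +
      (a * (-v / (ρ * q ^ 2)) + b * (u / (ρ * q ^ 2))) * (u * x + v * y) ≤ 0 := by
  have hT' : 0 < x ^ 2 + y ^ 2 := by
    by_contra! hc
    refine hT (Prod.ext ?_ ?_)
    · simp only; nlinarith [sq_nonneg x, sq_nonneg y]
    · simp only; nlinarith [sq_nonneg x, sq_nonneg y]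
  -- the gradient `(a, b)` is a multiple of `rotLeft (x, y)`
  obtain ⟨m, hm⟩ : ∃ m, m = (a * -y + b * x) / (x ^ 2 + y ^ 2) := ⟨_, rfl⟩
  have hm0 : m ≤ 0 := hm ▸ div_nonpos_of_nonpos_of_nonneg h2 hT'.le
  rw [eq_div_iff hT'.ne'] at hm
  have ha : a = -y * m := by
    refine mul_right_cancel₀ hT'.ne' ?_
    linear_combination x * h1 + y * hm
  have hb : b = x * m := by
    refine mul_right_cancel₀ hT'.ne' ?_
    linear_combination y * h1 - x * hm
  have key : (a * (u / q ^ 2) + b * (v / q ^ 2)) * -(ρ * (-(v * x) + u * y)) +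
      (a * (-v / (ρ * q ^ 2)) + b * (u / (ρ * q ^ 2))) * (u * x + v * y) =
      m * (((ρ * (-(v * x) + u * y)) ^ 2 + (u * x + v * y) ^ 2) / (ρ * q ^ 2)) := by
    rw [ha, hb]
    field_simp
    ring
  rw [key]
  exact mul_nonpos_of_nonpos_of_nonneg hm0 (by positivity)

namespace IsRepresentedFlow

variable {γ : ℝ} {f₁ f₂ : ℝ → ℝ} {l₁ l₂ : ℝ} {g₁ g₂ : ℝ → ℝ} {ψ₁ ψ₂ : ℝ} {u v θ φ ψ : ℝ × ℝ → ℝ}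
  {S : ℝ → ℝ × ℝ}

/-- The image of the flow and of its sonic curve in the potential plane. The limits of the
derivatives of the speed on the boundary are those of the derivatives along `potField₁` and `potField₂` in
the physical plane. -/
theorem exists_isSonicFlow (h : IsRepresentedFlow γ f₁ f₂ l₁ l₂ g₁ g₂ ψ₁ ψ₂ u v θ φ ψ)
    (hS : IsMeyerSonicCurve (critSpeed γ) (physNozzle f₁ f₂ l₁ l₂) (physWall f₁ l₁ l₂)
      (physWall f₂ l₁ l₂) (speed u v) S) :
    ∃ τ a b, ((τ = 1 ∧ S 0 ∈ physWall f₁ l₁ l₂ ∧ S 1 ∈ physWall f₂ l₁ l₂) ∨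
        (τ = -1 ∧ S 0 ∈ physWall f₂ l₁ l₂ ∧ S 1 ∈ physWall f₁ l₁ l₂)) ∧
      IsSonicFlow γ τ ψ₁ ψ₂ (toPot φ ψ '' physNozzle f₁ f₂ l₁ l₂)
        (fun w => speed u v (fromPot (physNozzle f₁ f₂ l₁ l₂) φ ψ w))
        (fun w => θ (fromPot (physNozzle f₁ f₂ l₁ l₂) φ ψ w)) (fun s => toPot φ ψ (S s))
        (fun s => potDeriv γ u v (S s) (derivWithin S (Icc 0 1) s)) a b := by
  have hγ := h.one_lt
  have hopen := h.nozzle.isOpen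
  have himg := h.isOpen_image
  have hqC := h.flow.contDiffOn_speed
  have hρC := h.flow.contDiffOn_density hγ
  have hθC := h.angle.contDiffOn h.flow hopen
  have hmem := fun {s} => hS.mem_closure (s := s)
  have hbox : ∀ {κ : ℝ} {p : ℝ × ℝ}, p ∈ closure (physNozzle f₁ f₂ l₁ l₂) →
      ((κ = 1 ∧ p ∈ physWall f₁ l₁ l₂) ∨ (κ = -1 ∧ p ∈ physWall f₂ l₁ l₂)) →
      HasHalfBox κ (toPot φ ψ '' physNozzle f₁ f₂ l₁ l₂) (toPot φ ψ p) := fun hp hκ =>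
    (h.potNozzle.hasHalfBox (hκ.imp (fun e => ⟨e.1, h.toPot_mem_wall (Or.inl ⟨rfl, rfl⟩) e.2⟩)
      (fun e => ⟨e.1, h.toPot_mem_wall (Or.inr ⟨rfl, rfl⟩) e.2⟩))).of_eventually
      (hκ.imp (fun e => e.1) (fun e => e.1))
      (h.eventually_mem_image hp (hκ.elim (fun e => e.2.1) (fun e => e.2.1)))
  have hw₁ : ∀ {p}, p ∈ physWall f₁ l₁ l₂ → (toPot φ ψ p).2 = ψ₁ := fun hp =>
    (h.toPot_mem_wall (Or.inl ⟨rfl, rfl⟩) hp).1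
  have hw₂ : ∀ {p}, p ∈ physWall f₂ l₁ l₂ → (toPot φ ψ p).2 = ψ₂ := fun hp =>
    (h.toPot_mem_wall (Or.inr ⟨rfl, rfl⟩) hp).1
  have hqd : ∀ z ∈ physNozzle f₁ f₂ l₁ l₂, DifferentiableAt ℝ (speed u v) z := fun z hz =>
    ((hqC.mono subset_closure).contDiffAt (hopen.mem_nhds hz)).differentiableAt (by norm_num)
  have hθd : ∀ z ∈ physNozzle f₁ f₂ l₁ l₂, DifferentiableAt ℝ θ z := fun z hz =>
    (hθC.contDiffAt (hopen.mem_nhds hz)).differentiableAt (by norm_num)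
  obtain ⟨τ, hτ⟩ : ∃ τ : ℝ, (τ = 1 ∧ S 0 ∈ physWall f₁ l₁ l₂ ∧ S 1 ∈ physWall f₂ l₁ l₂) ∨
      (τ = -1 ∧ S 0 ∈ physWall f₂ l₁ l₂ ∧ S 1 ∈ physWall f₁ l₁ l₂) := by
    rcases hS.ends with e | e
    · exact ⟨1, Or.inl ⟨rfl, e⟩⟩
    · exact ⟨-1, Or.inr ⟨rfl, e⟩⟩
  have m0 : (0 : ℝ) ∈ Icc (0 : ℝ) 1 := ⟨le_rfl, zero_le_one⟩
  have m1 : (1 : ℝ) ∈ Icc (0 : ℝ) 1 := ⟨zero_le_one, le_rfl⟩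
  obtain ⟨g, hpart⟩ := exists_gradient_family hopen hqC
  have hE₁ := h.flow.contDiffOn_potField₁
  have hE₂ := h.flow.contDiffOn_potField₂ hγ
  have htendsto : ∀ (E : ℝ × ℝ → ℝ × ℝ) (F : ℝ × ℝ → ℝ),
      ContDiffOn ℝ 2 E (closure (physNozzle f₁ f₂ l₁ l₂)) →
      (∀ z ∈ physNozzle f₁ f₂ l₁ l₂, F (toPot φ ψ z) = fderiv ℝ (speed u v) z (E z)) →
      ∀ p ∈ closure (physNozzle f₁ f₂ l₁ l₂),
      Tendsto F (𝓝[toPot φ ψ '' physNozzle f₁ f₂ l₁ l₂] toPot φ ψ p) (𝓝 (g p p (E p))) := by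
    intro E F hE hF p hp
    have h1 := (tendsto_of_eventuallyEq_contDiff (hpart E hE p hp).1 (hpart E hE p hp).2).comp
      (h.tendsto_fromPot hp)
    refine h1.congr' ?_
    filter_upwards [self_mem_nhdsWithin]
    rintro _ ⟨z, hz, rfl⟩
    rw [Function.comp_apply, h.fromPot_toPot (subset_closure hz), hF z hz]
  refine ⟨τ, fun s => g (S s) (S s) (potField₁ u v (S s)),
    fun s => g (S s) (S s) (potField₂ γ u v (S s)), hτ, ?_⟩
  refine
    { isOpen := himg
      strip := fun w hw => h.image_strip hw
      lt := h.potNozzle.lt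
      contDiffOn_q := h.contDiffOn_comp_fromPot le_rfl (hqC.mono subset_closure)
      contDiffOn_θ := h.contDiffOn_comp_fromPot le_rfl hθC
      chaplygin₁ := ?_
      chaplygin₂ := ?_
      continuousOn := h.continuousOn_toPot.comp hS.contDiffOn.continuousOn fun s hs => (hmem hs).1
      hasDerivAt := fun s hs => ?_
      continuousOn_deriv := ?_
      regular := fun s hs h0 => hS.regular s hs
        (h.flow.eq_zero_of_potDeriv_eq_zero hγ (hmem hs).1 h0)
      injOn := fun s hs t ht he => hS.injOn hs ht (h.rep.bijOn.injOn (hmem hs).1 (hmem ht).1 he)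
      mem := fun s hs => mem_image_of_mem _ (hS.mem_nozzle s hs)
      ends := hτ.imp (fun e => ⟨e.1, hw₁ e.2.1, hw₂ e.2.2⟩) (fun e => ⟨e.1, hw₂ e.2.1, hw₁ e.2.2⟩)
      start_box := hbox (hmem m0).1 (hτ.imp (fun e => ⟨e.1, e.2.1⟩) (fun e => ⟨e.1, e.2.1⟩))
      end_box := hbox (hmem m1).1 (hτ.symm.imp (fun e => ⟨by rw [e.1, neg_neg], e.2.2⟩)
        (fun e => ⟨by rw [e.1], e.2.2⟩))
      sonic := ?_
      q_eq := fun s hs => by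
        have e := hmem (Ioo_subset_Icc_self hs)
        rw [h.fromPot_toPot e.1]
        exact e.2
      tendsto_q := fun s hs => by
        have e : Tendsto (speed u v) _ _ := (hqC (S s) (hmem hs).1).continuousWithinAt
        rw [(hmem hs).2] at e
        exact (e.mono_left (nhdsWithin_mono _ subset_closure)).comp (h.tendsto_fromPot (hmem hs).1)
      tendsto₁ := fun s hs => htendsto (potField₁ u v) _ hE₁
        (fun z hz => h.pd₁_comp_fromPot hz (hqd z hz)) _ (hmem hs).1
      tendsto₂ := fun s hs => htendsto (potField₂ γ u v) _ hE₂
        (fun z hz => h.pd₂_comp_fromPot hz (hqd z hz)) _ (hmem hs).1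
      bounded := ?_
      left := ?_ }
  · rintro _ ⟨z, hz, rfl⟩
    rw [h.pd₂_comp_fromPot hz (hθd z hz), h.pd₁_comp_fromPot hz (hqd z hz),
      h.fromPot_toPot (subset_closure hz)]
    exact (h.chaplygin hz).1
  · rintro _ ⟨z, hz, rfl⟩
    rw [h.pd₁_comp_fromPot hz (hθd z hz), h.pd₂_comp_fromPot hz (hqd z hz),
      h.fromPot_toPot (subset_closure hz)]
    exact (h.chaplygin hz).2
  · have hz := hS.mem_nozzle s hs
    have e := (h.differentiableAt_toPot hz).hasFDerivAt.comp_hasDerivAt s (hS.hasDerivAt hs)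
    rw [h.fderiv_toPot hz] at e
    exact e
  · have hSc : ContinuousOn S (Icc 0 1) := hS.contDiffOn.continuousOn
    have hu := h.flow.contDiffOn_u.continuousOn.comp hSc fun s hs => (hmem hs).1
    have hv := h.flow.contDiffOn_v.continuousOn.comp hSc fun s hs => (hmem hs).1
    have hρ := hρC.continuousOn.comp hSc fun s hs => (hmem hs).1
    have h1 := hS.continuousOn_deriv.fst
    have h2 := hS.continuousOn_deriv.snd
    exact ((hu.mul h1).add (hv.mul h2)).prodMk (hρ.mul ((hv.mul h1).neg.add (hu.mul h2)))
  · rintro _ ⟨z, hz, rfl⟩ hzc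
    simp only [h.fromPot_toPot (subset_closure hz)] at hzc
    have h1 : z ∈ S '' Icc 0 1 := by
      rw [hS.image_eq]
      exact ⟨subset_closure hz, hzc⟩
    obtain ⟨s, hs, rfl⟩ := h1
    exact ⟨s, hs, rfl⟩
  · intro s hs
    have hp := (hmem hs).1
    set F : ℝ × ℝ → ℝ := fun z => fderiv ℝ (speed u v) z (potField₁ u v z)
    obtain ⟨M, hM⟩ := exists_bound_fderiv (F := F) hopen (hpart _ hE₁ _ hp).1 (hpart _ hE₁ _ hp).2
    have hFC : ContDiffOn ℝ 1 F (physNozzle f₁ f₂ l₁ l₂) := by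
      have h1 := ((contDiffOn_succ_iff_fderiv_of_isOpen (n := 1) hopen).1
        (by simpa [one_add_one_eq_two] using hqC.mono subset_closure)).2.2
      exact h1.clm_apply ((hE₁.mono subset_closure).of_le one_le_two)
    have hFd : ∀ z ∈ physNozzle f₁ f₂ l₁ l₂, DifferentiableAt ℝ F z := fun z hz =>
      (hFC.contDiffAt (hopen.mem_nhds hz)).differentiableAt (by norm_num)
    have hN : ∀ E : ℝ × ℝ → ℝ × ℝ, ContDiffOn ℝ 2 E (closure (physNozzle f₁ f₂ l₁ l₂)) →
        ∀ᶠ z in 𝓝[physNozzle f₁ f₂ l₁ l₂] S s, ‖E z‖ < ‖E (S s)‖ + 1 := fun E hE => by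
      have h1 : Tendsto E _ _ := (hE _ hp).continuousWithinAt
      exact (h1.mono_left (nhdsWithin_mono _ subset_closure)).norm.eventually
        (gt_mem_nhds (lt_add_one _))
    have heq : ∀ z ∈ physNozzle f₁ f₂ l₁ l₂,
        pd₁ (fun w => speed u v (fromPot (physNozzle f₁ f₂ l₁ l₂) φ ψ w)) =ᶠ[𝓝 (toPot φ ψ z)]
          fun w => F (fromPot (physNozzle f₁ f₂ l₁ l₂) φ ψ w) := by
      intro z hz
      filter_upwards [himg.mem_nhds (mem_image_of_mem _ hz)]
      rintro _ ⟨y, hy, rfl⟩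
      rw [h.pd₁_comp_fromPot hy (hqd y hy), h.fromPot_toPot (subset_closure hy)]
    refine ⟨max (M * (‖potField₁ u v (S s)‖ + 1)) (M * (‖potField₂ γ u v (S s)‖ + 1)), ?_⟩
    filter_upwards [(h.tendsto_fromPot hp).eventually hM,
      (h.tendsto_fromPot hp).eventually (hN _ hE₁),
      (h.tendsto_fromPot hp).eventually (hN _ hE₂), self_mem_nhdsWithin]
    rintro _ h1 h2 h3 ⟨z, hz, rfl⟩
    rw [h.fromPot_toPot (subset_closure hz)] at h1 h2 h3
    have hM0 : 0 ≤ M := (norm_nonneg _).trans h1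
    rw [pd₁, pd₂, (heq z hz).fderiv_eq, ← pd₁, ← pd₂,
      h.pd₁_comp_fromPot hz (hFd z hz), h.pd₂_comp_fromPot hz (hFd z hz)]
    exact ⟨(((fderiv ℝ F z).le_opNorm _).trans (mul_le_mul h1 h2.le (norm_nonneg _) hM0)).trans
        (le_max_left _ _),
      (((fderiv ℝ F z).le_opNorm _).trans (mul_le_mul h1 h3.le (norm_nonneg _) hM0)).trans
        (le_max_right _ _)⟩
  · intro s hs
    have hz := hS.mem_nozzle s hs
    have hzc := hmem (Ioo_subset_Icc_self hs)
    have h1 : fderiv ℝ (speed u v) (S s) (derivWithin S (Icc 0 1) s) = 0 := by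
      refine ((hqd _ hz).hasFDerivAt.comp_hasDerivAt s (hS.hasDerivAt hs)).unique ?_
      refine (hasDerivAt_const s (critSpeed γ)).congr_of_eventuallyEq ?_
      filter_upwards [Ioo_mem_nhds hs.1 hs.2] with t ht using (hmem (Ioo_subset_Icc_self ht)).2
    have h2 := fderiv_nonpos_of_eventually_lt (hqd _ hz) hzc.2 (hS.left_subsonic s hs)
    rw [fderiv_eq_pd, h.pd₁_comp_fromPot hz (hqd _ hz), h.pd₂_comp_fromPot hz (hqd _ hz)]
    rw [fderiv_eq_pd] at h1 h2 ⊢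
    rw [fderiv_eq_pd]
    exact left_nonpos_transfer (h.flow.density_pos hγ hzc.1) (h.flow.pos _ hzc.1)
      (hS.regular s (Ioo_subset_Icc_self hs)) h1 h2

end IsRepresentedFlow

namespace IsRepresentedFlow

variable {γ : ℝ} {f₁ f₂ : ℝ → ℝ} {l₁ l₂ : ℝ} {g₁ g₂ : ℝ → ℝ} {ψ₁ ψ₂ : ℝ} {u v θ φ ψ : ℝ × ℝ → ℝ}
  {S : ℝ → ℝ × ℝ}

/-- Along an interval of exceptional parameters the velocity is constant, since its modulus is `c`
and its angle does not change, and `S` is orthogonal to it. Hence this part of `S` is straight. -/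
theorem image_exceptional_eq_segment (h : IsRepresentedFlow γ f₁ f₂ l₁ l₂ g₁ g₂ ψ₁ ψ₂ u v θ φ ψ)
    (hS : IsMeyerSonicCurve (critSpeed γ) (physNozzle f₁ f₂ l₁ l₂) (physWall f₁ l₁ l₂)
      (physWall f₂ l₁ l₂) (speed u v) S) {a b : ℝ} (ha : 0 ≤ a) (hab : a ≤ b) (hb : b ≤ 1)
    (hθ : ∀ s ∈ Icc a b, θ (S s) = θ (S a))
    (hT : ∀ s ∈ Icc a b, (potDeriv γ u v (S s) (derivWithin S (Icc 0 1) s)).1 = 0) :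
    S '' Icc a b = segment ℝ (S a) (S b) := by
  have hsub : Icc a b ⊆ Icc 0 1 := Icc_subset_Icc ha hb
  have haI : a ∈ Icc a b := left_mem_Icc.2 hab
  have hc := critSpeed_pos h.one_lt
  have hu : ∀ s ∈ Icc a b, u (S s) = u (S a) := fun s hs => by
    rw [h.angle.u_eq _ (hS.mem_closure (hsub hs)).1, h.angle.u_eq _ (hS.mem_closure (hsub haI)).1,
      (hS.mem_closure (hsub hs)).2, (hS.mem_closure (hsub haI)).2, hθ s hs]
  have hv : ∀ s ∈ Icc a b, v (S s) = v (S a) := fun s hs => by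
    rw [h.angle.v_eq _ (hS.mem_closure (hsub hs)).1, h.angle.v_eq _ (hS.mem_closure (hsub haI)).1,
      (hS.mem_closure (hsub hs)).2, (hS.mem_closure (hsub haI)).2, hθ s hs]
  have hn : (u (S a), v (S a)) ≠ ((0, 0) : ℝ × ℝ) := fun h0 => by
    have h1 := speed_sq u v (S a)
    obtain ⟨hu0, hv0⟩ := Prod.mk.inj h0
    rw [(hS.mem_closure (hsub haI)).2, hu0, hv0] at h1
    nlinarith
  refine image_Icc_eq_segment hab (hS.contDiffOn.continuousOn.mono hsub) (hS.injOn.mono hsub) hn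
    fun s hs => ?_
  have hder : ∀ t ∈ Icc (0 : ℝ) 1, HasDerivWithinAt
      (fun t => u (S a) * (S t).1 + v (S a) * (S t).2)
      (u (S a) * (derivWithin S (Icc 0 1) t).1 + v (S a) * (derivWithin S (Icc 0 1) t).2)
      (Icc 0 1) t := fun t ht =>
    ((hasDerivWithinAt_coord₁ (hS.hasDerivWithinAt ht)).const_mul _).add
      ((hasDerivWithinAt_coord₂ (hS.hasDerivWithinAt ht)).const_mul _)
  have := eq_of_deriv_eq_zero hder ha hb (fun t ht => by
    rw [← hu t ht, ← hv t ht]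
    exact hT t ht) s hs
  simp only at this ⊢
  linarith

theorem exists_decomposition (h : IsRepresentedFlow γ f₁ f₂ l₁ l₂ g₁ g₂ ψ₁ ψ₂ u v θ φ ψ)
    (hS : IsMeyerSonicCurve (critSpeed γ) (physNozzle f₁ f₂ l₁ l₂) (physWall f₁ l₁ l₂)
      (physWall f₂ l₁ l₂) (speed u v) S) :
    ∃ Sp Sm : Set (ℝ × ℝ),
      IsDecomposition (physWall f₁ l₁ l₂) (physWall f₂ l₁ l₂) (S '' Icc 0 1)
        (exceptionalSet θ S) Sp Sm ∧
      (exceptionalSet θ S = ∅ ∨ ∃ a b : ℝ × ℝ, exceptionalSet θ S = segment ℝ a b) ∧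
      HasPotentialShape (fun s => toPot φ ψ (S s)) (toPot φ ψ '' exceptionalSet θ S)
        (toPot φ ψ '' Sp) (toPot φ ψ '' Sm) := by
  have hγ := h.one_lt
  obtain ⟨τ, a, b, hτ, hf⟩ := h.exists_isSonicFlow hS
  have huni := hf.isUnimodalSign hγ
  have hcont := hf.continuousOn_deriv.fst
  have hθ : ContinuousOn (fun s => θ (S s)) (Icc 0 1) :=
    h.angle.cont.comp hS.contDiffOn.continuousOn fun s hs => (hS.mem_closure hs).1
  have hθ' : ∀ s ∈ Ioo (0 : ℝ) 1, θ (S s) =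
      θ (fromPot (physNozzle f₁ f₂ l₁ l₂) φ ψ (toPot φ ψ (S s))) := fun s hs => by
    rw [h.fromPot_toPot (hS.mem_closure (Ioo_subset_Icc_self hs)).1]
  set T : ℝ → ℝ × ℝ := fun s => potDeriv γ u v (S s) (derivWithin S (Icc 0 1) s)
  have hE : exceptionalSet θ S = S '' {s ∈ Icc (0 : ℝ) 1 | (T s).1 = 0} :=
    congrArg (S '' ·) (ext fun s => and_congr_right fun hs =>
      hf.derivWithin_angle_eq_zero_iff hγ hθ hθ' hs)
  have hτ0 : τ ≠ 0 := by rcases hf.sign with rfl | rfl <;> norm_num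
  refine ⟨S '' {s ∈ Icc (0 : ℝ) 1 | (T s).1 < 0}, S '' {s ∈ Icc (0 : ℝ) 1 | 0 < (T s).1}, ?_⟩
  rw [hE]
  refine ⟨huni.isDecomposition hcont hS.contDiffOn.continuousOn hS.injOn hτ, ?_, ?_⟩
  · rcases huni.zero_eq_Icc hτ0 hcont with h0 | ⟨r, t, hr, hrt, ht, h0⟩
    · exact Or.inl (by rw [h0, image_empty])
    · right
      refine ⟨S r, S t, ?_⟩
      have hz : ∀ s ∈ Icc r t, (T s).1 = 0 := fun s hs => by
        rw [← h0] at hs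
        exact hs.2
      rw [h0]
      refine h.image_exceptional_eq_segment hS hr hrt ht ?_ hz
      exact eq_of_deriv_eq_zero (fun s hs => hf.hasDerivWithinAt_angle hγ hθ hθ' hs) hr ht
        fun s hs => by rw [hz s hs, mul_zero]
  · simp only [image_image]
    exact huni.hasPotentialShape hf.sign
      (hasDerivWithinAt_Icc_of_Ioo hf.continuousOn hf.hasDerivAt hf.continuousOn_deriv)
      hf.continuousOn_deriv hf.injOn

end IsRepresentedFlow

end TransonicFlow

end

theorem mainTheorem6 (γ : ℝ) (hγ : 1 < γ) :
    -- the potential plane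
    (∀ (g₁ g₂ : ℝ → ℝ) (ψ₁ ψ₂ : ℝ) (q θ : ℝ × ℝ → ℝ) (S : ℝ → ℝ × ℝ),
      TransonicFlow.IsPotNozzle g₁ g₂ ψ₁ ψ₂ →
      TransonicFlow.IsPotFlow γ (TransonicFlow.potNozzle g₁ g₂ ψ₁ ψ₂) q θ →
      TransonicFlow.IsMeyerSonicCurve (TransonicFlow.critSpeed γ)
        (TransonicFlow.potNozzle g₁ g₂ ψ₁ ψ₂)
        (TransonicFlow.potWall g₁ g₂ ψ₁) (TransonicFlow.potWall g₁ g₂ ψ₂) q S →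
      ∃ Sp Sm : Set (ℝ × ℝ),
        TransonicFlow.IsDecomposition
          (TransonicFlow.potWall g₁ g₂ ψ₁) (TransonicFlow.potWall g₁ g₂ ψ₂)
          (S '' Set.Icc 0 1) (TransonicFlow.exceptionalSet θ S) Sp Sm ∧
        TransonicFlow.HasPotentialShape S (TransonicFlow.exceptionalSet θ S) Sp Sm) ∧
    -- the physical plane
    (∀ (f₁ f₂ : ℝ → ℝ) (l₁ l₂ : ℝ) (g₁ g₂ : ℝ → ℝ) (ψ₁ ψ₂ : ℝ)
        (u v θ φ ψ : ℝ × ℝ → ℝ) (S : ℝ → ℝ × ℝ),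
      TransonicFlow.IsPhysNozzle f₁ f₂ l₁ l₂ →
      TransonicFlow.IsPotNozzle g₁ g₂ ψ₁ ψ₂ →
      TransonicFlow.IsPhysFlow γ (TransonicFlow.physNozzle f₁ f₂ l₁ l₂) u v →
      TransonicFlow.IsFlowAngle (TransonicFlow.physNozzle f₁ f₂ l₁ l₂) u v θ →
      TransonicFlow.IsVelocityPotential (TransonicFlow.physNozzle f₁ f₂ l₁ l₂) u v φ →
      TransonicFlow.IsStreamFunction γ (TransonicFlow.physNozzle f₁ f₂ l₁ l₂) u v ψ →
      TransonicFlow.IsPotRepresentation f₁ f₂ l₁ l₂ g₁ g₂ ψ₁ ψ₂ φ ψ →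
      TransonicFlow.IsMeyerSonicCurve (TransonicFlow.critSpeed γ)
        (TransonicFlow.physNozzle f₁ f₂ l₁ l₂)
        (TransonicFlow.physWall f₁ l₁ l₂) (TransonicFlow.physWall f₂ l₁ l₂)
        (TransonicFlow.speed u v) S →
      ∃ Sp Sm : Set (ℝ × ℝ),
        TransonicFlow.IsDecomposition
          (TransonicFlow.physWall f₁ l₁ l₂) (TransonicFlow.physWall f₂ l₁ l₂)
          (S '' Set.Icc 0 1) (TransonicFlow.exceptionalSet θ S) Sp Sm ∧
        (TransonicFlow.exceptionalSet θ S = ∅ ∨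
          ∃ a b : ℝ × ℝ, TransonicFlow.exceptionalSet θ S = segment ℝ a b) ∧
        TransonicFlow.HasPotentialShape (fun s => TransonicFlow.toPot φ ψ (S s))
          (TransonicFlow.toPot φ ψ '' TransonicFlow.exceptionalSet θ S)
          (TransonicFlow.toPot φ ψ '' Sp) (TransonicFlow.toPot φ ψ '' Sm)) := by
  refine ⟨fun g₁ g₂ ψ₁ ψ₂ q θ S hG hq hS => ?_,
    fun f₁ f₂ l₁ l₂ g₁ g₂ ψ₁ ψ₂ u v θ φ ψ S hf hG hflow hθ hφ hψ hrep hS => ?_⟩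
  · exact TransonicFlow.exists_decomposition_of_pot hγ hG hq hS
  · exact TransonicFlow.IsRepresentedFlow.exists_decomposition
      ⟨hγ, hf, hG, hflow, hθ, hφ, hψ, hrep⟩ hS
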